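/- Let $d \ge 3$ and $s > 1/2$. For a Euclidean space $V$ of dimension $m\ge 2$ with unit sphere $S(V)$, equipped with the normalized $(m-1)$-dimensional Hausdorff measure $\sigma_{S(V)}$ (a probability measure), let $\pi_n$ be the orthogonal projection of $L^2(S(V);\mathbb{C})$ onto the spherical harmonics of degree $n$ (the restrictions to $S(V)$ of the harmonic homogeneous polynomials of degree $n$). For $r>0$ let $H^r_0(S(V))$ be the space of all mean-zero $f \in L^2(S(V);\mathbb{C})$ with $$\|f\|_{H^r_0(S(V))}^2 = \sum_{n=0}^\infty \bigl(n(n+m-2)\bigr)^r \, \|\pi_n f\|_{L^2}^2 < \infty .$$ Let $\sigma$ be the normalized Hausdorff measure on $S^{d-1}\subset\mathbb{R}^d$ and, for $\nu\in S^{d-1}$, let $\sigma_\nu$ be the normalized $(d-2)$-dimensional Hausdorff measure on the great sphere $\nu^\perp\cap S^{d-1}$. Put $$\mathcal{M}_d=\{(\nu,\theta)\in S^{d-1}\times S^{d-1} : \nu\cdot\theta=0\}.$$ Then there are a constant $C>0$ and a map $\Omega\mapsto\Gamma=\Gamma_\Omega$, assigning functions $\Gamma_\Omega:\mathcal{M}_d\to\mathbb{C}$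 to functions $\Omega : S^{d-1}\to\mathbb{C}$, such that the following holds. 1. For every $\Omega\in H^s_0(S^{d-1})$ and for every $\nu\in S^{d-1}$, we have $\Gamma_\Omega(\nu,\cdot) \in H^{s-1/2}_0(\nu^\perp\cap S^{d-1})$; in particular $$\int_{\nu^\perp\cap S^{d-1}} \Gamma_\Omega(\nu,\theta)\,d\sigma_\nu(\theta)=0, \qquad \text{and}\qquad \|\Gamma_\Omega(\nu,\cdot)\|_{H^{s-1/2}_0(\nu^\perp\cap S^{d-1})}\le C\,\|\Omega\|_{H^s_0(S^{d-1})}.$$ 2. For every $\Omega\in H^s_0(S^{d-1})$ we have, as measures on $S^{d-1}$, $$\Omega(\theta)\,\sigma(\theta)=\int_{S^{d-1}}\Gamma_\Omega(\nu,\theta)\,\sigma_\nu(\theta)\,d\sigma(\nu),$$ that is, for every Borel set $B\subseteq S^{d-1}$ the function $\nu\mapsto\int_{B\cap\nu^\perp}\Gamma_\Omega(\nu,\theta)\,d\sigma_\nu(\theta)$ is $\sigma$-integrable and its $\sigma$-integral equals $\int_B\Omega\,d\sigma$. 3. For every integer $k\ge0$, the map $\Omega\mapsto\Gamma_\Omega$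 sends the mean-zero functions in $C^k(S^{d-1})$ to $C^k(\mathcal{M}_d)$, and it is continuous with respect to the $C^k$ norms. -/

import Mathlib

open MeasureTheory Set
open scoped ENNReal RealInnerProductSpace

noncomputable section

namespace GreatSphere

section Sphere

variable (V : Type*) [NormedAddCommGroup V] [InnerProductSpace ℝ V]

/-- The unit sphere of a Euclidean space `V`, as a type. -/
abbrev USphere : Type _ := Metric.sphere (0 : V) 1

/-- The normalized Hausdorff measure (of dimension `dim V - 1`) on the unit sphere of `V`. -/
def sphereMeasure [MeasurableSpace V] [BorelSpace V] : Measure (USphere V) :=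
  (μH[(Module.finrank ℝ V : ℝ) - 1] (univ : Set (USphere V)))⁻¹ •
    (μH[(Module.finrank ℝ V : ℝ) - 1] : Measure (USphere V))

variable [FiniteDimensional ℝ V]

/-- The forms `A` for which the homogeneous polynomial `x ↦ A (x, …, x)` of degree `n`
on `V` is harmonic. Every complex homogeneous polynomial of degree `n` on `V` is the diagonal of
such an `n`-linear form. -/
def harmonicForms (n : ℕ) : Submodule ℂ (V [×n]→L[ℝ] ℂ) where
  carrier := {A | InnerProductSpace.HarmonicOnNhd (fun x : V => A fun _ => x) univ}
  add_mem' := fun {A B} hA hB => by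
    have := hA.add hB
    exact this
  zero_mem' := fun x _ => by
    refine ⟨contDiffAt_const, Filter.Eventually.of_forall fun y => ?_⟩
    exact congrFun (InnerProductSpace.laplacian_const (c := (0 : ℂ))) y
  smul_mem' := fun c A hA x hx =>
    (hA x hx).comp_CLM (l := (ContinuousLinearMap.mul ℝ ℂ c))

variable [MeasurableSpace V] [BorelSpace V]

/-- The space of spherical harmonics of degree `n`: the restrictions to the unit sphere of the
harmonic homogeneous polynomials of degree `n`, as a subspace of `L²`. -/
def sphericalHarmonics (n : ℕ) : Submodule ℂ (Lp ℂ 2 (sphereMeasure V)) where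
  carrier := {f | ∃ A ∈ harmonicForms V n,
    f =ᵐ[sphereMeasure V] fun x => A fun _ => (x : V)}
  add_mem' := by
    rintro f g ⟨A, hA, hf⟩ ⟨B, hB, hg⟩
    refine ⟨A + B, add_mem hA hB, ?_⟩
    filter_upwards [Lp.coeFn_add f g, hf, hg] with x h h1 h2
    rw [h, Pi.add_apply, h1, h2]
    rfl
  zero_mem' := ⟨0, zero_mem _, by
    filter_upwards [Lp.coeFn_zero ℂ 2 (sphereMeasure V)] with x h
    exact h⟩
  smul_mem' := by
    rintro c f ⟨A, hA, hf⟩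
    refine ⟨c • A, Submodule.smul_mem _ c hA, ?_⟩
    filter_upwards [Lp.coeFn_smul c f, hf] with x h h1
    rw [h, Pi.smul_apply, h1]
    rfl

instance finiteDimensional_multilinear (n : ℕ) : FiniteDimensional ℂ (V [×n]→L[ℝ] ℂ) := by
  have h : Module.Finite ℝ (V [×n]→L[ℝ] ℂ) :=
    Module.Finite.of_injective
      ({ toFun := fun A => A.toMultilinearMap
         map_add' := fun _ _ => rfl
         map_smul' := fun _ _ => rfl } :
        (V [×n]→L[ℝ] ℂ) →ₗ[ℝ] MultilinearMap ℝ (fun _ : Fin n => V) ℂ)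
      ContinuousMultilinearMap.toMultilinearMap_injective
  exact Module.Finite.of_restrictScalars_finite ℝ ℂ _

/-- The space of spherical harmonics of a given degree is finite-dimensional; this makes the
orthogonal projection onto it available. -/
instance finiteDimensional_sphericalHarmonics (n : ℕ) :
    FiniteDimensional ℂ (sphericalHarmonics V n) := by
  choose φ hφ hφ' using fun f : sphericalHarmonics V n => f.2
  let W : Submodule ℂ ((V [×n]→L[ℝ] ℂ) × sphericalHarmonics V n) :=
    { carrier := {p | (p.2 : Lp ℂ 2 (sphereMeasure V)) =ᵐ[sphereMeasure V]
        fun x => p.1 fun _ => (x : V)}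
      add_mem' := by
        rintro ⟨A, f⟩ ⟨B, g⟩ hf hg
        change ((f + g : Lp ℂ 2 (sphereMeasure V)) : USphere V → ℂ) =ᵐ[sphereMeasure V] _
        filter_upwards [Lp.coeFn_add (f : Lp ℂ 2 (sphereMeasure V)) g, hf, hg] with x h h1 h2
        rw [h, Pi.add_apply, h1, h2]
        rfl
      zero_mem' := by
        change ((0 : Lp ℂ 2 (sphereMeasure V)) : USphere V → ℂ) =ᵐ[sphereMeasure V] _
        filter_upwards [Lp.coeFn_zero ℂ 2 (sphereMeasure V)] with x h
        exact h
      smul_mem' := by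
        rintro c ⟨A, f⟩ hf
        change ((c • f : Lp ℂ 2 (sphereMeasure V)) : USphere V → ℂ) =ᵐ[sphereMeasure V] _
        filter_upwards [Lp.coeFn_smul c (f : Lp ℂ 2 (sphereMeasure V)), hf] with x h h1
        rw [h, Pi.smul_apply, h1]
        rfl }
  have hinj : Function.Injective ((LinearMap.fst ℂ _ _).comp W.subtype) := by
    rintro ⟨⟨A, f⟩, hf⟩ ⟨⟨B, g⟩, hg⟩ h
    obtain rfl : A = B := h
    have hfg : f = g := Subtype.ext (Lp.ext (Filter.EventuallyEq.trans (show _ =ᵐ[_] _ from hf)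
      (Filter.EventuallyEq.symm (show _ =ᵐ[_] _ from hg))))
    subst hfg
    rfl
  have hW : Module.Finite ℂ W := Module.Finite.of_injective _ hinj
  refine Module.Finite.of_surjective ((LinearMap.snd ℂ _ _).comp W.subtype) fun f => ?_
  exact ⟨⟨(φ f, f), hφ' f⟩, rfl⟩

open Classical in
/-- The Sobolev norm of order `s` of a function `f` on the unit sphere of `V`, with values in
`[0, ∞]`: its square is `∑ₙ (n (n + dim V - 2)) ^ s ‖πₙ f‖²`, where `πₙ` is the orthogonal
projection of `L²` onto the spherical harmonics of degree `n`, and where `n (n + dim V - 2)` is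
the absolute value of the corresponding eigenvalue of the spherical Laplacian. It is `∞` for
functions that are not in `L²`. -/
def sobolevNorm (s : ℝ) (f : USphere V → ℂ) : ℝ≥0∞ :=
  if hf : MemLp f 2 (sphereMeasure V) then
    (∑' n : ℕ, ENNReal.ofReal (((n : ℝ) * ((n : ℝ) + (Module.finrank ℝ V : ℝ) - 2)) ^ s) *
      ‖(sphericalHarmonics V n).starProjection (hf.toLp f)‖ₑ ^ 2) ^ (1 / 2 : ℝ)
  else ∞

/-- Membership in `H^s_0`: square integrable functions with finite Sobolev norm of order `s` and
with mean zero. -/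
def MemSobolevZero (s : ℝ) (f : USphere V → ℂ) : Prop :=
  MemLp f 2 (sphereMeasure V) ∧ sobolevNorm V s f < ∞ ∧ ∫ x, f x ∂(sphereMeasure V) = 0

end Sphere

section Ck

variable {E : Type*} [NormedAddCommGroup E] [NormedSpace ℝ E] {M : Set E}

/-- `f` is of class `C^k` on the (compact embedded sub-) manifold `M` of `E`: it is the restriction
of a `C^k` function on `E`. -/
def IsCk (k : ℕ) (f : M → ℂ) : Prop :=
  ∃ g : E → ℂ, ContDiff ℝ k g ∧ ∀ x : M, g x = f x

/-- The `C^k` norm on the (compact embedded sub-) manifold `M` of `E`: the infimum, over all `C^k`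
extensions of `f` to `E`, of the largest size on `M` of a derivative of order at most `k`. -/
def ckNorm (k : ℕ) (f : M → ℂ) : ℝ≥0∞ :=
  ⨅ (g : E → ℂ) (_ : ContDiff ℝ k g ∧ ∀ x : M, g x = f x),
    ⨆ (x : M) (j : ℕ) (_ : j ≤ k), ‖iteratedFDeriv ℝ j g (x : E)‖ₑ

end Ck

/-- Euclidean space `ℝ^d`. -/
abbrev Euc (d : ℕ) : Type := EuclideanSpace ℝ (Fin d)

/-- The manifold of all pairs `(ν, θ)` of orthogonal unit vectors in `ℝ^d`. -/
def orthoPairs (d : ℕ) : Set (Euc d × Euc d) :=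
  {p | ‖p.1‖ = 1 ∧ ‖p.2‖ = 1 ∧ ⟪p.1, p.2⟫ = 0}

variable {d : ℕ}

/-- The hyperplane `(lin ν)^⊥`, a Euclidean space of dimension `d - 1`. Its unit sphere
`USphere (hyperplane ν)` is the great sphere orthogonal to `ν`. -/
abbrev hyperplane (ν : USphere (Euc d)) : Submodule ℝ (Euc d) := (Submodule.span ℝ {(ν : Euc d)})ᗮ

/-- The inclusion of the great sphere orthogonal to `ν` into the unit sphere of `ℝ^d`. -/
def incl (ν : USphere (Euc d)) (θ : USphere (hyperplane ν)) : USphere (Euc d) :=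
  ⟨((θ : hyperplane ν) : Euc d),
    mem_sphere_zero_iff_norm.2 (norm_eq_of_mem_sphere θ)⟩

/-- The pair `(ν, θ)`, for `θ` in the great sphere orthogonal to `ν`. -/
def pair (ν : USphere (Euc d)) (θ : USphere (hyperplane ν)) : orthoPairs d :=
  ⟨((ν : Euc d), (incl ν θ : Euc d)), norm_eq_of_mem_sphere ν, norm_eq_of_mem_sphere (incl ν θ),
    (Submodule.mem_orthogonal_singleton_iff_inner_right).1 (θ : hyperplane ν).2⟩

end GreatSphere

end

/-!
The function `Γ_Ω (ν, ·)` is the restriction of `Ω` to the great sphere `ν^⊥ ∩ S^{d-1}`, minus a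
zonal average of this restriction over the same great sphere, with the weight `c |sin t|` in the
angle `t` (`greatPart`, `sinKernel`).

*Decomposition.* A uniform point of a uniformly chosen great sphere is uniform on `S^{d-1}`
(`integral_great`), so the restrictions of `Ω`, integrated over `ν`, give back `Ω σ`. Two
independent uniform points of a uniformly chosen great sphere have a joint density with respect to
`σ × σ` that is proportional to `1 / |sin t|`, so the weight turns them into independent points of
`S^{d-1}` (`integral_great_pair`). Hence the corrections, integrated over `ν`, contribute
`(∫ Ω dσ) σ = 0` (`integral_greatPart`). On the other hand a zonal average with a weight of mass one
keeps the mean, so `Γ_Ω (ν, ·)` has mean zero, and it commutes with rotations, so it does not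
increase the norm of any `π_n f`. Therefore `Γ_Ω (ν, ·)` has at most twice the Sobolev norm of the
restriction (`memSobolevZero_sub_zonal`).

*The Sobolev estimate* is the trace theorem with the loss of half a derivative, for each great
sphere. On a great circle through `ν`, a polynomial of degree `M` is a trigonometric polynomial of
degree `M`, so its square at a point is at most a multiple of `M` times its square mean
(`TrigPoly.enorm_zero_sq_le`); integration over all these circles bounds the `L²` norm on
`ν^⊥ ∩ S^{d-1}` by `M^{1/2}` times the `L²` norm on `S^{d-1}` (`lintegral_trace_sq_le`). This is
applied to the dyadic blocks of the expansion of `Ω` in spherical harmonics. The block of degrees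
below `2^{j+1}` has only degrees below `2^{j+1}` on the great sphere as well, so in the component of
degree `l` there only the blocks with `l < 2^{j+1}` contribute, and because of `s > 1/2` a weighted
Cauchy–Schwarz inequality sums them up (`sum_sobWeight_trace_le`).

*Restriction to every great sphere.* As `Ω` is only defined almost everywhere, restricting it to
each great sphere needs a good representative (`bestRep`). For discontinuous `Ω` it is the limit of
the dyadic partial sums of the expansion in spherical harmonics, where it exists (`preciseRep`);
these converge almost everywhere on each great sphere because the blocks decay geometrically in
`L²`. For continuous `Ω` it is `Ω` itself, and the estimate is obtained from polynomial
approximation (`sobEnergy_continuous_le`).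

*Smoothness.* Near each orthonormal pair, the great spheres can be parametrized by a fixed one
through a product of two reflections that depends smoothly on the pair (`frameMap`). The correction
is then, after a partition of unity, a sum of integrals over fixed great spheres of functions that
are composed with a smooth map, and differentiation under the integral sign bounds its `C^k` norm
(`exists_ckNorm_greatPart_le`). As `Ω ↦ Γ_Ω` is linear on continuous functions, this gives
continuity.
-/

set_option linter.unusedSectionVars false

namespace GreatSphere

/-! ### Invariant measures and the normalized Hausdorff measure on spheres -/

section Uniqueness

variable {X : Type*} [MetricSpace X] [CompactSpace X] [MeasurableSpace X] [BorelSpace X]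

lemma measurableSet_dist_lt (r : ℝ) : MeasurableSet {p : X × X | dist p.1 p.2 < r} :=
  (isOpen_lt continuous_dist continuous_const).measurableSet

lemma measure_ball_eq_of_transitive {μ : Measure X}
    (h : ∀ x y : X, ∃ e : X ≃ᵢ X, e x = y ∧ μ.map e = μ) (x y : X) (r : ℝ) :
    μ (Metric.ball x r) = μ (Metric.ball y r) := by
  obtain ⟨e, rfl, he⟩ := h x y
  conv_rhs => rw [← he]
  rw [Measure.map_apply e.continuous.measurable Metric.isOpen_ball.measurableSet,
    IsometryEquiv.preimage_ball, e.symm_apply_apply]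

lemma measure_ball_pos_of_transitive {μ : Measure X} [IsProbabilityMeasure μ]
    (h : ∀ x y : X, ∃ e : X ≃ᵢ X, e x = y ∧ μ.map e = μ) (x : X) {r : ℝ} (hr : 0 < r) :
    μ (Metric.ball x r) ≠ 0 := by
  intro h0
  obtain ⟨t, -, ht, hcov⟩ := (isCompact_univ (X := X)).finite_cover_balls hr
  have : μ univ ≤ 0 := by
    calc μ univ ≤ μ (⋃ y ∈ t, Metric.ball y r) := measure_mono hcov
      _ ≤ ∑ y ∈ ht.toFinset, μ (Metric.ball y r) := by
          have := measure_biUnion_finset_le (μ := μ) ht.toFinset (fun y => Metric.ball y r)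
          simpa using this
      _ = 0 := Finset.sum_eq_zero fun y _ => by
          rw [measure_ball_eq_of_transitive h y x, h0]
  simp at this

/-- Averaging a test function over balls of a fixed small radius, with respect to either measure,
shows that the integrals of the test function agree up to its modulus of continuity. -/
lemma lintegral_le_of_transitive {μ ν : Measure X} [IsProbabilityMeasure μ]
    [IsProbabilityMeasure ν]
    (h : ∀ x y : X, ∃ e : X ≃ᵢ X, e x = y ∧ μ.map e = μ ∧ ν.map e = ν)
    (f : BoundedContinuousFunction X NNReal) :
    ∫⁻ x, f x ∂μ ≤ ∫⁻ x, f x ∂ν := by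
  have hμ : ∀ x y : X, ∃ e : X ≃ᵢ X, e x = y ∧ μ.map e = μ := fun x y =>
    let ⟨e, h1, h2, _⟩ := h x y; ⟨e, h1, h2⟩
  have hν : ∀ x y : X, ∃ e : X ≃ᵢ X, e x = y ∧ ν.map e = ν := fun x y =>
    let ⟨e, h1, _, h2⟩ := h x y; ⟨e, h1, h2⟩
  have hfm : Measurable fun x => (f x : ℝ≥0∞) := f.continuous.measurable.coe_nnreal_ennreal
  obtain ⟨x₀⟩ : Nonempty X := μ.nonempty_of_neZero
  -- the double integral over the pairs at distance less than `r` of `g` at the first point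
  have key : ∀ (α β : Measure X) [IsProbabilityMeasure α] [IsProbabilityMeasure β]
      (_ : ∀ x y : X, ∃ e : X ≃ᵢ X, e x = y ∧ β.map e = β) (g : X → ℝ≥0∞) (r : ℝ),
      ∫⁻ x, ∫⁻ y, {p : X × X | dist p.1 p.2 < r}.indicator (fun p => g p.1) (x, y) ∂β ∂α
        = β (Metric.ball x₀ r) * ∫⁻ x, g x ∂α := by
    intro α β _ _ hβ g r
    rw [← lintegral_const_mul' _ _ (measure_ne_top _ _)]
    refine lintegral_congr fun x => ?_
    rw [← measure_ball_eq_of_transitive hβ x x₀, mul_comm, ← setLIntegral_const,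
      ← lintegral_indicator Metric.isOpen_ball.measurableSet]
    refine lintegral_congr fun y => ?_
    simp only [indicator, mem_ofPred_eq, Metric.mem_ball, dist_comm]
  have hmass : ∀ r : ℝ, μ (Metric.ball x₀ r) = ν (Metric.ball x₀ r) := by
    intro r
    have h1 := key ν μ hμ (fun _ => 1) r
    have h2 := key μ ν hν (fun _ => 1) r
    rw [lintegral_lintegral_swap] at h1
    · simp only [lintegral_const, measure_univ, mul_one] at h1 h2
      rw [← h1, ← h2]
      refine lintegral_congr fun x => lintegral_congr fun y => ?_
      simp only [indicator, mem_ofPred_eq, dist_comm]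
    · exact (measurable_const.indicator (measurableSet_dist_lt r)).aemeasurable
  refine ENNReal.le_of_forall_pos_le_add fun ε hε _ => ?_
  obtain ⟨r, hr, hfr⟩ := Metric.uniformContinuous_iff.1
    (CompactSpace.uniformContinuous_of_continuous f.continuous) ε hε
  have h0 := measure_ball_pos_of_transitive hμ x₀ hr
  have htop : μ (Metric.ball x₀ r) ≠ ∞ := measure_ne_top _ _
  rw [← ENNReal.mul_le_mul_iff_right h0 htop]
  calc μ (Metric.ball x₀ r) * ∫⁻ x, f x ∂μ
      = ∫⁻ x, ∫⁻ y, {p : X × X | dist p.1 p.2 < r}.indicator (fun p => (f p.1 : ℝ≥0∞)) (x, y)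
          ∂ν ∂μ := by rw [hmass, key μ ν hν (fun x => (f x : ℝ≥0∞)) r]
    _ = ∫⁻ y, ∫⁻ x, {p : X × X | dist p.1 p.2 < r}.indicator (fun p => (f p.1 : ℝ≥0∞)) (x, y)
          ∂μ ∂ν := by
        rw [lintegral_lintegral_swap]
        exact ((hfm.comp measurable_fst).indicator (measurableSet_dist_lt r)).aemeasurable
    _ ≤ ∫⁻ y, ∫⁻ x, {p : X × X | dist p.1 p.2 < r}.indicator
          (fun p => (f p.1 : ℝ≥0∞) + ε) (y, x) ∂μ ∂ν := by
        refine lintegral_mono fun y => lintegral_mono fun x => ?_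
        by_cases hxy : dist x y < r
        · have hyx : dist y x < r := by rwa [dist_comm]
          simp only [indicator, mem_ofPred_eq, hxy, hyx, if_true]
          have := hfr hxy
          rw [NNReal.dist_eq] at this
          have h3 : f x ≤ f y + ε := by
            rw [← NNReal.coe_le_coe]; push_cast
            linarith [(abs_lt.1 this).2]
          exact_mod_cast h3
        · simp [indicator, hxy]
    _ = μ (Metric.ball x₀ r) * (∫⁻ x, f x ∂ν + ε) := by
        rw [key ν μ hμ (fun x => (f x : ℝ≥0∞) + ε), lintegral_add_right _ measurable_const]
        simp

/-- A compact metric space carries at most one probability measure that is invariant under a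
transitive family of isometries. -/
theorem measure_eq_of_transitive {μ ν : Measure X} [IsProbabilityMeasure μ]
    [IsProbabilityMeasure ν]
    (h : ∀ x y : X, ∃ e : X ≃ᵢ X, e x = y ∧ μ.map e = μ ∧ ν.map e = ν) : μ = ν := by
  refine ext_of_forall_lintegral_eq_of_IsFiniteMeasure fun f => le_antisymm ?_ ?_
  · exact lintegral_le_of_transitive h f
  · refine lintegral_le_of_transitive (fun x y => ?_) f
    obtain ⟨e, h1, h2, h3⟩ := h x y
    exact ⟨e, h1, h3, h2⟩

end Uniqueness

section Hausdorff

variable {V : Type*} [NormedAddCommGroup V] [InnerProductSpace ℝ V]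
  {W : Type*} [NormedAddCommGroup W] [InnerProductSpace ℝ W]

/-- The isometry between unit spheres induced by a linear isometry equivalence. -/
def sphereIso (e : V ≃ₗᵢ[ℝ] W) : USphere V ≃ᵢ USphere W where
  toFun x := ⟨e x, by simp⟩
  invFun x := ⟨e.symm x, by simp⟩
  left_inv x := by ext; simp
  right_inv x := by ext; simp
  isometry_toFun := Isometry.of_dist_eq fun x y => by simp [Subtype.dist_eq]

@[simp] lemma coe_sphereIso (e : V ≃ₗᵢ[ℝ] W) (x : USphere V) : (sphereIso e x : W) = e x := rfl

lemma norm_coe_sphere (x : USphere V) : ‖(x : V)‖ = 1 := norm_eq_of_mem_sphere x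

lemma exists_isometry_apply_eq (x y : USphere V) : ∃ e : V ≃ₗᵢ[ℝ] V, e x = y :=
  ⟨(Submodule.span ℝ {(x : V) - y})ᗮ.reflection, Submodule.reflection_sub (by simp)⟩

lemma exists_sphereIso_apply_eq (x y : USphere V) : ∃ e : V ≃ₗᵢ[ℝ] V, sphereIso e x = y :=
  let ⟨e, he⟩ := exists_isometry_apply_eq x y
  ⟨e, Subtype.ext he⟩

variable [FiniteDimensional ℝ V] [MeasurableSpace V] [BorelSpace V]
  [FiniteDimensional ℝ W] [MeasurableSpace W] [BorelSpace W]

lemma finrank_orthogonal_unit (v : USphere V) :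
    Module.finrank ℝ (Submodule.span ℝ {(v : V)})ᗮ + 1 = Module.finrank ℝ V := by
  have h := Submodule.finrank_add_finrank_orthogonal (Submodule.span ℝ {(v : V)})
  have hv : (v : V) ≠ 0 := by
    intro h; have := norm_coe_sphere v; simp [h] at this
  rw [finrank_span_singleton hv] at h
  omega

lemma map_sphereMeasure (e : V ≃ₗᵢ[ℝ] W) :
    (sphereMeasure V).map (sphereIso e) = sphereMeasure W := by
  have hd : Module.finrank ℝ V = Module.finrank ℝ W := e.toLinearEquiv.finrank_eq
  rw [sphereMeasure, sphereMeasure, Measure.map_smul, IsometryEquiv.map_hausdorffMeasure, hd]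
  congr 2
  rw [← IsometryEquiv.hausdorffMeasure_image (sphereIso e)]
  simp

lemma norm_inv_smul_sub_le {x y : V} (hx : 1 ≤ ‖x‖) (hy : 1 ≤ ‖y‖) :
    ‖‖x‖⁻¹ • x - ‖y‖⁻¹ • y‖ ≤ 2 * ‖x - y‖ := by
  have h1 : ‖x‖⁻¹ • x - ‖y‖⁻¹ • y = ‖x‖⁻¹ • (x - y) + (‖x‖⁻¹ - ‖y‖⁻¹) • y := by
    simp only [smul_sub, sub_smul]; abel
  have hx0 : 0 < ‖x‖ := by linarith
  have hy0 : 0 < ‖y‖ := by linarith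
  have h2 : ‖x‖⁻¹ ≤ 1 := inv_le_one_of_one_le₀ hx
  rw [h1]
  refine (norm_add_le _ _).trans ?_
  rw [norm_smul, norm_smul, norm_inv, norm_norm, Real.norm_eq_abs]
  have h3 : |‖x‖⁻¹ - ‖y‖⁻¹| * ‖y‖ = ‖x‖⁻¹ * |‖y‖ - ‖x‖| := by
    rw [show ‖x‖⁻¹ - ‖y‖⁻¹ = ‖x‖⁻¹ * (‖y‖ - ‖x‖) * ‖y‖⁻¹ by field_simp, abs_mul, abs_mul,
      abs_of_pos (inv_pos.2 hx0), abs_of_pos (inv_pos.2 hy0)]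
    field_simp
  have h4 : |‖y‖ - ‖x‖| ≤ ‖x - y‖ := by
    rw [norm_sub_rev]; exact abs_norm_sub_norm_le y x
  rw [h3]
  nlinarith [norm_nonneg (x - y), abs_nonneg (‖y‖ - ‖x‖)]

/-- A spherical cap is a Lipschitz image of a ball in the tangent hyperplane. -/
lemma hausdorffMeasure_cap_lt_top (v : USphere V) :
    (μH[(Module.finrank ℝ V : ℝ) - 1] : Measure (USphere V))
      {x | 1 / 2 < ⟪(v : V), (x : V)⟫} < ∞ := by
  have hfr := finrank_orthogonal_unit v
  set H := (Submodule.span ℝ {(v : V)})ᗮ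
  have hd : (Module.finrank ℝ V : ℝ) - 1 = (Module.finrank ℝ H : ℝ) := by
    rw [← hfr]; push_cast; ring
  have hv : ‖(v : V)‖ = 1 := norm_coe_sphere v
  have horth : ∀ y : H, ⟪(v : V), (y : V)⟫ = 0 := fun y =>
    Submodule.mem_orthogonal_singleton_iff_inner_right.1 y.2
  have hn : ∀ y : H, ‖(v : V) + y‖ ^ 2 = 1 + ‖(y : V)‖ ^ 2 := fun y => by
    rw [norm_add_sq_real, horth, hv]; ring
  have hge : ∀ y : H, 1 ≤ ‖(v : V) + y‖ := fun y => by
    have h1 := hn y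
    nlinarith [norm_nonneg ((v : V) + y), sq_nonneg ‖(y : V)‖]
  let φ : H → USphere V := fun y => ⟨‖(v : V) + y‖⁻¹ • ((v : V) + y), by
    rw [mem_sphere_zero_iff_norm, norm_smul, norm_inv, norm_norm,
      inv_mul_cancel₀ (by linarith [hge y])]⟩
  have hφ : LipschitzWith 2 φ := LipschitzWith.of_dist_le_mul fun x y => by
    rw [Subtype.dist_eq, dist_eq_norm, dist_eq_norm]
    refine (norm_inv_smul_sub_le (hge x) (hge y)).trans (le_of_eq ?_)
    simp
  have hsub : {x : USphere V | 1 / 2 < ⟪(v : V), (x : V)⟫} ⊆ φ '' Metric.closedBall 0 2 := by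
    intro x hx
    simp only [mem_ofPred_eq] at hx
    set a := ⟪(v : V), (x : V)⟫
    have ha : 0 < a := by linarith
    have hy : a⁻¹ • (x : V) - v ∈ H := by
      rw [Submodule.mem_orthogonal_singleton_iff_inner_right, inner_sub_right, inner_smul_right,
        real_inner_self_eq_norm_sq, hv, inv_mul_cancel₀ ha.ne']
      norm_num
    refine ⟨⟨_, hy⟩, ?_, ?_⟩
    · rw [mem_closedBall_zero_iff]
      have h1 := hn ⟨_, hy⟩
      simp only [add_sub_cancel, norm_smul, norm_coe_sphere, norm_inv, Real.norm_eq_abs, abs_of_pos ha] at h1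
      change ‖a⁻¹ • (x : V) - v‖ ≤ 2
      have h2 : a⁻¹ < 2 := by
        rw [inv_lt_comm₀ ha two_pos]; linarith
      have h3 : 0 < a⁻¹ := inv_pos.2 ha
      nlinarith [norm_nonneg (a⁻¹ • (x : V) - v)]
    · apply Subtype.ext
      simp only [φ, add_sub_cancel, norm_smul, norm_coe_sphere, norm_inv, Real.norm_eq_abs,
        abs_of_pos ha, mul_one, inv_inv, smul_smul, mul_inv_cancel₀ ha.ne', one_smul]
  refine (measure_mono hsub).trans_lt ?_
  rw [hd]
  refine (hφ.hausdorffMeasure_image_le (Nat.cast_nonneg _) _).trans_lt ?_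
  refine ENNReal.mul_lt_top (ENNReal.rpow_lt_top_of_nonneg (Nat.cast_nonneg _) (by simp)) ?_
  exact (isCompact_closedBall _ _).measure_lt_top

lemma hausdorffMeasure_sphere_ne_top :
    (μH[(Module.finrank ℝ V : ℝ) - 1] : Measure (USphere V)) univ ≠ ∞ := by
  have hcov : (univ : Set (USphere V)) ⊆ ⋃ v : USphere V, {x | 1 / 2 < ⟪(v : V), (x : V)⟫} := by
    intro x _
    simp only [mem_iUnion, mem_ofPred_eq]
    exact ⟨x, by rw [real_inner_self_eq_norm_sq, norm_coe_sphere]; norm_num⟩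
  obtain ⟨t, ht⟩ := isCompact_univ.elim_finite_subcover _ (fun v =>
    isOpen_lt continuous_const (continuous_const.inner continuous_subtype_val)) hcov
  refine ((measure_mono ht).trans (measure_biUnion_finset_le _ _)).trans_lt ?_ |>.ne
  exact ENNReal.sum_lt_top.2 fun v _ => hausdorffMeasure_cap_lt_top v

/-- The orthogonal projection of the sphere to a hyperplane covers the unit ball there. -/
lemma hausdorffMeasure_sphere_ne_zero [Nontrivial V] :
    (μH[(Module.finrank ℝ V : ℝ) - 1] : Measure (USphere V)) univ ≠ 0 := by
  intro h0
  obtain ⟨v⟩ : Nonempty (USphere V) := (NormedSpace.sphere_nonempty.2 zero_le_one).to_subtype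
  have hfr := finrank_orthogonal_unit v
  set H := (Submodule.span ℝ {(v : V)})ᗮ
  have hd : (Module.finrank ℝ V : ℝ) - 1 = (Module.finrank ℝ H : ℝ) := by
    rw [← hfr]; push_cast; ring
  have hv : ‖(v : V)‖ = 1 := norm_coe_sphere v
  have hP : LipschitzWith 1 fun x : USphere V => H.orthogonalProjectionOnto (x : V) := by
    refine LipschitzWith.of_dist_le_mul fun x y => ?_
    rw [Subtype.dist_eq x y, dist_eq_norm, dist_eq_norm, ← map_sub]
    simpa using H.orthogonalProjectionOnto_norm_le |> fun h =>
      (H.orthogonalProjectionOnto.le_of_opNorm_le h ((x : V) - y))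
  have h1 := hP.hausdorffMeasure_image_le (d := (Module.finrank ℝ H : ℝ)) (Nat.cast_nonneg _) univ
  rw [← hd, h0, mul_zero, hd] at h1
  have hsub : Metric.ball (0 : H) 1 ⊆
      (fun x : USphere V => H.orthogonalProjectionOnto (x : V)) '' univ := by
    intro y hy
    rw [mem_ball_zero_iff] at hy
    have horth : ⟪(y : V), (v : V)⟫ = 0 := by
      rw [real_inner_comm]; exact Submodule.mem_orthogonal_singleton_iff_inner_right.1 y.2
    have hy' : ‖(y : V)‖ < 1 := hy
    refine ⟨⟨y + √(1 - ‖(y : V)‖ ^ 2) • (v : V), ?_⟩, mem_univ _, ?_⟩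
    · rw [mem_sphere_zero_iff_norm, ← sq_eq_sq₀ (norm_nonneg _) zero_le_one, norm_add_sq_real,
        inner_smul_right, horth, norm_smul, hv, Real.norm_eq_abs, mul_one, sq_abs, Real.sq_sqrt]
      · ring
      · nlinarith [norm_nonneg (y : V)]
    · simp only [map_add, map_smul, Submodule.orthogonalProjectionOnto_mem_subspace_eq_self]
      have : H.orthogonalProjectionOnto (v : V) = 0 := by
        rw [Submodule.orthogonalProjectionOnto_eq_zero_iff]
        exact Submodule.le_orthogonal_orthogonal _ (Submodule.mem_span_singleton_self _)
      rw [this]; simp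
  have h2 : (μH[(Module.finrank ℝ H : ℝ)] : Measure H) (Metric.ball 0 1) = 0 :=
    measure_mono_null hsub (le_antisymm h1 bot_le)
  exact (Metric.isOpen_ball.measure_pos _ ⟨0, by simp⟩).ne' h2

instance isProbabilityMeasure_sphereMeasure [Nontrivial V] :
    IsProbabilityMeasure (sphereMeasure V) where
  measure_univ := by
    rw [sphereMeasure, Measure.smul_apply, smul_eq_mul]
    exact ENNReal.inv_mul_cancel hausdorffMeasure_sphere_ne_zero hausdorffMeasure_sphere_ne_top

/-- The normalized Hausdorff measure is the only rotation-invariant probability measure on the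
sphere. -/
lemma eq_sphereMeasure [Nontrivial V] (μ : Measure (USphere V)) [IsProbabilityMeasure μ]
    (h : ∀ e : V ≃ₗᵢ[ℝ] V, μ.map (sphereIso e) = μ) : μ = sphereMeasure V :=
  measure_eq_of_transitive fun x y =>
    let ⟨e, he⟩ := exists_sphereIso_apply_eq x y
    ⟨sphereIso e, he, h e, map_sphereMeasure e⟩

instance isOpenPosMeasure_sphereMeasure [Nontrivial V] :
    (sphereMeasure V).IsOpenPosMeasure where
  open_pos U hU hne h0 := by
    obtain ⟨x, hx⟩ := hne
    obtain ⟨r, hr, hrU⟩ := Metric.isOpen_iff.1 hU x hx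
    refine measure_ball_pos_of_transitive (μ := sphereMeasure V) (fun x y => ?_) x hr
      (measure_mono_null hrU h0)
    obtain ⟨e, he⟩ := exists_sphereIso_apply_eq x y
    exact ⟨sphereIso e, he, map_sphereMeasure e⟩

end Hausdorff

/-! ### Slicing the sphere along great spheres -/

section Slicing

variable {V : Type*} [NormedAddCommGroup V] [InnerProductSpace ℝ V] [FiniteDimensional ℝ V]
  [MeasurableSpace V] [BorelSpace V]

/-- The hyperplane orthogonal to a vector. -/
noncomputable abbrev perp {V : Type*} [NormedAddCommGroup V] [InnerProductSpace ℝ V] (v : V) : Submodule ℝ V :=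
  (Submodule.span ℝ {v})ᗮ

lemma inner_perp {v : V} (y : perp v) : ⟪v, (y : V)⟫ = 0 :=
  Submodule.mem_orthogonal_singleton_iff_inner_right.1 y.2

lemma finrank_perp (v : USphere V) :
    Module.finrank ℝ (perp (v : V)) + 1 = Module.finrank ℝ V :=
  finrank_orthogonal_unit v

lemma nontrivial_perp (v : USphere V) (h : 2 ≤ Module.finrank ℝ V) : Nontrivial (perp (v : V)) := by
  have := finrank_perp v
  exact Module.nontrivial_of_finrank_pos (R := ℝ) (by omega)

lemma nontrivial_of_two_le (h : 2 ≤ Module.finrank ℝ V) : Nontrivial V :=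
  Module.nontrivial_of_finrank_pos (R := ℝ) (by omega)

lemma lintegral_sphereMeasure_comp [Nontrivial V] (e : V ≃ₗᵢ[ℝ] V) (f : V → ℝ≥0∞) :
    ∫⁻ x : USphere V, f (e x) ∂sphereMeasure V = ∫⁻ x : USphere V, f x ∂sphereMeasure V := by
  conv_rhs => rw [← map_sphereMeasure e]
  exact ((sphereIso e).toHomeomorph.measurableEmbedding.lintegral_map
    (fun x : USphere V => f x)).symm

lemma lintegral_sphereMeasure_neg [Nontrivial V] (f : V → ℝ≥0∞) :
    ∫⁻ x : USphere V, f (-x) ∂sphereMeasure V = ∫⁻ x : USphere V, f x ∂sphereMeasure V :=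
  lintegral_sphereMeasure_comp (LinearIsometryEquiv.neg ℝ) f

lemma map_toSphere (e : V ≃ₗᵢ[ℝ] V) :
    (volume : Measure V).toSphere.map (sphereIso e) = (volume : Measure V).toSphere := by
  ext s hs
  have hm : Measurable (sphereIso e) := (sphereIso e).continuous.measurable
  rw [Measure.map_apply hm hs, Measure.toSphere_apply' _ hs,
    Measure.toSphere_apply' _ (hm hs)]
  congr 1
  conv_rhs => rw [← e.measurePreserving.measure_preimage_equiv (f := e.toHomeomorph.toMeasurableEquiv)]
  congr 1
  ext x
  simp only [mem_smul, mem_image, mem_preimage,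
    show e.toHomeomorph.toMeasurableEquiv x = e x from rfl]
  constructor
  · rintro ⟨r, hr, _, ⟨y, hy, rfl⟩, rfl⟩
    exact ⟨r, hr, _, ⟨_, hy, rfl⟩, by rw [map_smul]; rfl⟩
  · rintro ⟨r, hr, _, ⟨y, hy, rfl⟩, h⟩
    refine ⟨r, hr, e.symm y, ⟨(sphereIso e).symm y, by simpa using hy, rfl⟩, ?_⟩
    apply e.injective
    rw [map_smul, e.apply_symm_apply, h]

lemma toSphere_eq_smul [Nontrivial V] :
    (volume : Measure V).toSphere = (volume : Measure V).toSphere univ • sphereMeasure V := by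
  set c := (volume : Measure V).toSphere univ
  have h0 : c ≠ 0 := by
    simp only [c, ne_eq, Measure.measure_univ_eq_zero]
    exact Measure.toSphere_ne_zero _
  have ht : c ≠ ∞ := measure_ne_top _ _
  have : IsProbabilityMeasure (c⁻¹ • (volume : Measure V).toSphere) :=
    ⟨by rw [Measure.smul_apply, smul_eq_mul, ENNReal.inv_mul_cancel h0 ht]⟩
  rw [← eq_sphereMeasure (c⁻¹ • (volume : Measure V).toSphere), smul_smul,
    ENNReal.mul_inv_cancel h0 ht, one_smul]
  intro e
  rw [Measure.map_smul, map_toSphere]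

/-- Integration in polar coordinates. -/
lemma lintegral_polar [Nontrivial V] {g : V → ℝ≥0∞} (hg : Measurable g) :
    ∫⁻ x, g x = (volume : Measure V).toSphere univ * ∫⁻ θ : USphere V, (∫⁻ r in Ioi (0 : ℝ),
      ENNReal.ofReal (r ^ (Module.finrank ℝ V - 1)) * g (r • (θ : V))) ∂sphereMeasure V := by
  have h1 : ∫⁻ x, g x = ∫⁻ x : ({0}ᶜ : Set V), g x ∂(volume.comap Subtype.val) := by
    rw [lintegral_subtype_comap (measurableSet_singleton _).compl, restrict_compl_singleton]
  have h2 := (Measure.measurePreserving_homeomorphUnitSphereProd (volume : Measure V)).symm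
    (homeomorphUnitSphereProd V).toMeasurableEquiv
  rw [h1, ← h2.lintegral_comp (f := fun x : ({0}ᶜ : Set V) => g x)
    (hg.comp measurable_subtype_coe), lintegral_prod _ (by
      exact ((hg.comp measurable_subtype_coe).comp h2.measurable).aemeasurable),
    toSphere_eq_smul, lintegral_smul_measure, smul_eq_mul]
  congr 1
  · simp
  refine lintegral_congr fun θ => ?_
  rw [Measure.volumeIoiPow, lintegral_withDensity_eq_lintegral_mul _ (by fun_prop)]
  · rw [← lintegral_subtype_comap measurableSet_Ioi]
    rfl
  · exact (hg.comp measurable_subtype_coe).comp (h2.measurable.comp (by fun_prop))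

/-- The total weight `∫ |cos φ| ^ m` over a full turn. -/
noncomputable def cosWeight (m : ℕ) : ℝ≥0∞ :=
  ∫⁻ φ in Ioo (-Real.pi) Real.pi, ENNReal.ofReal (|Real.cos φ| ^ m)

lemma cosWeight_ne_top (m : ℕ) : cosWeight m ≠ ∞ := by
  have h : cosWeight m ≤ ∫⁻ φ in Ioo (-Real.pi) Real.pi, 1 := by
    refine lintegral_mono fun φ => ?_
    rw [← ENNReal.ofReal_one]
    exact ENNReal.ofReal_le_ofReal (pow_le_one₀ (abs_nonneg _) (Real.abs_cos_le_one _))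
  refine ne_top_of_le_ne_top ?_ h
  simp [Real.volume_Ioo]

lemma cosWeight_ne_zero (m : ℕ) : cosWeight m ≠ 0 := by
  intro h
  have hsub : Ioo 0 (Real.pi / 2) ⊆ Ioo (-Real.pi) Real.pi := fun x hx =>
    ⟨by linarith [hx.1, Real.pi_pos], by linarith [hx.2, Real.pi_pos]⟩
  have h2 := lintegral_mono_set (μ := volume)
    (f := fun φ => ENNReal.ofReal (|Real.cos φ| ^ m)) hsub
  have h3 : 0 < ∫⁻ φ in Ioo 0 (Real.pi / 2), ENNReal.ofReal (|Real.cos φ| ^ m) := by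
    refine setLIntegral_pos_iff (by fun_prop) |>.2 ?_
    have : (Function.support fun φ => ENNReal.ofReal (|Real.cos φ| ^ m)) ∩ Ioo 0 (Real.pi / 2)
        = Ioo 0 (Real.pi / 2) := by
      refine inter_eq_right.2 fun φ hφ => ?_
      have hc : 0 < Real.cos φ := Real.cos_pos_of_mem_Ioo ⟨by linarith [hφ.1, Real.pi_pos], hφ.2⟩
      simp only [Function.mem_support, ne_eq, ENNReal.ofReal_eq_zero, not_le]
      positivity
    rw [this, Real.volume_Ioo]
    simp [Real.pi_pos]
  exact h3.ne' (le_antisymm (h2.trans h.le) bot_le)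

/-- The point of latitude `φ` on the great circle through the pole `v` and the point `θ` of the
equator. It is used for all `φ ∈ (-π, π)`, so that every point of the circle is reached. -/
noncomputable def arc (v θ : V) (φ : ℝ) : V := Real.cos φ • θ + Real.sin φ • v

lemma norm_arc_perp (v : USphere V) (θ : USphere (perp (v : V))) (φ : ℝ) :
    ‖arc (v : V) (θ : perp (v : V)) φ‖ = 1 := by
  have h1 : ‖((θ : perp (v : V)) : V)‖ = 1 := norm_eq_of_mem_sphere θ
  have h2 : ⟪((θ : perp (v : V)) : V), (v : V)⟫ = 0 := by
    rw [real_inner_comm]; exact inner_perp _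
  rw [← sq_eq_sq₀ (norm_nonneg _) zero_le_one, arc, norm_add_sq_real, norm_smul, norm_smul, h1,
    norm_coe_sphere, inner_smul_left, inner_smul_right, h2]
  simp

/-- The symmetric form of polar coordinates in a plane: for an integrand that has been averaged
over a symmetric set of directions, the radius may run over the whole line. -/
lemma lintegral_Ioi_sphere_eq [Nontrivial V] {g : V → ℝ≥0∞} (hg : Measurable g) (m : ℕ) :
    2 * ∫⁻ θ : USphere V, (∫⁻ r in Ioi (0 : ℝ),
      ENNReal.ofReal (r ^ m) * g (r • (θ : V))) ∂sphereMeasure V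
    = ∫⁻ θ : USphere V, (∫⁻ r : ℝ, ENNReal.ofReal (|r| ^ m) * g (r • (θ : V)))
        ∂sphereMeasure V := by
  have hm : Measurable fun p : V × ℝ => ENNReal.ofReal (|p.2| ^ m) * g (p.2 • p.1) := by
    fun_prop
  have hG : Measurable fun x : V => ∫⁻ r in Ioi (0 : ℝ), ENNReal.ofReal (|r| ^ m) * g (r • x) :=
    hm.lintegral_prod_right' (ν := volume.restrict (Ioi 0))
  have h1 : ∀ x : V, ∫⁻ r : ℝ, ENNReal.ofReal (|r| ^ m) * g (r • x)
      = (∫⁻ r in Ioi (0 : ℝ), ENNReal.ofReal (|r| ^ m) * g (r • x))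
        + ∫⁻ r in Ioi (0 : ℝ), ENNReal.ofReal (|r| ^ m) * g (r • -x) := by
    intro x
    rw [← setLIntegral_univ, ← Iic_union_Ioi (a := (0 : ℝ)),
      lintegral_union measurableSet_Ioi (by
        rw [disjoint_left]; exact fun a ha hb => not_lt.2 (show a ≤ 0 from ha) hb), add_comm]
    congr 1
    rw [setLIntegral_congr Iio_ae_eq_Iic.symm]
    have h := (Measure.measurePreserving_neg (volume : Measure ℝ)).setLIntegral_comp_preimage
      (measurableSet_Iio (a := (0 : ℝ)))
      (f := fun r => ENNReal.ofReal (|r| ^ m) * g (r • x)) (by fun_prop)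
    rw [← h]
    simp [Set.neg_preimage]
  simp only [h1]
  have hG' : Measurable fun θ : USphere V =>
      ∫⁻ r in Ioi (0 : ℝ), ENNReal.ofReal (|r| ^ m) * g (r • (θ : V)) :=
    hG.comp measurable_subtype_coe
  rw [lintegral_add_left hG', lintegral_sphereMeasure_neg
    (fun x => ∫⁻ r in Ioi (0 : ℝ), ENNReal.ofReal (|r| ^ m) * g (r • x)), two_mul]
  congr 1 <;>
  · refine lintegral_congr fun θ => setLIntegral_congr_fun measurableSet_Ioi fun r hr => ?_
    simp only [abs_of_pos (show (0 : ℝ) < r from hr)]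

lemma exists_volume_eq_map_prod (v : USphere V) :
    ∃ c : ℝ≥0∞, (volume : Measure V) = c • ((volume : Measure (perp (v : V))).prod
      (volume : Measure ℝ)).map (fun p => (p.1 : V) + p.2 • (v : V)) := by
  have hv : ‖(v : V)‖ = 1 := norm_coe_sphere v
  let L : (perp (v : V) × ℝ) →ₗ[ℝ] V :=
    { toFun := fun p => (p.1 : V) + p.2 • (v : V)
      map_add' := fun p q => by simp [add_smul]; abel
      map_smul' := fun c p => by simp [smul_smul] }
  have hinj : Function.Injective L := by
    rw [injective_iff_map_eq_zero]
    rintro ⟨y, t⟩ h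
    have h0 : (y : V) + t • (v : V) = 0 := h
    have h1 : ⟪(v : V), (y : V) + t • (v : V)⟫ = t := by
      rw [inner_add_right, inner_perp, inner_smul_right, real_inner_self_eq_norm_sq, hv]; ring
    rw [h0, inner_zero_right] at h1
    subst h1
    simpa using h0
  let e := LinearEquiv.ofInjectiveOfFinrankEq L hinj (by
    rw [Module.finrank_prod, Module.finrank_self, finrank_perp])
  have := e.isAddHaarMeasure_map ((volume : Measure (perp (v : V))).prod (volume : Measure ℝ))
  have := this (LinearMap.continuous_of_finiteDimensional e.toLinearMap)
    (LinearMap.continuous_of_finiteDimensional e.symm.toLinearMap)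
  have he' : ⇑e.toAddEquiv = fun p => (p.1 : V) + p.2 • (v : V) := rfl
  rw [he'] at this
  exact ⟨_, Measure.isAddLeftInvariant_eq_smul _ _⟩

/-- Integration over the sphere by slicing it into great circles through `v`, up to a constant factor,
which is then determined by integrating `1`. -/
lemma exists_lintegral_sphere_eq_arc (v : USphere V) {m : ℕ} (hm : Module.finrank ℝ V = m + 2) :
    ∃ k : ℝ≥0∞, ∀ f : V → ℝ≥0∞, Measurable f →
      ∫⁻ x : USphere V, f x ∂sphereMeasure V = k * ∫⁻ θ : USphere (perp (v : V)),
        (∫⁻ φ in Ioo (-Real.pi) Real.pi, ENNReal.ofReal (|Real.cos φ| ^ m) *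
          f (arc (v : V) (θ : perp (v : V)) φ)) ∂sphereMeasure (perp (v : V)) := by
  have := nontrivial_of_two_le (V := V) (by omega)
  have := nontrivial_perp v (by omega)
  have hfr : Module.finrank ℝ (perp (v : V)) = m + 1 := by
    have := finrank_perp v; omega
  obtain ⟨c, hc⟩ := exists_volume_eq_map_prod v
  set H := perp (v : V)
  have hv : ‖(v : V)‖ = 1 := norm_coe_sphere v
  let N : V → V := fun x => ‖x‖⁻¹ • x
  have hN : Measurable N := by fun_prop
  -- both sides are compared with the integral over the unit ball of the radial extension of `f`
  let F : (V → ℝ≥0∞) → V → ℝ≥0∞ := fun f => (Metric.ball 0 1).indicator fun x => f (N x)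
  have hF : ∀ f, Measurable f → Measurable (F f) := fun f hf =>
    (hf.comp hN).indicator Metric.isOpen_ball.measurableSet
  have hNs : ∀ (r : ℝ) (x : V), 0 < r → ‖x‖ = 1 → N (r • x) = x := fun r x hr hx => by
    simp only [N, norm_smul, hx, Real.norm_eq_abs, abs_of_pos hr, mul_one, smul_smul,
      inv_mul_cancel₀ hr.ne', one_smul]
  have hFs : ∀ f (r : ℝ) (x : V), 0 < r → ‖x‖ = 1 →
      F f (r • x) = (Iio (1 : ℝ)).indicator 1 r * f x := fun f r x hr hx => by
    simp only [F, indicator, mem_ball_zero_iff, norm_smul, hx, Real.norm_eq_abs, abs_of_pos hr,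
      mul_one, hNs r x hr hx, mem_Iio, Pi.one_apply]
    split_ifs <;> simp
  set a : ℝ≥0∞ := ∫⁻ r in Ioi (0 : ℝ), ENNReal.ofReal (r ^ (m + 1)) * (Iio (1 : ℝ)).indicator 1 r
  have hind : Measurable ((Iio (1 : ℝ)).indicator (1 : ℝ → ℝ≥0∞)) :=
    measurable_one.indicator measurableSet_Iio
  have hS : ∀ f, Measurable f → ∫⁻ x, F f x
      = (volume : Measure V).toSphere univ * (a * ∫⁻ x : USphere V, f x ∂sphereMeasure V) := by
    intro f hf
    have hfs : Measurable fun x : USphere V => f x := hf.comp measurable_subtype_coe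
    rw [lintegral_polar (hF f hf), ← lintegral_const_mul _ hfs]
    congr 1
    refine lintegral_congr fun θ => ?_
    rw [← lintegral_mul_const _ (by fun_prop)]
    refine setLIntegral_congr_fun measurableSet_Ioi fun r hr => ?_
    simp only [hFs f r θ hr (norm_coe_sphere θ), hm, mul_assoc]
    rfl
  have hA : ∀ f, Measurable f → 2 * ∫⁻ x, F f x
      = c * ((volume : Measure H).toSphere univ * (a * ∫⁻ θ : USphere H,
        (∫⁻ φ in Ioo (-Real.pi) Real.pi, ENNReal.ofReal (|Real.cos φ| ^ m) *
          f (arc (v : V) (θ : H) φ)) ∂sphereMeasure H)) := by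
    intro f hf
    have hFf := hF f hf
    have hmp : Measurable fun p : H × ℝ => (p.1 : V) + p.2 • (v : V) := by fun_prop
    have hFp : Measurable fun p : H × ℝ => F f ((p.1 : V) + p.2 • (v : V)) := hFf.comp hmp
    rw [hc, lintegral_smul_measure, smul_eq_mul, lintegral_map hFf hmp,
      lintegral_prod_symm' _ hFp]
    have e1 : ∀ t : ℝ, 2 * ∫⁻ y : H, F f ((y : V) + t • (v : V))
        = (volume : Measure H).toSphere univ * ∫⁻ θ : USphere H, (∫⁻ r : ℝ,
          ENNReal.ofReal (|r| ^ m) * F f (((r • (θ : H) : H) : V) + t • (v : V)))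
            ∂sphereMeasure H := by
      intro t
      rw [lintegral_polar (g := fun y : H => F f ((y : V) + t • (v : V))) (by fun_prop), hfr,
        ← lintegral_Ioi_sphere_eq (g := fun y : H => F f ((y : V) + t • (v : V))) (by fun_prop)]
      simp only [Nat.add_sub_cancel]
      ring
    have hmeas : Measurable fun q : (ℝ × USphere H) × ℝ =>
        ENNReal.ofReal (|q.2| ^ m) * F f (((q.2 • (q.1.2 : H) : H) : V) + q.1.1 • (v : V)) := by
      have : Measurable fun q : (ℝ × USphere H) × ℝ => 
        (((q.2 • (q.1.2 : H) : H) : V) + q.1.1 • (v : V)) := by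
        push_cast
        fun_prop
      have h2 := hFf.comp this
      exact (by fun_prop : Measurable fun q : (ℝ × USphere H) × ℝ =>
        ENNReal.ofReal (|q.2| ^ m)).mul h2
    rw [mul_left_comm, ← lintegral_const_mul _ (hFp.lintegral_prod_left' (μ := volume))]
    simp only [e1]
    rw [lintegral_const_mul _ ((hmeas.lintegral_prod_right' (ν := volume)).lintegral_prod_right'
      (ν := sphereMeasure H)), lintegral_lintegral_swap
      (hmeas.lintegral_prod_right' (ν := volume)).aemeasurable]
    congr 2
    rw [← lintegral_const_mul _ (by
      refine Measurable.lintegral_prod_right' (ν := volume.restrict (Ioo (-Real.pi) Real.pi))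
        (f := fun p : USphere H × ℝ => ENNReal.ofReal (|Real.cos p.2| ^ m) *
          f (arc (v : V) (p.1 : H) p.2)) ?_
      refine Measurable.mul (by fun_prop) (hf.comp ?_)
      unfold arc; fun_prop)]
    refine lintegral_congr fun θ => ?_
    -- now a planar integral, in polar coordinates
    have h3 : Measurable fun p : ℝ × ℝ => ENNReal.ofReal (|p.1| ^ m) *
        F f (((p.1 • (θ : H) : H) : V) + p.2 • (v : V)) :=
      hmeas.comp (by fun_prop : Measurable fun p : ℝ × ℝ => ((p.2, θ), p.1))
    rw [lintegral_lintegral_swap (by exact (h3.comp measurable_swap).aemeasurable),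
      ← lintegral_prod (fun p : ℝ × ℝ => ENNReal.ofReal (|p.1| ^ m) *
        F f (((p.1 • (θ : H) : H) : V) + p.2 • (v : V))) h3.aemeasurable]
    change ∫⁻ p : ℝ × ℝ, _ = _
    rw [← lintegral_comp_polarCoord_symm]
    have h4 : ∀ p ∈ polarCoord.target, ENNReal.ofReal p.1 • (fun p : ℝ × ℝ =>
        ENNReal.ofReal (|p.1| ^ m) * F f (((p.1 • (θ : H) : H) : V) + p.2 • (v : V)))
          (polarCoord.symm p)
        = (ENNReal.ofReal (p.1 ^ (m + 1)) * (Iio (1 : ℝ)).indicator 1 p.1) *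
          (ENNReal.ofReal (|Real.cos p.2| ^ m) * f (arc (v : V) (θ : H) p.2)) := by
      rintro ⟨r, φ⟩ ⟨hr, -⟩
      have hr : 0 < r := hr
      have h5 : (((r * Real.cos φ) • (θ : H) : H) : V) + (r * Real.sin φ) • (v : V)
          = r • arc (v : V) (θ : H) φ := by
        simp [arc, smul_add, smul_smul]
      simp only [polarCoord_symm_apply, smul_eq_mul, h5, hFs f r _ hr (norm_arc_perp v θ φ)]
      rw [abs_mul, mul_pow, abs_of_pos hr, ENNReal.ofReal_mul (by positivity), pow_succ',
        ENNReal.ofReal_mul hr.le]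
      ring
    rw [setLIntegral_congr_fun polarCoord.open_target.measurableSet h4, polarCoord_target,
      Measure.volume_eq_prod, ← Measure.prod_restrict,
      lintegral_prod_mul (f := fun r => ENNReal.ofReal (r ^ (m + 1)) * (Iio (1 : ℝ)).indicator 1 r)
        (g := fun φ => ENNReal.ofReal (|Real.cos φ| ^ m) * f (arc (v : V) (θ : H) φ))]
    · fun_prop
    · refine (Measurable.mul (by fun_prop) (hf.comp ?_)).aemeasurable
      unfold arc; fun_prop
  set b := (volume : Measure V).toSphere univ
  have hb0 : b ≠ 0 := by
    simp only [b, ne_eq, Measure.measure_univ_eq_zero]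
    exact Measure.toSphere_ne_zero _
  have hbt : b ≠ ∞ := measure_ne_top _ _
  have hba : b * a = volume (Metric.ball (0 : V) 1) := by
    have h := hS (fun _ => 1) measurable_const
    simp only [lintegral_const, measure_univ, mul_one] at h
    rw [← h]
    simp only [F]
    rw [lintegral_indicator Metric.isOpen_ball.measurableSet, setLIntegral_const, one_mul]
  have ha0 : a ≠ 0 := by
    intro h
    rw [h, mul_zero] at hba
    exact (Metric.isOpen_ball.measure_pos volume ⟨(0 : V), by simp⟩).ne hba
  have hat : a ≠ ∞ := by
    intro h
    rw [h, ENNReal.mul_top hb0] at hba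
    exact (measure_ball_lt_top).ne hba.symm
  refine ⟨(2 * b * a)⁻¹ * (c * (volume : Measure H).toSphere univ * a), fun f hf => ?_⟩
  have h := hA f hf
  rw [hS f hf] at h
  have h0 : 2 * b * a ≠ 0 := by simp [hb0, ha0]
  have h1 : 2 * b * a ≠ ∞ := ENNReal.mul_ne_top (ENNReal.mul_ne_top (by simp) hbt) hat
  rw [mul_assoc, ← ENNReal.mul_right_inj h0 h1, ← mul_assoc (2 * b * a),
    ENNReal.mul_inv_cancel h0 h1, one_mul]
  calc _ = 2 * (b * (a * ∫⁻ x : USphere V, f x ∂sphereMeasure V)) := by ring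
    _ = _ := by rw [h]; ring

/-- The normalized measure of the sphere in the coordinates given by a point of the equator and
the angle along the great circle through it and the pole. -/
theorem lintegral_sphere_eq_arc (v : USphere V) {m : ℕ} (hm : Module.finrank ℝ V = m + 2)
    {f : V → ℝ≥0∞} (hf : Measurable f) :
    ∫⁻ x : USphere V, f x ∂sphereMeasure V = (cosWeight m)⁻¹ * ∫⁻ θ : USphere (perp (v : V)),
      (∫⁻ φ in Ioo (-Real.pi) Real.pi, ENNReal.ofReal (|Real.cos φ| ^ m) *
        f (arc (v : V) (θ : perp (v : V)) φ)) ∂sphereMeasure (perp (v : V)) := by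
  have := nontrivial_of_two_le (V := V) (by omega)
  have := nontrivial_perp v (by omega)
  obtain ⟨k, hk⟩ := exists_lintegral_sphere_eq_arc v hm
  have h1 := hk (fun _ => 1) measurable_const
  have h2 : k = (cosWeight m)⁻¹ := by
    simp only [lintegral_const, measure_univ, mul_one] at h1
    exact ENNReal.eq_inv_of_mul_eq_one_left h1.symm
  rw [hk f hf, h2]

end Slicing

/-! ### Random great spheres and random orthogonal pairs -/

section Uniqueness

variable {Y : Type*} [MetricSpace Y] [MeasurableSpace Y] [BorelSpace Y]

/-- Uniqueness of invariant probability measures concentrated on a compact set. -/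
lemma measure_eq_of_transitiveOn {K : Set Y} (hK : IsCompact K) {μ ν : Measure Y}
    [IsProbabilityMeasure μ] [IsProbabilityMeasure ν] (hμ : μ Kᶜ = 0) (hν : ν Kᶜ = 0)
    (h : ∀ x ∈ K, ∀ y ∈ K, ∃ e : Y ≃ᵢ Y, e x = y ∧ (∀ z, e z ∈ K ↔ z ∈ K) ∧
      μ.map e = μ ∧ ν.map e = ν) : μ = ν := by
  have hKm : MeasurableSet K := hK.measurableSet
  have hemb : MeasurableEmbedding (Subtype.val : K → Y) := MeasurableEmbedding.subtype_coe hKm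
  have hres : ∀ m : Measure Y, m Kᶜ = 0 → (m.comap (Subtype.val : K → Y)).map Subtype.val = m := by
    intro m hm
    rw [hemb.map_comap, Subtype.range_coe, Measure.restrict_eq_self_of_ae_mem]
    exact (mem_ae_iff.2 hm : K ∈ ae m)
  have hprob : ∀ m : Measure Y, IsProbabilityMeasure m → m Kᶜ = 0 →
      IsProbabilityMeasure (m.comap (Subtype.val : K → Y)) := by
    intro m _ hm
    constructor
    rw [comap_subtype_coe_apply hKm, image_univ, Subtype.range_coe, prob_compl_eq_zero_iff hKm |>.1 hm]
  have := hprob μ inferInstance hμ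
  have := hprob ν inferInstance hν
  have : CompactSpace K := isCompact_iff_compactSpace.1 hK
  rw [← hres μ hμ, ← hres ν hν]
  congr 1
  refine measure_eq_of_transitive fun x y => ?_
  obtain ⟨e, hxy, heK, h1, h2⟩ := h x x.2 y y.2
  let e' : K ≃ᵢ K :=
    { toFun := fun z => ⟨e z, (heK z).2 z.2⟩
      invFun := fun z => ⟨e.symm z, by rw [← heK]; simp⟩
      left_inv := fun z => by ext; simp
      right_inv := fun z => by ext; simp
      isometry_toFun := Isometry.of_dist_eq fun z w => by
        simpa [Subtype.dist_eq] using e.dist_eq z w }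
  have key : ∀ m : Measure Y, m.map e = m →
      (m.comap (Subtype.val : K → Y)).map e' = m.comap (Subtype.val : K → Y) := by
    intro m hm
    ext s hs
    have hme : Measurable e' := e'.continuous.measurable
    rw [Measure.map_apply hme hs, comap_subtype_coe_apply hKm, comap_subtype_coe_apply hKm]
    conv_rhs => rw [← hm, Measure.map_apply e.continuous.measurable (hemb.measurableSet_image.2 hs)]
    congr 1
    ext z
    simp only [mem_image, mem_preimage, Subtype.exists, exists_and_right, exists_eq_right]
    exact ⟨fun ⟨hz, h⟩ => ⟨(heK z).2 hz, h⟩, fun ⟨hz, h⟩ => ⟨(heK z).1 hz, h⟩⟩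
  exact ⟨e', Subtype.ext hxy, key μ h1, key ν h2⟩

end Uniqueness

section Great

variable {V : Type*} [NormedAddCommGroup V] [InnerProductSpace ℝ V] [FiniteDimensional ℝ V]
  [MeasurableSpace V] [BorelSpace V]

/-- The direction of the component of `y` orthogonal to the unit vector `v`
(zero if there is none). -/
noncomputable def greatProj {V : Type*} [NormedAddCommGroup V] [InnerProductSpace ℝ V]
    (v y : V) : V := ‖y - ⟪v, y⟫ • v‖⁻¹ • (y - ⟪v, y⟫ • v)

lemma measurable_greatProj : Measurable fun p : V × V => greatProj p.1 p.2 := by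
  unfold greatProj; fun_prop

lemma map_greatProj (e : V ≃ₗᵢ[ℝ] V) (v y : V) :
    e (greatProj v y) = greatProj (e v) (e y) := by
  simp only [greatProj, map_smul, map_sub, e.inner_map_map, ← e.norm_map (y - ⟪v, y⟫ • v)]

lemma greatProj_arc (v : USphere V) (θ : USphere (perp (v : V))) (φ : ℝ) :
    greatProj (v : V) (arc (v : V) (θ : perp (v : V)) φ)
      = (|Real.cos φ|⁻¹ * Real.cos φ) • ((θ : perp (v : V)) : V) := by
  have h1 : ‖((θ : perp (v : V)) : V)‖ = 1 := norm_eq_of_mem_sphere θ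
  have h2 : arc (v : V) (θ : perp (v : V)) φ - ⟪(v : V), arc (v : V) (θ : perp (v : V)) φ⟫ • (v : V)
      = Real.cos φ • ((θ : perp (v : V)) : V) := by
    simp only [arc, inner_add_right, inner_smul_right, inner_perp, real_inner_self_eq_norm_sq,
      norm_coe_sphere]
    simp
  rw [greatProj, h2, norm_smul, h1, Real.norm_eq_abs, mul_one, smul_smul]

lemma ae_cos_ne_zero : ∀ᵐ φ : ℝ, Real.cos φ ≠ 0 := by
  have : {φ : ℝ | ¬ Real.cos φ ≠ 0}.Countable := by
    refine (countable_range fun k : ℤ => (2 * (k : ℝ) + 1) * Real.pi / 2).mono fun φ hφ => ?_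
    simp only [ne_eq, not_not, mem_ofPred_eq, Real.cos_eq_zero_iff] at hφ
    obtain ⟨k, hk⟩ := hφ
    exact ⟨k, hk.symm⟩
  exact this.measure_zero _

/-- A uniform point of a great sphere is the direction of the projection of a uniform point of the
sphere. This makes the dependence on the great sphere explicit. -/
theorem lintegral_perp_eq (v : USphere V) (h : 2 ≤ Module.finrank ℝ V)
    {f : V → ℝ≥0∞} (hf : Measurable f) :
    ∫⁻ θ : USphere (perp (v : V)), f (θ : perp (v : V)) ∂sphereMeasure (perp (v : V))
      = ∫⁻ y : USphere V, f (greatProj v y) ∂sphereMeasure V := by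
  obtain ⟨m, hm⟩ := Nat.exists_eq_add_of_le' h
  have := nontrivial_perp v h
  have hg : Measurable fun y : V => f (greatProj (v : V) y) :=
    hf.comp (measurable_greatProj.comp (by fun_prop : Measurable fun y : V => ((v : V), y)))
  rw [lintegral_sphere_eq_arc v hm hg, lintegral_lintegral_swap]
  · have h1 : ∀ᵐ φ ∂(volume : Measure ℝ).restrict (Ioo (-Real.pi) Real.pi),
        ∫⁻ θ : USphere (perp (v : V)), ENNReal.ofReal (|Real.cos φ| ^ m) *
          f (greatProj (v : V) (arc (v : V) (θ : perp (v : V)) φ)) ∂sphereMeasure (perp (v : V))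
        = ENNReal.ofReal (|Real.cos φ| ^ m) * ∫⁻ θ : USphere (perp (v : V)),
          f (θ : perp (v : V)) ∂sphereMeasure (perp (v : V)) := by
      filter_upwards [ae_restrict_of_ae ae_cos_ne_zero] with φ hφ
      rw [lintegral_const_mul' _ _ ENNReal.ofReal_ne_top]
      congr 1
      rcases hφ.lt_or_gt with hneg | hpos
      · have h3 : |Real.cos φ|⁻¹ * Real.cos φ = -1 := by
          rw [abs_of_neg hneg]; field_simp
        rw [← lintegral_sphereMeasure_neg (V := perp (v : V)) (fun θ => f θ)]
        refine lintegral_congr fun θ => ?_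
        rw [greatProj_arc v θ φ, h3]
        simp
      · have h3 : |Real.cos φ|⁻¹ * Real.cos φ = 1 := by
          rw [abs_of_pos hpos]; field_simp
        refine lintegral_congr fun θ => ?_
        rw [greatProj_arc v θ φ, h3, one_smul]
    rw [lintegral_congr_ae h1, lintegral_mul_const _ (by fun_prop)]
    change _ = (cosWeight m)⁻¹ * (cosWeight m * _)
    rw [← mul_assoc, ENNReal.inv_mul_cancel (cosWeight_ne_zero m) (cosWeight_ne_top m), one_mul]
  · refine (Measurable.mul (by fun_prop) (hg.comp ?_)).aemeasurable
    unfold arc; fun_prop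

lemma map_perp_eq (v : USphere V) (h : 2 ≤ Module.finrank ℝ V) :
    (sphereMeasure (perp (v : V))).map (fun θ : USphere (perp (v : V)) => ((θ : perp (v : V)) : V))
      = (sphereMeasure V).map (fun y : USphere V => greatProj (v : V) (y : V)) := by
  have hmeas : Measurable fun y : USphere V => greatProj (v : V) (y : V) :=
    measurable_greatProj.comp (by fun_prop : Measurable fun y : USphere V => ((v : V), (y : V)))
  refine Measure.ext_of_lintegral _ fun f hf => ?_
  rw [lintegral_map hf (by fun_prop), lintegral_map hf hmeas, lintegral_perp_eq v h hf]

/-- The law of a uniform point on a uniformly chosen great sphere, together with that sphere. -/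
noncomputable def pairLaw (V : Type*) [NormedAddCommGroup V] [InnerProductSpace ℝ V]
    [FiniteDimensional ℝ V] [MeasurableSpace V] [BorelSpace V] : Measure (V × V) :=
  ((sphereMeasure V).prod (sphereMeasure V)).map
    (fun p : USphere V × USphere V => ((p.1 : V), greatProj (p.1 : V) (p.2 : V)))

lemma measurable_pairMap : Measurable
    (fun p : USphere V × USphere V => ((p.1 : V), greatProj (p.1 : V) (p.2 : V))) :=
  Measurable.prodMk (by fun_prop) (measurable_greatProj.comp
    (by fun_prop : Measurable fun q : USphere V × USphere V => ((q.1 : V), (q.2 : V))))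

lemma isProbabilityMeasure_pairLaw [Nontrivial V] : IsProbabilityMeasure (pairLaw V) :=
  Measure.isProbabilityMeasure_map measurable_pairMap.aemeasurable

lemma lintegral_pairLaw (h : 2 ≤ Module.finrank ℝ V) {F : V × V → ℝ≥0∞} (hF : Measurable F) :
    ∫⁻ p, F p ∂pairLaw V = ∫⁻ ν : USphere V, (∫⁻ θ : USphere (perp (ν : V)),
      F ((ν : V), ((θ : perp (ν : V)) : V)) ∂sphereMeasure (perp (ν : V))) ∂sphereMeasure V := by
  have := nontrivial_of_two_le h
  have hFm : Measurable fun p : USphere V × USphere V =>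
      F ((p.1 : V), greatProj (p.1 : V) (p.2 : V)) := hF.comp measurable_pairMap
  rw [pairLaw, lintegral_map hF measurable_pairMap, lintegral_prod _ hFm.aemeasurable]
  refine lintegral_congr fun ν => ?_
  rw [lintegral_perp_eq ν h (f := fun z => F ((ν : V), z)) (by fun_prop)]

lemma map_pairLaw [Nontrivial V] (e : V ≃ₗᵢ[ℝ] V) :
    (pairLaw V).map (Prod.map e e) = pairLaw V := by
  have he : Measurable (Prod.map e e) := by
    exact (e.continuous.prodMap e.continuous).measurable
  have h1 : MeasurePreserving (Prod.map (sphereIso e) (sphereIso e))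
      ((sphereMeasure V).prod (sphereMeasure V)) ((sphereMeasure V).prod (sphereMeasure V)) :=
    MeasurePreserving.prod ⟨(sphereIso e).continuous.measurable, map_sphereMeasure e⟩
      ⟨(sphereIso e).continuous.measurable, map_sphereMeasure e⟩
  conv_rhs => rw [pairLaw, ← h1.map_eq, Measure.map_map measurable_pairMap h1.measurable]
  rw [pairLaw, Measure.map_map he measurable_pairMap]
  congr 1
  funext p
  simp [map_greatProj]

/-- Pairs of orthogonal unit vectors. -/
def orthoSet (V : Type*) [NormedAddCommGroup V] [InnerProductSpace ℝ V] : Set (V × V) :=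
  {p | ‖p.1‖ = 1 ∧ ‖p.2‖ = 1 ∧ ⟪p.1, p.2⟫ = 0}

lemma isCompact_orthoSet : IsCompact (orthoSet V) := by
  refine ((isCompact_closedBall (0 : V) 1).prod (isCompact_closedBall (0 : V) 1)).of_isClosed_subset
    ?_ fun p hp => ⟨by simp [hp.1], by simp [hp.2.1]⟩
  exact (isClosed_eq (by fun_prop) (by fun_prop)).inter
    ((isClosed_eq (by fun_prop) (by fun_prop)).inter (isClosed_eq (by fun_prop) (by fun_prop)))

lemma pairLaw_compl_orthoSet (h : 2 ≤ Module.finrank ℝ V) : pairLaw V (orthoSet V)ᶜ = 0 := by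
  have hm : MeasurableSet (orthoSet V) := isCompact_orthoSet.measurableSet
  rw [← lintegral_indicator_one hm.compl, lintegral_pairLaw h (measurable_one.indicator hm.compl)]
  refine (lintegral_congr fun ν => lintegral_congr fun θ => ?_).trans
    (b := ∫⁻ ν : USphere V, (∫⁻ θ : USphere (perp (ν : V)), 0 ∂sphereMeasure (perp (ν : V)))
      ∂sphereMeasure V) (by simp)
  have : ((ν : V), ((θ : perp (ν : V)) : V)) ∈ orthoSet V :=
    ⟨norm_coe_sphere ν, norm_eq_of_mem_sphere θ, inner_perp _⟩
  simp [this]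

/-- Two reflections take any pair of orthogonal unit vectors to any other. -/
lemma exists_isometry_pair_eq {p q : V × V} (hp : p ∈ orthoSet V) (hq : q ∈ orthoSet V) :
    ∃ e : V ≃ₗᵢ[ℝ] V, e p.1 = q.1 ∧ e p.2 = q.2 := by
  obtain ⟨hp1, hp2, hp3⟩ := hp
  obtain ⟨hq1, hq2, hq3⟩ := hq
  let e₁ := (Submodule.span ℝ {p.1 - q.1})ᗮ.reflection
  have h1 : e₁ p.1 = q.1 := Submodule.reflection_sub (by rw [hp1, hq1])
  let e₂ := (Submodule.span ℝ {e₁ p.2 - q.2})ᗮ.reflection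
  have h2 : e₂ (e₁ p.2) = q.2 := Submodule.reflection_sub (by rw [e₁.norm_map, hp2, hq2])
  have h3 : e₂ q.1 = q.1 := by
    refine Submodule.reflection_mem_subspace_eq_self ?_
    rw [Submodule.mem_orthogonal_singleton_iff_inner_left, inner_sub_right, hq3, ← h1,
      e₁.inner_map_map, hp3, sub_zero]
  exact ⟨e₁.trans e₂, by simp [h1, h3], by simp [h2]⟩

/-- The joint law of a random great sphere and a random point on it is symmetric. -/
theorem map_swap_pairLaw (h : 2 ≤ Module.finrank ℝ V) :
    (pairLaw V).map Prod.swap = pairLaw V := by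
  have := nontrivial_of_two_le h
  have := isProbabilityMeasure_pairLaw (V := V)
  have := Measure.isProbabilityMeasure_map (μ := pairLaw V) (f := Prod.swap)
    measurable_swap.aemeasurable
  have hm : MeasurableSet (orthoSet V) := isCompact_orthoSet.measurableSet
  refine measure_eq_of_transitiveOn isCompact_orthoSet ?_ (pairLaw_compl_orthoSet h) ?_
  · rw [Measure.map_apply measurable_swap hm.compl]
    convert pairLaw_compl_orthoSet h using 2
    ext p
    simp only [mem_preimage, mem_compl_iff, orthoSet, mem_ofPred_eq, Prod.fst_swap, Prod.snd_swap,
      real_inner_comm p.1 p.2]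
    tauto
  · intro p hp q hq
    obtain ⟨e, h1, h2⟩ := exists_isometry_pair_eq hp hq
    have hmap : Measurable (Prod.map e e) := (e.continuous.prodMap e.continuous).measurable
    let E : (V × V) ≃ᵢ (V × V) :=
      { toFun := Prod.map e e
        invFun := Prod.map e.symm e.symm
        left_inv := fun p => Prod.ext (e.symm_apply_apply _) (e.symm_apply_apply _)
        right_inv := fun p => Prod.ext (e.apply_symm_apply _) (e.apply_symm_apply _)
        isometry_toFun := Isometry.of_dist_eq fun p q => by simp [Prod.dist_eq] }
    have hE : ⇑E = Prod.map e e := rfl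
    refine ⟨E, Prod.ext h1 h2, fun z => ?_, ?_, ?_⟩
    · simp [hE, orthoSet]
    · rw [hE, Measure.map_map hmap measurable_swap]
      conv_rhs => rw [← map_pairLaw e, Measure.map_map measurable_swap hmap]
      rfl
    · rw [hE, map_pairLaw]

theorem lintegral_great_swap (h : 2 ≤ Module.finrank ℝ V) {F : V × V → ℝ≥0∞}
    (hF : Measurable F) :
    ∫⁻ ν : USphere V, (∫⁻ θ : USphere (perp (ν : V)),
      F ((ν : V), ((θ : perp (ν : V)) : V)) ∂sphereMeasure (perp (ν : V))) ∂sphereMeasure V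
    = ∫⁻ ν : USphere V, (∫⁻ θ : USphere (perp (ν : V)),
      F (((θ : perp (ν : V)) : V), (ν : V)) ∂sphereMeasure (perp (ν : V))) ∂sphereMeasure V := by
  refine (lintegral_pairLaw h hF).symm.trans (Eq.trans ?_
    (lintegral_pairLaw h (F := fun p => F p.swap) (by fun_prop)))
  conv_lhs => rw [← map_swap_pairLaw h]
  rw [lintegral_map hF measurable_swap]

theorem lintegral_great (h : 2 ≤ Module.finrank ℝ V) {f : V → ℝ≥0∞} (hf : Measurable f) :
    ∫⁻ ν : USphere V, (∫⁻ θ : USphere (perp (ν : V)),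
      f ((θ : perp (ν : V)) : V) ∂sphereMeasure (perp (ν : V))) ∂sphereMeasure V
    = ∫⁻ x : USphere V, f x ∂sphereMeasure V := by
  rw [lintegral_great_swap h (F := fun p => f p.2) (by fun_prop)]
  refine lintegral_congr fun ν => ?_
  have := nontrivial_perp ν h
  simp

lemma greatProj_greatProj_comm {u v : V} (huv : ⟪u, v⟫ = 0) (y : V) :
    greatProj u (greatProj v y) = greatProj v (greatProj u y) := by
  have hN : ∀ (w : V) (c : ℝ), 0 ≤ c → (c = 0 → w = 0) → ‖c⁻¹ • w‖⁻¹ • c⁻¹ • w = ‖w‖⁻¹ • w := by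
    intro w c hc h0
    rcases hc.eq_or_lt with rfl | hc
    · simp [h0 rfl]
    · rw [norm_smul, norm_inv, Real.norm_eq_abs, abs_of_pos hc, mul_inv, inv_inv, smul_smul]
      congr 1
      field_simp
  have key : ∀ u v : V, ⟪u, v⟫ = 0 → greatProj u (greatProj v y)
      = ‖y - ⟪v, y⟫ • v - ⟪u, y⟫ • u‖⁻¹ • (y - ⟪v, y⟫ • v - ⟪u, y⟫ • u) := by
    intro u v h
    have h1 : greatProj v y - ⟪u, greatProj v y⟫ • u
        = ‖y - ⟪v, y⟫ • v‖⁻¹ • (y - ⟪v, y⟫ • v - ⟪u, y⟫ • u) := by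
      simp only [greatProj, inner_smul_right, inner_sub_right, h, mul_zero, sub_zero, smul_sub,
        smul_smul]
    rw [greatProj, h1, hN _ _ (norm_nonneg _)]
    intro h0
    rw [norm_eq_zero] at h0
    have : ⟪u, y⟫ = 0 := by
      have h2 : ⟪u, y - ⟪v, y⟫ • v⟫ = ⟪u, y⟫ := by rw [inner_sub_right, inner_smul_right, h]; simp
      rw [← h2, h0, inner_zero_right]
    rw [h0, this]; simp
  have h2 : y - ⟪v, y⟫ • v - ⟪u, y⟫ • u = y - ⟪u, y⟫ • u - ⟪v, y⟫ • v := by abel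
  rw [key u v huv, key v u (by rw [real_inner_comm]; exact huv), h2]

/-- The great subsphere orthogonal to two orthogonal unit vectors, reached through either of them. -/
lemma lintegral_perp_perp_comm (h : 3 ≤ Module.finrank ℝ V) (θ : USphere V)
    (ν : USphere (perp (θ : V))) (ν' : USphere V) (θ' : USphere (perp (ν' : V)))
    (hν : ((ν : perp (θ : V)) : V) = ν') (hθ : ((θ' : perp (ν' : V)) : V) = θ)
    {f : V → ℝ≥0∞} (hf : Measurable f) :
    ∫⁻ ω : USphere (perp (ν : perp (θ : V))), f ((ω : perp (ν : perp (θ : V))) : perp (θ : V))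
        ∂sphereMeasure (perp (ν : perp (θ : V)))
      = ∫⁻ ω : USphere (perp (θ' : perp (ν' : V))),
        f ((ω : perp (θ' : perp (ν' : V))) : perp (ν' : V))
          ∂sphereMeasure (perp (θ' : perp (ν' : V))) := by
  have h1 := finrank_perp θ
  have h2 := finrank_perp ν'
  have hm : ∀ v : V, Measurable fun y : V => f (greatProj v y) := fun v =>
    hf.comp (measurable_greatProj.comp (by fun_prop : Measurable fun y : V => (v, y)))
  have e1 : ∀ y : perp (θ : V), ((greatProj (ν : perp (θ : V)) y : perp (θ : V)) : V)
      = greatProj (ν' : V) (y : V) := fun y => by rw [← hν]; rfl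
  have e2 : ∀ y : perp (ν' : V), ((greatProj (θ' : perp (ν' : V)) y : perp (ν' : V)) : V)
      = greatProj (θ : V) (y : V) := fun y => by rw [← hθ]; rfl
  rw [lintegral_perp_eq ν (by omega) (f := fun z => f z) (by fun_prop),
    lintegral_perp_eq θ' (by omega) (f := fun z => f z) (by fun_prop)]
  simp only [e1, e2]
  rw [lintegral_perp_eq θ (by omega) (hm ν'), lintegral_perp_eq ν' (by omega) (hm θ)]
  refine lintegral_congr fun y => ?_
  rw [greatProj_greatProj_comm]
  rw [real_inner_comm, ← hν]
  exact inner_perp _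

lemma measurable_arc_lintegral {f : V → ℝ≥0∞} (hf : Measurable f) (θ : V) (m : ℕ) :
    Measurable fun ω : V => ∫⁻ φ in Ioo (-Real.pi) Real.pi,
      ENNReal.ofReal (|Real.cos φ| ^ m) * f (arc θ ω φ) := by
  refine Measurable.lintegral_prod_right' (ν := volume.restrict (Ioo (-Real.pi) Real.pi))
    (f := fun p : V × ℝ => ENNReal.ofReal (|Real.cos p.2| ^ m) * f (arc θ p.1 p.2)) ?_
  refine Measurable.mul (by fun_prop) (hf.comp ?_)
  unfold arc; fun_prop

/-- Averaging over the great spheres through `θ`, with the sine of the distance to `θ` as a weight,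
gives the uniform measure on the sphere. -/
theorem lintegral_great_weight {m : ℕ} (h : Module.finrank ℝ V = m + 3) (θ : USphere V)
    {f : V → ℝ≥0∞} (hf : Measurable f) :
    ∫⁻ ν : USphere (perp (θ : V)), (∫⁻ x : USphere (perp ((ν : perp (θ : V)) : V)),
      ENNReal.ofReal √(1 - ⟪((x : perp ((ν : perp (θ : V)) : V)) : V), (θ : V)⟫ ^ 2) *
        f (x : perp ((ν : perp (θ : V)) : V)) ∂sphereMeasure (perp ((ν : perp (θ : V)) : V)))
        ∂sphereMeasure (perp (θ : V))
      = (cosWeight m)⁻¹ * cosWeight (m + 1) * ∫⁻ x : USphere V, f x ∂sphereMeasure V := by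
  have hfr := finrank_perp θ
  have hH := measurable_arc_lintegral hf (θ : V) (m + 1)
  have hin : ∀ ν : USphere (perp (θ : V)), ∫⁻ x : USphere (perp ((ν : perp (θ : V)) : V)),
      ENNReal.ofReal √(1 - ⟪((x : perp ((ν : perp (θ : V)) : V)) : V), (θ : V)⟫ ^ 2) *
        f (x : perp ((ν : perp (θ : V)) : V)) ∂sphereMeasure (perp ((ν : perp (θ : V)) : V))
      = (cosWeight m)⁻¹ * ∫⁻ ω : USphere (perp (ν : perp (θ : V))),
        (fun ω : V => ∫⁻ φ in Ioo (-Real.pi) Real.pi, ENNReal.ofReal (|Real.cos φ| ^ (m + 1)) *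
          f (arc (θ : V) ω φ)) ((ω : perp (ν : perp (θ : V))) : perp (θ : V))
          ∂sphereMeasure (perp (ν : perp (θ : V))) := by
    intro ν
    let ν' : USphere V := ⟨((ν : perp (θ : V)) : V), by
      rw [mem_sphere_zero_iff_norm]; exact norm_eq_of_mem_sphere ν⟩
    let θ' : USphere (perp (ν' : V)) := ⟨⟨(θ : V), by
      rw [Submodule.mem_orthogonal_singleton_iff_inner_right, real_inner_comm]
      exact inner_perp _⟩, by rw [mem_sphere_zero_iff_norm]; exact norm_coe_sphere θ⟩
    rw [lintegral_perp_perp_comm (by omega) θ ν ν' θ' rfl rfl hH]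
    have hfr' := finrank_perp ν'
    have := lintegral_sphere_eq_arc θ' (m := m) (by omega)
      (f := fun x : perp (ν' : V) => ENNReal.ofReal √(1 - ⟪(x : V), (θ : V)⟫ ^ 2) * f x)
      (by fun_prop)
    refine this.trans ?_
    congr 1
    refine lintegral_congr fun ω => lintegral_congr fun φ => ?_
    have h1 : ((arc (θ' : perp (ν' : V)) (ω : perp (θ' : perp (ν' : V))) φ : perp (ν' : V)) : V)
        = arc (θ : V) (((ω : perp (θ' : perp (ν' : V))) : perp (ν' : V)) : V) φ := rfl
    have h2 : ⟪(((ω : perp (θ' : perp (ν' : V))) : perp (ν' : V)) : V), (θ : V)⟫ = 0 := by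
      rw [real_inner_comm]; exact inner_perp (v := (θ' : perp (ν' : V))) _
    have h3 : ⟪arc (θ : V) (((ω : perp (θ' : perp (ν' : V))) : perp (ν' : V)) : V) φ, (θ : V)⟫
        = Real.sin φ := by
      rw [arc, inner_add_left, inner_smul_left, inner_smul_left, h2, real_inner_self_eq_norm_sq,
        norm_coe_sphere]
      simp
    rw [h1, h3, ← Real.cos_sq', Real.sqrt_sq_eq_abs, ← mul_assoc, ← ENNReal.ofReal_mul (by positivity),
      ← pow_succ]
  have := nontrivial_perp θ (by omega)
  simp only [hin]
  rw [lintegral_const_mul' _ _ (ENNReal.inv_ne_top.2 (cosWeight_ne_zero m)),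
    lintegral_great (V := perp (θ : V)) (by omega) (f := fun ω : perp (θ : V) =>
      ∫⁻ φ in Ioo (-Real.pi) Real.pi, ENNReal.ofReal (|Real.cos φ| ^ (m + 1)) *
          f (arc (θ : V) (ω : V) φ)) (hH.comp measurable_subtype_coe),
    lintegral_sphere_eq_arc θ (m := m + 1) (by omega) hf, mul_assoc, ← mul_assoc (cosWeight (m + 1)),
    ENNReal.mul_inv_cancel (cosWeight_ne_zero _) (cosWeight_ne_top _), one_mul]

/-- Two points chosen independently on a random great sphere, weighted by the sine of their
distance, become independent and uniform. -/
theorem lintegral_great_pair {m : ℕ} (h : Module.finrank ℝ V = m + 3)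
    {F : V × V → ℝ≥0∞} (hF : Measurable F) :
    ∫⁻ ν : USphere V, (∫⁻ θ : USphere (perp (ν : V)), (∫⁻ x : USphere (perp (ν : V)),
      ENNReal.ofReal √(1 - ⟪((x : perp (ν : V)) : V), ((θ : perp (ν : V)) : V)⟫ ^ 2) *
        F (((θ : perp (ν : V)) : V), ((x : perp (ν : V)) : V)) ∂sphereMeasure (perp (ν : V)))
          ∂sphereMeasure (perp (ν : V))) ∂sphereMeasure V
      = (cosWeight m)⁻¹ * cosWeight (m + 1) *
        ∫⁻ θ : USphere V, (∫⁻ x : USphere V, F (θ, x) ∂sphereMeasure V) ∂sphereMeasure V := by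
  have := nontrivial_of_two_le (V := V) (by omega)
  have hF' : Measurable fun p : USphere V × USphere V => F ((p.1 : V), (p.2 : V)) := by fun_prop
  -- only unit vectors matter, but the swapping lemma asks for a function on all pairs
  let G : V × V → ℝ≥0∞ := fun p => ∫⁻ y : USphere V,
    ENNReal.ofReal √(1 - ⟪greatProj p.1 (y : V), p.2⟫ ^ 2) * F (p.2, greatProj p.1 (y : V))
      ∂sphereMeasure V
  have hgm : Measurable fun q : (V × V) × USphere V => greatProj q.1.1 (q.2 : V) :=
    measurable_greatProj.comp
      (by fun_prop : Measurable fun q : (V × V) × USphere V => (q.1.1, (q.2 : V)))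
  have hG : Measurable G := by
    refine Measurable.lintegral_prod_right' (f := fun q : (V × V) × USphere V =>
      ENNReal.ofReal √(1 - ⟪greatProj q.1.1 (q.2 : V), q.1.2⟫ ^ 2) *
        F (q.1.2, greatProj q.1.1 (q.2 : V))) ?_
    fun_prop
  have hin : ∀ (ν : USphere V) (z : V), ∫⁻ x : USphere (perp (ν : V)),
      ENNReal.ofReal √(1 - ⟪((x : perp (ν : V)) : V), z⟫ ^ 2) *
        F (z, ((x : perp (ν : V)) : V)) ∂sphereMeasure (perp (ν : V)) = G ((ν : V), z) :=
    fun ν z => lintegral_perp_eq ν (by omega)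
      (f := fun x => ENNReal.ofReal √(1 - ⟪x, z⟫ ^ 2) * F (z, x)) (by fun_prop)
  simp only [hin]
  rw [lintegral_great_swap (by omega) hG, ← lintegral_const_mul _ (hF'.lintegral_prod_right')]
  refine lintegral_congr fun θ => ?_
  rw [← lintegral_great_weight h θ (f := fun x => F ((θ : V), x)) (by fun_prop)]
  refine lintegral_congr fun ν => ?_
  exact (hin ⟨((ν : perp (θ : V)) : V), by
      rw [mem_sphere_zero_iff_norm]; exact norm_eq_of_mem_sphere ν⟩ θ).symm

end Great

/-! ### Smooth homogeneous functions and the spherical Laplacian -/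

section Homogeneous

variable {V : Type*} [NormedAddCommGroup V] [InnerProductSpace ℝ V] [FiniteDimensional ℝ V]

/-- Smoothness, of class `C^∞`. -/
abbrev Smooth {V : Type*} [NormedAddCommGroup V] [NormedSpace ℝ V] (f : V → ℂ) : Prop :=
  ContDiff ℝ ((⊤ : ℕ∞) : WithTop ℕ∞) f

/-- The derivative of `f` in the direction `v`. -/
noncomputable def dirD (v : V) (f : V → ℂ) : V → ℂ := fun x => fderiv ℝ f x v

lemma Smooth.dirD {f : V → ℂ} (hf : Smooth f) (v : V) : Smooth (dirD v f) :=
  (hf.fderiv_right (m := ((⊤ : ℕ∞) : WithTop ℕ∞)) (by simp)).clm_apply contDiff_const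

lemma Smooth.differentiableAt {f : V → ℂ} (hf : Smooth f) (x : V) : DifferentiableAt ℝ f x :=
  (ContDiff.differentiable hf (by simp)) x

lemma dirD_add {f g : V → ℂ} (hf : Smooth f) (hg : Smooth g) (v : V) :
    dirD v (fun x => f x + g x) = fun x => dirD v f x + dirD v g x := by
  funext x
  simp [dirD, fderiv_fun_add (hf.differentiableAt x) (hg.differentiableAt x)]

lemma dirD_sub {f g : V → ℂ} (hf : Smooth f) (hg : Smooth g) (v : V) :
    dirD v (fun x => f x - g x) = fun x => dirD v f x - dirD v g x := by
  funext x
  simp [dirD, fderiv_fun_sub (hf.differentiableAt x) (hg.differentiableAt x)]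

lemma smooth_inner (v : V) : Smooth fun x : V => ((⟪v, x⟫ : ℝ) : ℂ) :=
  Complex.ofRealCLM.contDiff.comp (innerSL ℝ v).contDiff

lemma dirD_inner (v w : V) : dirD w (fun x : V => ((⟪v, x⟫ : ℝ) : ℂ)) = fun _ => ((⟪v, w⟫ : ℝ) : ℂ) := by
  funext x
  have h : (fun x : V => ((⟪v, x⟫ : ℝ) : ℂ)) = ⇑(Complex.ofRealCLM.comp (innerSL ℝ v)) := by
    funext y; simp
  rw [dirD, h, ContinuousLinearMap.fderiv]
  simp

lemma dirD_mul {f g : V → ℂ} (hf : Smooth f) (hg : Smooth g) (v : V) :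
    dirD v (fun x => f x * g x) = fun x => dirD v f x * g x + f x * dirD v g x := by
  funext x
  simp only [dirD]
  rw [fderiv_fun_mul (hf.differentiableAt x) (hg.differentiableAt x)]
  simp [mul_comm, add_comm]

lemma fderiv_eq_sum (b : OrthonormalBasis (Fin (Module.finrank ℝ V)) ℝ V) (f : V → ℂ) (x y : V) :
    fderiv ℝ f x y = ∑ i, ((⟪b i, y⟫ : ℝ) : ℂ) * dirD (b i) f x := by
  conv_lhs => rw [← b.sum_repr' y]
  simp only [map_sum, map_smul, dirD]
  simp

/-- The angular derivative in the plane of `a` and `b`. -/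
noncomputable def angD (a b : V) (f : V → ℂ) : V → ℂ := fun x =>
  ((⟪a, x⟫ : ℝ) : ℂ) * dirD b f x - ((⟪b, x⟫ : ℝ) : ℂ) * dirD a f x

lemma Smooth.angD {f : V → ℂ} (hf : Smooth f) (a b : V) : Smooth (angD a b f) :=
  ((smooth_inner a).mul (hf.dirD b)).sub ((smooth_inner b).mul (hf.dirD a))

/-- A smooth function that is homogeneous of degree `n`; these are exactly the homogeneous
polynomials of degree `n`, see `SmoothHomog.exists_form`. -/
structure SmoothHomog {V : Type*} [NormedAddCommGroup V] [InnerProductSpace ℝ V]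
    (n : ℕ) (f : V → ℂ) : Prop where
  smooth : Smooth f
  homog : ∀ (t : ℝ) (x : V), f (t • x) = ((t : ℂ)) ^ n * f x

/-- The Laplacian, as a sum of second directional derivatives. -/
noncomputable def lapl {V : Type*} [NormedAddCommGroup V] [InnerProductSpace ℝ V]
    [FiniteDimensional ℝ V] (f : V → ℂ) : V → ℂ := fun x =>
  ∑ i, dirD (stdOrthonormalBasis ℝ V i) (dirD (stdOrthonormalBasis ℝ V i) f) x

lemma Smooth.lapl {f : V → ℂ} (hf : Smooth f) : Smooth (lapl f) :=
  ContDiff.sum fun _ _ => (hf.dirD _).dirD _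

lemma lapl_eq_laplacian {f : V → ℂ} (hf : Smooth f) : Laplacian.laplacian f = lapl f := by
  rw [InnerProductSpace.laplacian_eq_iteratedFDeriv_stdOrthonormalBasis]
  funext x
  refine Finset.sum_congr rfl fun i _ => ?_
  have hd : DifferentiableAt ℝ (fderiv ℝ f) x :=
    ((hf.fderiv_right (m := ((⊤ : ℕ∞) : WithTop ℕ∞)) (by simp)).differentiable (by simp)) x
  rw [iteratedFDeriv_two_apply]
  change _ = fderiv ℝ (fun y => fderiv ℝ f y _) x _
  rw [fderiv_clm_apply hd (differentiableAt_const _)]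
  simp

lemma lapl_sub {f g : V → ℂ} (hf : Smooth f) (hg : Smooth g) :
    lapl (fun x => f x - g x) = fun x => lapl f x - lapl g x := by
  funext x
  simp only [lapl, ← Finset.sum_sub_distrib]
  refine Finset.sum_congr rfl fun i _ => ?_
  rw [dirD_sub hf hg, dirD_sub (hf.dirD _) (hg.dirD _)]

lemma lapl_add {f g : V → ℂ} (hf : Smooth f) (hg : Smooth g) :
    lapl (fun x => f x + g x) = fun x => lapl f x + lapl g x := by
  funext x
  simp only [lapl, ← Finset.sum_add_distrib]
  refine Finset.sum_congr rfl fun i _ => ?_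
  rw [dirD_add hf hg, dirD_add (hf.dirD _) (hg.dirD _)]

lemma lapl_const_mul {f : V → ℂ} (hf : Smooth f) (c : ℂ) :
    lapl (fun x => c * f x) = fun x => c * lapl f x := by
  have h : ∀ (g : V → ℂ) (_ : Smooth g) (v : V),
      dirD v (fun x => c * g x) = fun x => c * dirD v g x := fun g hg v => by
    funext x
    simp [dirD, fderiv_const_mul (hg.differentiableAt x)]
  funext x
  simp only [lapl, Finset.mul_sum]
  refine Finset.sum_congr rfl fun i _ => ?_
  rw [h f hf, h _ (hf.dirD _)]

namespace SmoothHomog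

variable {n : ℕ} {f g : V → ℂ}

lemma add (hf : SmoothHomog n f) (hg : SmoothHomog n g) : SmoothHomog n fun x => f x + g x :=
  ⟨hf.smooth.add hg.smooth, fun t x => by rw [hf.homog, hg.homog]; ring⟩

lemma sub (hf : SmoothHomog n f) (hg : SmoothHomog n g) : SmoothHomog n fun x => f x - g x :=
  ⟨hf.smooth.sub hg.smooth, fun t x => by rw [hf.homog, hg.homog]; ring⟩

lemma const_mul (hf : SmoothHomog n f) (c : ℂ) : SmoothHomog n fun x => c * f x :=
  ⟨contDiff_const.mul hf.smooth, fun t x => by rw [hf.homog]; ring⟩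

lemma zero : SmoothHomog n fun _ : V => (0 : ℂ) :=
  ⟨contDiff_const, fun t x => by simp⟩

lemma mul {m : ℕ} (hf : SmoothHomog n f) (hg : SmoothHomog m g) :
    SmoothHomog (n + m) fun x => f x * g x :=
  ⟨hf.smooth.mul hg.smooth, fun t x => by rw [hf.homog, hg.homog]; ring⟩

lemma conj (hf : SmoothHomog n f) : SmoothHomog n fun x => starRingEnd ℂ (f x) :=
  ⟨Complex.conjCLE.contDiff.comp hf.smooth, fun t x => by rw [hf.homog]; simp⟩

lemma inner (v : V) : SmoothHomog 1 fun x : V => ((⟪v, x⟫ : ℝ) : ℂ) :=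
  ⟨smooth_inner v, fun t x => by rw [inner_smul_right]; simp⟩

lemma norm_sq : SmoothHomog 2 fun x : V => ((‖x‖ ^ 2 : ℝ) : ℂ) :=
  ⟨Complex.ofRealCLM.contDiff.comp (contDiff_norm_sq ℝ), fun t x => by
    rw [norm_smul, mul_pow, Real.norm_eq_abs, sq_abs]; simp⟩

lemma const (c : ℂ) : SmoothHomog 0 fun _ : V => c := ⟨contDiff_const, fun t x => by simp⟩

lemma of_form (A : V [×n]→L[ℝ] ℂ) : SmoothHomog n fun x => A fun _ => x :=
  ⟨A.contDiff.comp (contDiff_pi.2 fun _ => contDiff_id), fun t x => by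
    rw [A.map_smul_univ (fun _ => t) (fun _ => x)]; simp⟩

/-- A smooth homogeneous function of degree `n` is given by its `n`-th derivative at the origin. -/
lemma exists_form (hf : SmoothHomog n f) : ∃ A : V [×n]→L[ℝ] ℂ, ∀ x, f x = A fun _ => x := by
  refine ⟨((n.factorial : ℝ)⁻¹) • iteratedFDeriv ℝ n f 0, fun x => ?_⟩
  have h1 := ContinuousLinearMap.iteratedFDeriv_comp_right (i := n)
    (ContinuousLinearMap.toSpanSingleton ℝ x) hf.smooth 0
    (by exact_mod_cast le_top (a := (n : ℕ∞)))
  have h2 : f ∘ ⇑(ContinuousLinearMap.toSpanSingleton ℝ x) = fun t : ℝ => t ^ n • f x := by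
    funext t
    simp [hf.homog, Complex.real_smul]
  have h3 := congrArg (fun A : ℝ [×n]→L[ℝ] ℂ => A fun _ => 1) h1
  simp only [ContinuousMultilinearMap.compContinuousLinearMap_apply, h2, map_zero,
    ContinuousLinearMap.toSpanSingleton_apply, one_smul] at h3
  rw [← iteratedDeriv_eq_iteratedFDeriv] at h3
  have h4 : iteratedDeriv n (fun t : ℝ => t ^ n • f x) 0 = (n.factorial : ℝ) • f x := by
    rw [iteratedDeriv_smul_const (by fun_prop)]
    simp [Nat.descFactorial_self]
  rw [h4] at h3
  rw [smul_apply, ← h3, smul_smul, inv_mul_cancel₀ (by positivity),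
    one_smul]

lemma euler (hf : SmoothHomog n f) (x : V) : fderiv ℝ f x x = n * f x := by
  have h1 : HasDerivAt (fun t : ℝ => f (t • x)) (fderiv ℝ f ((1 : ℝ) • x) x) 1 := by
    have h := (hf.smooth.differentiableAt ((1 : ℝ) • x)).hasFDerivAt.comp_hasDerivAt (1 : ℝ)
      ((hasDerivAt_id (1 : ℝ)).smul_const x)
    simpa [Function.comp_def] using h
  have h2 : HasDerivAt (fun t : ℝ => f (t • x)) (n * f x) 1 := by
    simp only [hf.homog]
    have h := ((hasDerivAt_pow n (1 : ℝ)).ofReal_comp).mul_const (f x)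
    simpa using h
  rw [one_smul] at h1
  exact h1.unique h2

lemma fderiv_smul (hf : SmoothHomog n f) (t : ℝ) (x v : V) :
    (t : ℂ) * fderiv ℝ f (t • x) v = (t : ℂ) ^ n * fderiv ℝ f x v := by
  have h1 : HasFDerivAt (fun y : V => f (t • y)) ((fderiv ℝ f (t • x)).comp
      (t • ContinuousLinearMap.id ℝ V)) x :=
    (hf.smooth.differentiableAt (t • x)).hasFDerivAt.comp x ((hasFDerivAt_id x).const_smul t)
  have h2 : HasFDerivAt (fun y : V => f (t • y)) (((t : ℂ) ^ n) • fderiv ℝ f x) x := by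
    simp only [hf.homog]
    exact (hf.smooth.differentiableAt x).hasFDerivAt.const_mul ((t : ℂ) ^ n)
  have h3 := congrArg (fun L : V →L[ℝ] ℂ => L v) (h1.unique h2)
  simpa using h3

lemma dirD (hf : SmoothHomog (n + 1) f) (v : V) : SmoothHomog n (dirD v f) := by
  refine ⟨hf.smooth.dirD v, ?_⟩
  intro t x
  have hcont : Continuous (GreatSphere.dirD v f) := (hf.smooth.dirD v).continuous
  have h1 : Continuous fun t : ℝ => GreatSphere.dirD v f (t • x) :=
    hcont.comp (by fun_prop)
  have h2 : Continuous fun t : ℝ => (t : ℂ) ^ n * GreatSphere.dirD v f x := by fun_prop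
  refine congrFun (Continuous.ext_on (dense_compl_singleton (0 : ℝ)) h1 h2 fun t ht => ?_) t
  have ht' : (t : ℂ) ≠ 0 := by exact_mod_cast ht
  have h3 := hf.fderiv_smul t x v
  rw [pow_succ', mul_assoc] at h3
  exact mul_left_cancel₀ ht' h3

lemma dirD_zero (hf : SmoothHomog 0 f) (v : V) : GreatSphere.dirD v f = fun _ => 0 := by
  have h : f = fun _ => f 0 := by
    funext x
    have := hf.homog 0 x
    simpa using this.symm
  funext x
  rw [h]
  simp [GreatSphere.dirD]

lemma lapl (hf : SmoothHomog (n + 2) f) : SmoothHomog n (lapl f) := by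
  refine ⟨hf.smooth.lapl, fun t x => ?_⟩
  simp only [GreatSphere.lapl, Finset.mul_sum]
  exact Finset.sum_congr rfl fun i _ => ((hf.dirD _).dirD _).homog t x

lemma lapl_of_lt_two (hf : SmoothHomog n f) (hn : n < 2) : GreatSphere.lapl f = fun _ => 0 := by
  funext x
  refine Finset.sum_eq_zero fun i _ => ?_
  match n, hn with
  | 0, _ => rw [hf.dirD_zero]; simp [GreatSphere.dirD]
  | 1, _ => rw [(hf.dirD _).dirD_zero]

lemma euler_dirD (hf : SmoothHomog n f) (v x : V) :
    fderiv ℝ (GreatSphere.dirD v f) x x = ((n : ℂ) - 1) * GreatSphere.dirD v f x := by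
  match n with
  | 0 => rw [hf.dirD_zero]; simp
  | n + 1 => rw [(hf.dirD v).euler]; push_cast; ring

/-- The sum of the squares of the angular derivatives is the spherical Laplacian. -/
lemma sum_angD_angD (hf : SmoothHomog n f) (x : V) :
    ∑ i, ∑ j, angD (stdOrthonormalBasis ℝ V i) (stdOrthonormalBasis ℝ V j)
      (angD (stdOrthonormalBasis ℝ V i) (stdOrthonormalBasis ℝ V j) f) x
    = 2 * (((‖x‖ ^ 2 : ℝ) : ℂ) * GreatSphere.lapl f x
      - (n : ℂ) * ((n : ℂ) + Module.finrank ℝ V - 2) * f x) := by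
  set b := stdOrthonormalBasis ℝ V
  have hs := hf.smooth
  set c : Fin (Module.finrank ℝ V) → ℂ := fun i => ((⟪b i, x⟫ : ℝ) : ℂ)
  have hδ : ∀ i j, ⟪b i, b j⟫ = if i = j then (1 : ℝ) else 0 :=
    fun i j => orthonormal_iff_ite.1 b.orthonormal i j
  have hE : ∑ i, c i * GreatSphere.dirD (b i) f x = n * f x := by
    rw [← hf.euler, fderiv_eq_sum b]
  have hE2 : ∀ j, ∑ i, c i * GreatSphere.dirD (b i) (GreatSphere.dirD (b j) f) x
      = ((n : ℂ) - 1) * GreatSphere.dirD (b j) f x := fun j => by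
    rw [← hf.euler_dirD, fderiv_eq_sum b]
  have hN : ∑ i, c i ^ 2 = ((‖x‖ ^ 2 : ℝ) : ℂ) := by
    rw [← b.sum_sq_inner_right x]; push_cast; rfl
  have hterm : ∀ i j, angD (b i) (b j) (angD (b i) (b j) f) x
      = (c i ^ 2 * GreatSphere.dirD (b j) (GreatSphere.dirD (b j) f) x
        + c j ^ 2 * GreatSphere.dirD (b i) (GreatSphere.dirD (b i) f) x)
        - (c i * GreatSphere.dirD (b i) f x + c j * GreatSphere.dirD (b j) f x)
        - (c i * (c j * GreatSphere.dirD (b j) (GreatSphere.dirD (b i) f) x)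
          + c j * (c i * GreatSphere.dirD (b i) (GreatSphere.dirD (b j) f) x))
        + (if i = j then c i * GreatSphere.dirD (b j) f x + c j * GreatSphere.dirD (b i) f x
          else 0) := by
    intro i j
    have h1 : ∀ k, GreatSphere.dirD (b k) (angD (b i) (b j) f) x
        = ((⟪b i, b k⟫ : ℝ) : ℂ) * GreatSphere.dirD (b j) f x
          + c i * GreatSphere.dirD (b k) (GreatSphere.dirD (b j) f) x
          - (((⟪b j, b k⟫ : ℝ) : ℂ) * GreatSphere.dirD (b i) f x
          + c j * GreatSphere.dirD (b k) (GreatSphere.dirD (b i) f) x) := by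
      intro k
      unfold angD
      rw [dirD_sub ((smooth_inner _).mul (hs.dirD _)) ((smooth_inner _).mul (hs.dirD _)),
        dirD_mul (smooth_inner _) (hs.dirD _), dirD_mul (smooth_inner _) (hs.dirD _)]
      simp only [dirD_inner, c]
    change c i * GreatSphere.dirD (b j) (angD (b i) (b j) f) x
      - c j * GreatSphere.dirD (b i) (angD (b i) (b j) f) x = _
    rw [h1, h1, hδ, hδ, hδ, hδ]
    by_cases hij : i = j
    · subst hij; simp; ring
    · simp [hij, Ne.symm hij]; ring
  simp only [hterm, Finset.sum_add_distrib, Finset.sum_sub_distrib, Finset.sum_ite_eq,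
    Finset.mem_univ, if_true]
  have h5 : ∑ i, ∑ j, c i * (c j * GreatSphere.dirD (b j) (GreatSphere.dirD (b i) f) x)
      = ((n : ℂ) - 1) * (n * f x) := by
    simp only [← Finset.mul_sum, hE2]
    rw [← hE, Finset.mul_sum]
    exact Finset.sum_congr rfl fun i _ => by ring
  have h6 : ∑ i, ∑ j, c j * (c i * GreatSphere.dirD (b i) (GreatSphere.dirD (b j) f) x)
      = ((n : ℂ) - 1) * (n * f x) := by
    rw [Finset.sum_comm]; exact h5
  have h7 : ∑ i, GreatSphere.dirD (b i) (GreatSphere.dirD (b i) f) x = GreatSphere.lapl f x := rfl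
  have h8 : ∑ i, ∑ _j : Fin (Module.finrank ℝ V), c i * GreatSphere.dirD (b i) f x = Module.finrank ℝ V * (n * f x) := by
    simp only [Finset.sum_const, Finset.card_univ, Fintype.card_fin, nsmul_eq_mul,
      ← Finset.mul_sum, hE]
  have h9 : ∑ _i : Fin (Module.finrank ℝ V), ∑ j, c j * GreatSphere.dirD (b j) f x = Module.finrank ℝ V * (n * f x) := by
    rw [Finset.sum_comm]; exact h8
  have h10 : ∑ i, ∑ j, c i ^ 2 * GreatSphere.dirD (b j) (GreatSphere.dirD (b j) f) x
      = ((‖x‖ ^ 2 : ℝ) : ℂ) * GreatSphere.lapl f x := by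
    simp only [← Finset.mul_sum, ← Finset.sum_mul, hN, h7]
  have h11 : ∑ i, ∑ j, c j ^ 2 * GreatSphere.dirD (b i) (GreatSphere.dirD (b i) f) x
      = ((‖x‖ ^ 2 : ℝ) : ℂ) * GreatSphere.lapl f x := by
    rw [Finset.sum_comm]; exact h10
  rw [h5, h6, h8, h9, h10, h11, hE]
  ring

end SmoothHomog

end Homogeneous

/-! ### Differentiation under the integral sign over a compact space -/

section Parametric

universe u

variable {P : Type u} [NormedAddCommGroup P] [NormedSpace ℝ P] [FiniteDimensional ℝ P]
  {Y : Type*} [NormedAddCommGroup Y] [NormedSpace ℝ Y]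
  {X : Type*} [TopologicalSpace X] [CompactSpace X] [SecondCountableTopology X]
  [MeasurableSpace X] [BorelSpace X]
  {μ : Measure X} [IsFiniteMeasure μ] {ι : X → Y}

lemma integrable_of_continuous {E : Type*} [NormedAddCommGroup E] {F : X → E}
    (hF : Continuous F) : Integrable F μ := by
  obtain ⟨C, hC⟩ := isCompact_univ.exists_bound_of_continuousOn hF.continuousOn
  exact Integrable.of_bound hF.aestronglyMeasurable C (Filter.Eventually.of_forall fun x => hC x (mem_univ x))

lemma hasFDerivAt_integral_param {E : Type*} [NormedAddCommGroup E] [NormedSpace ℝ E]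
    (hι : Continuous ι) {H : P × Y → E} (hH : ContDiff ℝ 1 H) (p₀ : P) :
    HasFDerivAt (fun p => ∫ x, H (p, ι x) ∂μ)
      (∫ x, (fderiv ℝ H (p₀, ι x)).comp (ContinuousLinearMap.inl ℝ P Y) ∂μ) p₀ := by
  have hcont : Continuous fun q : P × X =>
      (fderiv ℝ H (q.1, ι q.2)).comp (ContinuousLinearMap.inl ℝ P Y) :=
    ((hH.continuous_fderiv one_ne_zero).comp (by fun_prop)).clm_comp continuous_const
  have : ProperSpace P := FiniteDimensional.proper_real P
  obtain ⟨C, hC⟩ := ((isCompact_closedBall p₀ 1).prod (isCompact_univ (X := X))).exists_bound_of_continuousOn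
    hcont.continuousOn
  refine hasFDerivAt_integral_of_dominated_of_fderiv_le (bound := fun _ => C)
    (F' := fun p x => (fderiv ℝ H (p, ι x)).comp (ContinuousLinearMap.inl ℝ P Y))
    (Metric.closedBall_mem_nhds p₀ one_pos) ?_ ?_ ?_ ?_ (integrable_const _) ?_
  · exact Filter.Eventually.of_forall fun p =>
      (hH.continuous.comp (by fun_prop : Continuous fun x => (p, ι x))).aestronglyMeasurable
  · exact integrable_of_continuous (hH.continuous.comp (by fun_prop : Continuous fun x => (p₀, ι x)))
  · exact (hcont.comp (by fun_prop : Continuous fun x => (p₀, x))).aestronglyMeasurable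
  · exact Filter.Eventually.of_forall fun x p hp => hC (p, x) ⟨hp, mem_univ x⟩
  · refine Filter.Eventually.of_forall fun x p _ => ?_
    exact ((hH.differentiable one_ne_zero) (p, ι x)).hasFDerivAt.comp p (hasFDerivAt_prodMk_left p (ι x))

lemma contDiff_integral_param {k : ℕ} {E : Type u} [NormedAddCommGroup E] [NormedSpace ℝ E]
    (hι : Continuous ι) {H : P × Y → E} (hH : ContDiff ℝ k H) :
    ContDiff ℝ k fun p => ∫ x, H (p, ι x) ∂μ := by
  induction k generalizing E with
  | zero =>
    simp only [Nat.cast_zero, contDiff_zero] at hH ⊢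
    have : Continuous fun q : P × X => H (q.1, ι q.2) := hH.comp (by fun_prop)
    have h := continuous_parametric_integral_of_continuous (μ := μ) (s := univ)
      (f := fun p x => H (p, ι x)) this isCompact_univ
    simpa using h
  | succ k ih =>
    push_cast
    rw [contDiff_succ_iff_hasFDerivAt]
    refine ⟨_, ih (E := P →L[ℝ] E) (H := fun q => (fderiv ℝ H q).comp (ContinuousLinearMap.inl ℝ P Y)) ?_,
      fun p => hasFDerivAt_integral_param hι (hH.of_le (by norm_cast; omega)) p⟩
    exact (hH.fderiv_right (by norm_cast)).clm_comp contDiff_const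

lemma norm_iteratedFDeriv_integral_param_le {k j : ℕ} (hj : j ≤ k) {E : Type u}
    [NormedAddCommGroup E] [NormedSpace ℝ E]
    (hι : Continuous ι) {H : P × Y → E} (hH : ContDiff ℝ k H) (p : P) {C : ℝ}
    (hC : ∀ x, ‖iteratedFDeriv ℝ j H (p, ι x)‖ ≤ C) :
    ‖iteratedFDeriv ℝ j (fun p => ∫ x, H (p, ι x) ∂μ) p‖ ≤ C * μ.real univ := by
  induction j generalizing k E with
  | zero =>
    simp only [norm_iteratedFDeriv_zero] at hC ⊢
    exact norm_integral_le_of_norm_le_const (Filter.Eventually.of_forall hC)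
  | succ j ih =>
    obtain ⟨k, rfl⟩ := Nat.exists_eq_add_of_le' (by omega : 1 ≤ k)
    rw [← norm_iteratedFDeriv_fderiv]
    have h1 : fderiv ℝ (fun p => ∫ x, H (p, ι x) ∂μ) = fun p =>
        ∫ x, (fderiv ℝ H (p, ι x)).comp (ContinuousLinearMap.inl ℝ P Y) ∂μ := funext fun p =>
      (hasFDerivAt_integral_param hι (hH.of_le (by norm_cast; omega)) p).fderiv
    rw [h1]
    have hH' : ContDiff ℝ k (fderiv ℝ H) := hH.fderiv_right (by norm_cast)
    let R : ((P × Y) →L[ℝ] E) →L[ℝ] (P →L[ℝ] E) :=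
      (ContinuousLinearMap.compL ℝ P (P × Y) E).flip (ContinuousLinearMap.inl ℝ P Y)
    have hR : ‖R‖ ≤ 1 := ContinuousLinearMap.opNorm_le_bound _ zero_le_one fun L => by
      refine (ContinuousLinearMap.opNorm_comp_le _ _).trans ?_
      rw [one_mul]
      exact mul_le_of_le_one_right (norm_nonneg _) (ContinuousLinearMap.norm_inl_le_one ℝ P Y)
    refine ih (k := k) (by omega) (E := P →L[ℝ] E) (H := fun q => R (fderiv ℝ H q))
      (R.contDiff.comp hH') fun x => ?_
    refine (R.norm_iteratedFDeriv_comp_left hH'.contDiffAt (by norm_cast; omega)).trans ?_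
    rw [norm_iteratedFDeriv_fderiv]
    exact (mul_le_of_le_one_left (norm_nonneg _) hR).trans (hC x)

end Parametric

/-! ### Orthogonality of spherical harmonics of different degrees -/

section Orthogonality

variable {V : Type*} [NormedAddCommGroup V] [InnerProductSpace ℝ V] [FiniteDimensional ℝ V]

/-- Rotation by the angle `t` in the plane spanned by the orthonormal vectors `a` and `b`. -/
noncomputable def rotFun (a b : V) (t : ℝ) (x : V) : V :=
  x + ((Real.cos t - 1) * ⟪a, x⟫ - Real.sin t * ⟪b, x⟫) • a +
    (Real.sin t * ⟪a, x⟫ + (Real.cos t - 1) * ⟪b, x⟫) • b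

lemma norm_rotFun {a b : V} (ha : ‖a‖ = 1) (hb : ‖b‖ = 1) (hab : ⟪a, b⟫ = 0) (t : ℝ) (x : V) :
    ‖rotFun a b t x‖ = ‖x‖ := by
  rw [← sq_eq_sq₀ (norm_nonneg _) (norm_nonneg _), rotFun, norm_add_sq_real, norm_add_sq_real]
  simp only [inner_add_left, inner_smul_left, inner_smul_right, norm_smul, ha, hb, hab,
    Real.norm_eq_abs, mul_one, sq_abs, real_inner_comm a x, real_inner_comm b x,
    RCLike.conj_to_real]
  linear_combination (⟪a, x⟫ ^ 2 + ⟪b, x⟫ ^ 2) * (Real.sin_sq_add_cos_sq t)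

/-- Rotation by the angle `t`, as a linear isometry equivalence. -/
noncomputable def rot {a b : V} (ha : ‖a‖ = 1) (hb : ‖b‖ = 1) (hab : ⟪a, b⟫ = 0) (t : ℝ) :
    V ≃ₗᵢ[ℝ] V :=
  LinearIsometry.toLinearIsometryEquiv
    { toFun := rotFun a b t
      map_add' := fun x y => by
        simp only [rotFun, inner_add_right, mul_add, add_smul, sub_smul]; abel
      map_smul' := fun c x => by
        simp only [rotFun, inner_smul_right, smul_add, smul_smul, RingHom.id_apply]
        congr 2
        · congr 1; ring_nf
        · ring_nf
      norm_map' := norm_rotFun ha hb hab t } rfl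

lemma hasDerivAt_rotFun (a b x : V) :
    HasDerivAt (fun t => rotFun a b t x) (⟪a, x⟫ • b - ⟪b, x⟫ • a) 0 := by
  have hc := (Real.hasDerivAt_cos 0).sub_const 1
  have hs := Real.hasDerivAt_sin 0
  have h := (((hc.mul_const ⟪a, x⟫).sub (hs.mul_const ⟪b, x⟫)).smul_const a).const_add x |>.add
    (((hs.mul_const ⟪a, x⟫).add (hc.mul_const ⟪b, x⟫)).smul_const b)
  refine (show HasDerivAt (fun t => rotFun a b t x) _ 0 from h).congr_deriv ?_
  simp only [Real.sin_zero, Real.cos_zero, neg_zero, zero_mul, one_mul, zero_sub, add_zero, neg_smul]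
  abel

variable [MeasurableSpace V] [BorelSpace V]

/-- Angular derivatives are antisymmetric for rotation-invariant measures on pairs of points of
the sphere. -/
lemma integral_angD {a b : V} (ha : ‖a‖ = 1) (hb : ‖b‖ = 1) (hab : ⟪a, b⟫ = 0)
    {μ : Measure (USphere V × USphere V)} [IsFiniteMeasure μ]
    (hμ : ∀ e : V ≃ₗᵢ[ℝ] V, μ.map (Prod.map (sphereIso e) (sphereIso e)) = μ)
    {f g : V → ℂ} (hf : Smooth f) (hg : Smooth g) :
    ∫ p, angD a b f p.1 * g p.2 ∂μ = - ∫ p, f p.1 * angD a b g p.2 ∂μ := by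
  let ι : USphere V × USphere V → V × V := fun p => (p.1, p.2)
  have hι : Continuous ι := by fun_prop
  let H : ℝ × (V × V) → ℂ := fun q => f (rotFun a b q.1 q.2.1) * g (rotFun a b q.1 q.2.2)
  have hrot : ContDiff ℝ 1 fun q : ℝ × V => rotFun a b q.1 q.2 := by
    unfold rotFun
    have hc : ContDiff ℝ 1 fun q : ℝ × V => Real.cos q.1 := Real.contDiff_cos.comp contDiff_fst
    have hs : ContDiff ℝ 1 fun q : ℝ × V => Real.sin q.1 := Real.contDiff_sin.comp contDiff_fst
    have hA : ContDiff ℝ 1 fun q : ℝ × V => ⟪a, q.2⟫ := contDiff_const.inner ℝ contDiff_snd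
    have hB : ContDiff ℝ 1 fun q : ℝ × V => ⟪b, q.2⟫ := contDiff_const.inner ℝ contDiff_snd
    exact (contDiff_snd.add ((((hc.sub contDiff_const).mul hA).sub (hs.mul hB)).smul
      contDiff_const)).add (((hs.mul hA).add ((hc.sub contDiff_const).mul hB)).smul contDiff_const)
  have hH : ContDiff ℝ 1 H :=
    ((hf.of_le (by exact_mod_cast le_top)).comp (hrot.comp
      (contDiff_fst.prodMk (contDiff_fst.comp contDiff_snd)))).mul
    ((hg.of_le (by exact_mod_cast le_top)).comp (hrot.comp
      (contDiff_fst.prodMk (contDiff_snd.comp contDiff_snd))))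
  have hconst : (fun t => ∫ p, H (t, ι p) ∂μ) = fun _ => ∫ p, f p.1 * g p.2 ∂μ := by
    funext t
    have he := (sphereIso (rot ha hb hab t)).toHomeomorph.prodCongr
      (sphereIso (rot ha hb hab t)).toHomeomorph
    conv_rhs => rw [← hμ (rot ha hb hab t)]
    exact (MeasurableEmbedding.integral_map (Homeomorph.measurableEmbedding
      ((sphereIso (rot ha hb hab t)).toHomeomorph.prodCongr
        (sphereIso (rot ha hb hab t)).toHomeomorph)) (fun p => f p.1 * g p.2)).symm
  have h1 := hasFDerivAt_integral_param (μ := μ) hι hH 0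
  rw [hconst] at h1
  have h2 := congrArg (fun L : ℝ →L[ℝ] ℂ => L 1) (h1.unique (hasFDerivAt_const _ _))
  have hcont : Continuous fun p => (fderiv ℝ H (0, ι p)).comp (ContinuousLinearMap.inl ℝ ℝ (V × V)) :=
    ((hH.continuous_fderiv one_ne_zero).comp (by fun_prop)).clm_comp continuous_const
  simp only [ContinuousLinearMap.integral_apply (integrable_of_continuous hcont),
    ContinuousLinearMap.comp_apply, ContinuousLinearMap.inl_apply, zero_apply] at h2
  have hr0 : ∀ x : V, rotFun a b 0 x = x := fun x => by simp [rotFun]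
  have hang : ∀ (u : V → ℂ) (_ : Smooth u) (x : V),
      HasDerivAt (fun t => u (rotFun a b t x)) (angD a b u x) 0 := fun u hu x => by
    have h := (hu.differentiableAt (rotFun a b 0 x)).hasFDerivAt.comp_hasDerivAt (0 : ℝ)
      (hasDerivAt_rotFun a b x)
    rw [hr0] at h
    refine (show HasDerivAt (fun t => u (rotFun a b t x)) _ 0 from h).congr_deriv ?_
    simp [angD, dirD]
  have h3 : ∀ p, fderiv ℝ H (0, ι p) ((1 : ℝ), (0 : V × V))
      = angD a b f p.1 * g p.2 + f p.1 * angD a b g p.2 := fun p => by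
    have e1 : HasDerivAt (fun t : ℝ => H (t, ι p)) (fderiv ℝ H (0, ι p) ((1 : ℝ), (0 : V × V))) 0 :=
      HasFDerivAt.comp_hasDerivAt (l := H) (f := fun t : ℝ => (t, ι p)) (0 : ℝ)
        ((hH.differentiable one_ne_zero) (0, ι p)).hasFDerivAt
        ((hasDerivAt_id (0 : ℝ)).prodMk (hasDerivAt_const (0 : ℝ) (ι p)))
    have e2 : HasDerivAt (fun t : ℝ => H (t, ι p)) (angD a b f p.1 * g (rotFun a b 0 p.2)
        + f (rotFun a b 0 p.1) * angD a b g p.2) 0 := (hang f hf p.1).mul (hang g hg p.2)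
    rw [hr0, hr0] at e2
    exact e1.unique e2
  simp only [h3] at h2
  have hfc := hf.continuous
  have hgc := hg.continuous
  have hfa := (hf.angD a b).continuous
  have hga := (hg.angD a b).continuous
  rw [integral_add (integrable_of_continuous (by fun_prop))
    (integrable_of_continuous (by fun_prop))] at h2
  exact eq_neg_of_add_eq_zero_left h2

/-- Harmonic homogeneous functions of different degrees are orthogonal for every
rotation-invariant bilinear form, since the spherical Laplacian is symmetric and has different
eigenvalues on them. -/
theorem integral_harmonic_mul_eq_zero (hV : 2 ≤ Module.finrank ℝ V)
    {μ : Measure (USphere V × USphere V)} [IsFiniteMeasure μ]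
    (hμ : ∀ e : V ≃ₗᵢ[ℝ] V, μ.map (Prod.map (sphereIso e) (sphereIso e)) = μ)
    {m n : ℕ} (hmn : m ≠ n) {f g : V → ℂ} (hf : SmoothHomog m f) (hg : SmoothHomog n g)
    (hf0 : ∀ x, lapl f x = 0) (hg0 : ∀ x, lapl g x = 0) :
    ∫ p, f p.1 * g p.2 ∂μ = 0 := by
  set b := stdOrthonormalBasis ℝ V
  have hfs := hf.smooth
  have hgs := hg.smooth
  have hsymm : ∀ i j, ∫ p, angD (b i) (b j) (angD (b i) (b j) f) p.1 * g p.2 ∂μ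
      = ∫ p, f p.1 * angD (b i) (b j) (angD (b i) (b j) g) p.2 ∂μ := by
    intro i j
    by_cases hij : i = j
    · subst hij
      simp [angD]
    have h0 : ⟪b i, b j⟫ = 0 := b.orthonormal.2 hij
    rw [integral_angD (b.norm_eq_one i) (b.norm_eq_one j) h0 hμ (hfs.angD _ _) hgs,
      integral_angD (b.norm_eq_one i) (b.norm_eq_one j) h0 hμ hfs (hgs.angD _ _), neg_neg]
  have hI : ∀ {u v : V → ℂ}, Smooth u → Smooth v →
      Integrable (fun p : USphere V × USphere V => u p.1 * v p.2) μ := fun hu hv => by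
    have := hu.continuous
    have := hv.continuous
    exact integrable_of_continuous (by fun_prop)
  have hsum : ∫ p, (∑ i, ∑ j, angD (b i) (b j) (angD (b i) (b j) f) p.1) * g p.2 ∂μ
      = ∫ p, f p.1 * ∑ i, ∑ j, angD (b i) (b j) (angD (b i) (b j) g) p.2 ∂μ := by
    simp only [Finset.sum_mul, Finset.mul_sum]
    rw [integral_finsetSum _ fun i _ => integrable_finsetSum _ fun j _ =>
      hI ((hfs.angD _ _).angD _ _) hgs, integral_finsetSum _ fun i _ => integrable_finsetSum _ fun j _ =>
      hI hfs ((hgs.angD _ _).angD _ _)]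
    refine Finset.sum_congr rfl fun i _ => ?_
    rw [integral_finsetSum _ fun j _ => hI ((hfs.angD _ _).angD _ _) hgs,
      integral_finsetSum _ fun j _ => hI hfs ((hgs.angD _ _).angD _ _)]
    exact Finset.sum_congr rfl fun j _ => hsymm i j
  simp only [b, hf.sum_angD_angD, hg.sum_angD_angD, hf0, hg0, mul_zero, zero_sub] at hsum
  have e1 : ∀ p : USphere V × USphere V,
      2 * -((m : ℂ) * (m + Module.finrank ℝ V - 2) * f p.1) * g p.2
        = (-2 * (m : ℂ) * (m + Module.finrank ℝ V - 2)) * (f p.1 * g p.2) := fun p => by ring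
  have e2 : ∀ p : USphere V × USphere V,
      f p.1 * (2 * -((n : ℂ) * (n + Module.finrank ℝ V - 2) * g p.2))
        = (-2 * (n : ℂ) * (n + Module.finrank ℝ V - 2)) * (f p.1 * g p.2) := fun p => by ring
  simp only [e1, e2, integral_const_mul] at hsum
  set I := ∫ p, f p.1 * g p.2 ∂μ
  have h1 : ((m : ℂ) - n) * (m + n + Module.finrank ℝ V - 2) * I = 0 := by
    linear_combination (-1 / 2) * hsum
  obtain ⟨k, hk⟩ := Nat.exists_eq_add_of_le' hV
  have h2 : ((m : ℂ) - n) ≠ 0 := sub_ne_zero.2 (by exact_mod_cast hmn)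
  have h3 : ((m : ℂ) + n + Module.finrank ℝ V - 2) ≠ 0 := by
    rw [hk]
    push_cast
    have : ((m : ℂ) + n + (k + 2) - 2) = ((m + n + k : ℕ) : ℂ) := by push_cast; ring
    rw [this]
    exact_mod_cast (by omega : m + n + k ≠ 0)
  simpa [h2, h3] using h1

lemma lapl_conj_eq_zero {f : V → ℂ} (hf : Smooth f) (hf0 : ∀ x, lapl f x = 0) (x : V) :
    lapl (fun x => starRingEnd ℂ (f x)) x = 0 := by
  have h1 : ∀ (u : V → ℂ) (_ : Smooth u) (v : V),
      dirD v (fun x => starRingEnd ℂ (u x)) = fun x => starRingEnd ℂ (dirD v u x) := by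
    intro u hu v
    funext x
    have h := (Complex.conjCLE.toContinuousLinearMap.hasFDerivAt.comp x
      (hu.differentiableAt x).hasFDerivAt).fderiv
    change fderiv ℝ (⇑Complex.conjCLE ∘ u) x v = _
    exact congrArg (fun L : V →L[ℝ] ℂ => L v) h
  have h2 := hf0 x
  simp only [lapl] at h2 ⊢
  have h3 := congrArg (starRingEnd ℂ) h2
  rw [map_sum, map_zero] at h3
  rw [← h3]
  refine Finset.sum_congr rfl fun i _ => ?_
  rw [h1 f hf, h1 _ (hf.dirD _)]

/-- The special case of the diagonal measure. -/
lemma integral_conj_harmonic_mul_eq_zero (hV : 2 ≤ Module.finrank ℝ V)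
    {m n : ℕ} (hmn : m ≠ n) {f g : V → ℂ} (hf : SmoothHomog m f) (hg : SmoothHomog n g)
    (hf0 : ∀ x, lapl f x = 0) (hg0 : ∀ x, lapl g x = 0) :
    ∫ x : USphere V, starRingEnd ℂ (f x) * g x ∂sphereMeasure V = 0 := by
  have := nontrivial_of_two_le hV
  have hdiag : Measurable fun x : USphere V => (x, x) := by fun_prop
  have := Measure.isProbabilityMeasure_map (μ := sphereMeasure V) hdiag.aemeasurable
  have h := integral_harmonic_mul_eq_zero hV (μ := (sphereMeasure V).map fun x => (x, x))
    (fun e => ?_) hmn hf.conj hg (lapl_conj_eq_zero hf.smooth hf0) hg0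
  · have hfc := hf.smooth.continuous
    have hgc := hg.smooth.continuous
    rw [integral_map hdiag.aemeasurable] at h
    · exact h
    · exact Continuous.aestronglyMeasurable (by fun_prop)
  · have hm : Measurable (sphereIso e : USphere V → USphere V) :=
      (sphereIso e).continuous.measurable
    rw [Measure.map_map (hm.prodMap hm) hdiag]
    conv_rhs => rw [← map_sphereMeasure e, Measure.map_map hdiag hm]
    rfl

end Orthogonality

/-! ### Decomposition into spherical harmonics -/

section Decomposition

variable {V : Type*} [NormedAddCommGroup V] [InnerProductSpace ℝ V] [FiniteDimensional ℝ V]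

/-- A harmonic homogeneous polynomial of degree `n`. -/
structure HarmHomog {V : Type*} [NormedAddCommGroup V] [InnerProductSpace ℝ V]
    [FiniteDimensional ℝ V] (n : ℕ) (f : V → ℂ) : Prop extends SmoothHomog n f where
  lapl_eq : ∀ x, lapl f x = 0

lemma HarmHomog.zero (n : ℕ) : HarmHomog n fun _ : V => (0 : ℂ) :=
  ⟨SmoothHomog.zero, fun x => by
    have h : ∀ v : V, dirD v (fun _ : V => (0 : ℂ)) = fun _ => 0 := fun v => by
      funext y; simp [dirD]
    simp [lapl, h]⟩

lemma HarmHomog.continuous {n : ℕ} {f : V → ℂ} (hf : HarmHomog n f) : Continuous f :=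
  hf.smooth.continuous

lemma SmoothHomog.eq_zero_of_sphere [Nontrivial V] {n : ℕ} {f : V → ℂ} (hf : SmoothHomog n f)
    (h : ∀ x : USphere V, f x = 0) (x : V) : f x = 0 := by
  by_cases hx : x = 0
  · obtain ⟨s⟩ : Nonempty (USphere V) := (NormedSpace.sphere_nonempty.2 zero_le_one).to_subtype
    have := hf.homog 0 s
    rw [zero_smul, h s, mul_zero] at this
    rw [hx, this]
  · have hx' : ‖x‖ ≠ 0 := norm_ne_zero_iff.2 hx
    have := hf.homog ‖x‖ (‖x‖⁻¹ • x)
    rw [smul_smul, mul_inv_cancel₀ hx', one_smul, h ⟨‖x‖⁻¹ • x, by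
      rw [mem_sphere_zero_iff_norm, norm_smul, norm_inv, norm_norm, inv_mul_cancel₀ hx']⟩,
      mul_zero] at this
    exact this

/-- The space of homogeneous polynomials of degree `n`. -/
def homSpace (V : Type*) [NormedAddCommGroup V] [InnerProductSpace ℝ V]
    [FiniteDimensional ℝ V] (n : ℕ) :
    Submodule ℂ (V → ℂ) where
  carrier := {f | SmoothHomog n f}
  add_mem' hf hg := hf.add hg
  zero_mem' := SmoothHomog.zero
  smul_mem' c _ hf := hf.const_mul c

instance finiteDimensional_homSpace (n : ℕ) : FiniteDimensional ℂ (homSpace V n) := by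
  let D : (V [×n]→L[ℝ] ℂ) →ₗ[ℂ] homSpace V n :=
    { toFun := fun A => ⟨fun x => A fun _ => x, SmoothHomog.of_form A⟩
      map_add' := fun _ _ => rfl
      map_smul' := fun _ _ => rfl }
  refine Module.Finite.of_surjective D fun f => ?_
  obtain ⟨A, hA⟩ := SmoothHomog.exists_form f.2
  exact ⟨A, Subtype.ext (funext fun x => (hA x).symm)⟩

variable [MeasurableSpace V] [BorelSpace V]

/-- On the sphere every homogeneous polynomial is a sum of spherical harmonics: by induction,
`q ↦ Δ (|x|² q)` is injective on homogeneous polynomials, as a `q` in the kernel is orthogonal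
to itself on the sphere; hence it is onto. -/
theorem exists_decomposition (hV : 2 ≤ Module.finrank ℝ V) {n : ℕ} {f : V → ℂ}
    (hf : SmoothHomog n f) : ∃ h : ℕ → V → ℂ, (∀ l, HarmHomog l (h l)) ∧
      ∀ x : USphere V, f x = ∑ l ∈ Finset.range (n + 1), h l x := by
  have := nontrivial_of_two_le hV
  induction n using Nat.strong_induction_on generalizing f with
  | _ n ih =>
  classical
  have hharm : ∀ {f : V → ℂ}, HarmHomog n f → ∃ h : ℕ → V → ℂ, (∀ l, HarmHomog l (h l)) ∧
      ∀ x : USphere V, f x = ∑ l ∈ Finset.range (n + 1), h l x := fun {f} hf => by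
    refine ⟨fun l => if h : l = n then f else fun _ => 0, fun l => ?_, fun x => ?_⟩
    · by_cases h : l = n
      · subst h; simpa using hf
      · simpa [h] using HarmHomog.zero l
    · rw [Finset.sum_eq_single n] <;> simp +contextual
  rcases lt_or_ge n 2 with hn | hn
  · exact hharm ⟨hf, congrFun (hf.lapl_of_lt_two hn)⟩
  obtain ⟨k, rfl⟩ := Nat.exists_eq_add_of_le' hn
  have hM : ∀ {q : V → ℂ}, SmoothHomog k q →
      SmoothHomog (k + 2) fun x : V => ((‖x‖ ^ 2 : ℝ) : ℂ) * q x := fun hq => by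
    rw [add_comm]; exact SmoothHomog.norm_sq.mul hq
  let T : homSpace V k →ₗ[ℂ] homSpace V k :=
    { toFun := fun q => ⟨lapl fun x : V => ((‖x‖ ^ 2 : ℝ) : ℂ) * (q : V → ℂ) x, (hM q.2).lapl⟩
      map_add' := fun q r => Subtype.ext <| by
        have := lapl_add (hM q.2).smooth (hM r.2).smooth
        simp only [← mul_add] at this
        exact this
      map_smul' := fun c q => Subtype.ext <| by
        have := lapl_const_mul (hM q.2).smooth c
        simp only [mul_left_comm c] at this
        exact this }
  have hT : Function.Injective T := by
    rw [injective_iff_map_eq_zero]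
    rintro ⟨q, hq⟩ hq0
    have hq : SmoothHomog k q := hq
    have hp0 : HarmHomog (k + 2) fun x : V => ((‖x‖ ^ 2 : ℝ) : ℂ) * q x :=
      ⟨hM hq, fun x => congrFun (congrArg Subtype.val hq0) x⟩
    obtain ⟨h, hh, hqh⟩ := ih k (by omega) hq
    have h1 : ∫ x : USphere V, starRingEnd ℂ (q x) * q x ∂sphereMeasure V = 0 := by
      have h2 : ∀ x : USphere V, starRingEnd ℂ (q x) * q x
          = ∑ l ∈ Finset.range (k + 1), starRingEnd ℂ (h l x) * (((‖(x : V)‖ ^ 2 : ℝ) : ℂ) * q x) := by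
        intro x
        rw [← Finset.sum_mul, norm_coe_sphere, ← map_sum, ← hqh]
        simp
      simp only [h2]
      have hqc := hq.smooth.continuous
      rw [integral_finsetSum _ fun l _ => integrable_of_continuous (by
        have := (hh l).continuous
        have := hq.smooth.continuous
        fun_prop)]
      refine Finset.sum_eq_zero fun l hl => ?_
      rw [Finset.mem_range] at hl
      exact integral_conj_harmonic_mul_eq_zero hV (by omega) (hh l).toSmoothHomog hp0.toSmoothHomog
        (hh l).lapl_eq hp0.lapl_eq
    have hqc : Continuous fun x : USphere V => ‖q x‖ ^ 2 := by
      have := hq.smooth.continuous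
      fun_prop
    have h3 : ∫ x : USphere V, ‖q x‖ ^ 2 ∂sphereMeasure V = 0 := by
      have h4 : ∀ x : USphere V, starRingEnd ℂ (q x) * q x = ((‖q x‖ ^ 2 : ℝ) : ℂ) := fun x => by
        rw [mul_comm, Complex.mul_conj, Complex.normSq_eq_norm_sq]
      simp only [h4] at h1
      rw [integral_complex_ofReal] at h1
      exact_mod_cast h1
    rw [integral_eq_zero_iff_of_nonneg (fun x => by positivity) (integrable_of_continuous hqc)] at h3
    have h5 := (Continuous.ae_eq_iff_eq (sphereMeasure V) hqc continuous_zero).1 h3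
    refine Subtype.ext (funext fun x => hq.eq_zero_of_sphere (fun x => ?_) x)
    have := congrFun h5 x
    simpa using this
  obtain ⟨⟨q, hq⟩, hTq⟩ := (LinearMap.injective_iff_surjective.1 hT) ⟨lapl f, hf.lapl⟩
  have hq : SmoothHomog k q := hq
  have hTq' : lapl (fun x : V => ((‖x‖ ^ 2 : ℝ) : ℂ) * q x) = lapl f := congrArg Subtype.val hTq
  have hh : HarmHomog (k + 2) fun x : V => f x - ((‖x‖ ^ 2 : ℝ) : ℂ) * q x :=
    ⟨hf.sub (hM hq), fun x => by rw [lapl_sub hf.smooth (hM hq).smooth, hTq']; simp⟩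
  obtain ⟨h, hharm', hsum⟩ := ih k (by omega) hq
  refine ⟨fun l => if l = k + 2 then fun x : V => f x - ((‖x‖ ^ 2 : ℝ) : ℂ) * q x
    else if l ≤ k then h l else fun _ => 0, fun l => ?_, fun x => ?_⟩
  · dsimp only
    split_ifs with h1 h2
    · subst h1; exact hh
    · exact hharm' l
    · exact HarmHomog.zero l
  · rw [Finset.sum_range_succ, Finset.sum_range_succ]
    have h2 : ∑ l ∈ Finset.range (k + 1), (if l = k + 2 then fun x : V =>
        f x - ((‖x‖ ^ 2 : ℝ) : ℂ) * q x else if l ≤ k then h l else fun _ => 0) (x : V)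
        = ∑ l ∈ Finset.range (k + 1), h l x := by
      refine Finset.sum_congr rfl fun l hl => ?_
      rw [Finset.mem_range] at hl
      rw [if_neg (by omega), if_pos (by omega)]
    rw [h2, ← hsum]
    dsimp only
    rw [if_pos rfl, if_neg (by omega), if_neg (by omega), norm_coe_sphere]
    simp

end Decomposition

/-! ### Completeness of the spherical harmonics in `L²` -/

section L2

variable {V : Type*} [NormedAddCommGroup V] [InnerProductSpace ℝ V] [FiniteDimensional ℝ V]
  [MeasurableSpace V] [BorelSpace V]

lemma memLp_of_continuous [Nontrivial V] {f : USphere V → ℂ} (hf : Continuous f) :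
    MemLp f 2 (sphereMeasure V) := by
  obtain ⟨C, hC⟩ := isCompact_univ.exists_bound_of_continuousOn hf.continuousOn
  exact MemLp.of_bound hf.aestronglyMeasurable C
    (Filter.Eventually.of_forall fun x => hC x (mem_univ x))

lemma mem_sphericalHarmonics_iff {n : ℕ} {f : Lp ℂ 2 (sphereMeasure V)} :
    f ∈ sphericalHarmonics V n ↔ ∃ h : V → ℂ, HarmHomog n h ∧
      f =ᵐ[sphereMeasure V] fun x => h x := by
  constructor
  · rintro ⟨A, hA, hfA⟩
    refine ⟨fun x => A fun _ => x, ⟨SmoothHomog.of_form A, fun x => ?_⟩, hfA⟩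
    rw [← lapl_eq_laplacian (SmoothHomog.of_form A).smooth]
    exact (hA x (mem_univ x)).2.self_of_nhds
  · rintro ⟨h, hh, hfh⟩
    obtain ⟨A, hA⟩ := hh.exists_form
    have hAh : (fun x => A fun _ => x) = h := funext fun x => (hA x).symm
    refine ⟨A, fun x _ => ?_, hfh.trans (Filter.Eventually.of_forall fun x => hA x)⟩
    rw [hAh]
    refine ⟨(hh.smooth.of_le (WithTop.coe_le_coe.2 (le_top : (2 : ℕ∞) ≤ ⊤))).contDiffAt,
      Filter.Eventually.of_forall fun y => ?_⟩
    rw [lapl_eq_laplacian hh.smooth, hh.lapl_eq]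
    rfl

lemma HarmHomog.toLp_mem [Nontrivial V] {n : ℕ} {h : V → ℂ} (hh : HarmHomog n h)
    (hm : MemLp (fun x : USphere V => h x) 2 (sphereMeasure V)) :
    hm.toLp ∈ sphericalHarmonics V n :=
  mem_sphericalHarmonics_iff.2 ⟨h, hh, hm.coeFn_toLp⟩

lemma inner_toLp_eq {f g : USphere V → ℂ} (hf : MemLp f 2 (sphereMeasure V))
    (hg : MemLp g 2 (sphereMeasure V)) :
    inner ℂ (hf.toLp f) (hg.toLp g) = ∫ x, starRingEnd ℂ (f x) * g x ∂sphereMeasure V := by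
  rw [L2.inner_def]
  refine integral_congr_ae ?_
  filter_upwards [hf.coeFn_toLp, hg.coeFn_toLp] with x h1 h2
  rw [h1, h2, RCLike.inner_apply, mul_comm]

lemma inner_sphericalHarmonics_eq_zero (hV : 2 ≤ Module.finrank ℝ V) {m n : ℕ} (hmn : m ≠ n)
    {f g : Lp ℂ 2 (sphereMeasure V)} (hf : f ∈ sphericalHarmonics V m)
    (hg : g ∈ sphericalHarmonics V n) : inner ℂ f g = 0 := by
  obtain ⟨u, hu, hfu⟩ := mem_sphericalHarmonics_iff.1 hf
  obtain ⟨v, hv, hgv⟩ := mem_sphericalHarmonics_iff.1 hg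
  rw [L2.inner_def, ← integral_conj_harmonic_mul_eq_zero hV hmn hu.toSmoothHomog hv.toSmoothHomog
    hu.lapl_eq hv.lapl_eq]
  refine integral_congr_ae ?_
  filter_upwards [hfu, hgv] with x h1 h2
  rw [h1, h2, RCLike.inner_apply, mul_comm]

/-- Restrictions of homogeneous polynomials to the sphere. -/
def homRestrict (V : Type*) [NormedAddCommGroup V] [InnerProductSpace ℝ V]
    [FiniteDimensional ℝ V] :
    Submonoid C(USphere V, ℂ) where
  carrier := {u | ∃ (n : ℕ) (f : V → ℂ), SmoothHomog n f ∧ ∀ x : USphere V, u x = f x}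
  mul_mem' := by
    rintro u v ⟨n, f, hf, hu⟩ ⟨m, g, hg, hv⟩
    exact ⟨n + m, _, hf.mul hg, fun x => by simp [hu, hv]⟩
  one_mem' := ⟨0, _, SmoothHomog.const 1, fun x => rfl⟩

/-- Polynomials are dense in the continuous functions on the sphere, by Stone–Weierstrass. -/
lemma dense_span_homRestrict :
    Dense ((Submodule.span ℂ (homRestrict V : Set C(USphere V, ℂ)) : Submodule ℂ C(USphere V, ℂ)) :
      Set C(USphere V, ℂ)) := by
  let A : StarSubalgebra ℂ C(USphere V, ℂ) :=
    { Algebra.adjoin ℂ (homRestrict V : Set C(USphere V, ℂ)) with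
      star_mem' := by
        intro u hu
        induction hu using Algebra.adjoin_induction with
        | mem u hu =>
          obtain ⟨n, f, hf, hu⟩ := hu
          exact Algebra.subset_adjoin ⟨n, _, hf.conj, fun x => by simp [hu]⟩
        | algebraMap r =>
          refine Algebra.subset_adjoin ⟨0, _, SmoothHomog.const (starRingEnd ℂ r), fun x => ?_⟩
          simp [Algebra.algebraMap_eq_smul_one]
        | add u v _ _ hu hv => rw [star_add]; exact Subalgebra.add_mem _ hu hv
        | mul u v _ _ hu hv => rw [star_mul]; exact Subalgebra.mul_mem _ hv hu }
  have hsep : A.SeparatesPoints := by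
    intro x y hxy
    refine ⟨fun z : USphere V => ((⟪(x : V) - y, (z : V)⟫ : ℝ) : ℂ),
      ⟨⟨_, Complex.continuous_ofReal.comp (by fun_prop : Continuous fun z : USphere V =>
        (⟪(x : V) - y, (z : V)⟫ : ℝ))⟩, Algebra.subset_adjoin ⟨1, _, SmoothHomog.inner ((x : V) - y), fun z => rfl⟩,
        rfl⟩, ?_⟩
    intro h
    have h1 : ⟪(x : V) - y, (x : V)⟫ = ⟪(x : V) - y, (y : V)⟫ := Complex.ofReal_injective h
    rw [← sub_eq_zero, ← inner_sub_right, inner_self_eq_zero, sub_eq_zero] at h1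
    exact hxy (Subtype.ext h1)
  have htop := ContinuousMap.starSubalgebra_topologicalClosure_eq_top_of_separatesPoints A hsep
  have hA : ((Submodule.span ℂ (homRestrict V : Set C(USphere V, ℂ)) :
      Submodule ℂ C(USphere V, ℂ)) : Set C(USphere V, ℂ)) = A := by
    have h := Algebra.adjoin_eq_span (R := ℂ) (homRestrict V : Set C(USphere V, ℂ))
    rw [Submonoid.closure_eq] at h
    rw [← h]
    rfl
  rw [hA, dense_iff_closure_eq, ← StarSubalgebra.topologicalClosure_coe, htop]
  rfl

/-- The spherical harmonics span a dense subspace of `L²`. -/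
lemma eq_zero_of_inner_sphericalHarmonics (hV : 2 ≤ Module.finrank ℝ V)
    {f : Lp ℂ 2 (sphereMeasure V)}
    (hf : ∀ n, ∀ g ∈ sphericalHarmonics V n, inner ℂ g f = 0) : f = 0 := by
  have := nontrivial_of_two_le hV
  let J := ContinuousMap.toLp (E := ℂ) 2 (sphereMeasure V) ℂ
  let φ : Lp ℂ 2 (sphereMeasure V) →L[ℂ] ℂ := innerSL ℂ f
  have h1 : ∀ u ∈ Submodule.span ℂ (homRestrict V : Set C(USphere V, ℂ)), φ (J u) = 0 := by
    intro u hu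
    induction hu using Submodule.span_induction with
    | mem u hu =>
      obtain ⟨n, g, hg, hu⟩ := hu
      obtain ⟨h, hh, hsum⟩ := exists_decomposition hV hg
      have hm : ∀ l, MemLp (fun x : USphere V => h l x) 2 (sphereMeasure V) := fun l =>
        memLp_of_continuous ((hh l).continuous.comp continuous_subtype_val)
      have hJ : J u = ∑ l ∈ Finset.range (n + 1), (hm l).toLp := by
        have hs : J u = (memLp_finsetSum (Finset.range (n + 1)) fun l _ => hm l).toLp := by
          refine Lp.ext ((ContinuousMap.coeFn_toLp _ _).trans ?_)
          refine Filter.EventuallyEq.trans (Filter.Eventually.of_forall fun x => ?_)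
            (MemLp.coeFn_toLp _).symm
          rw [hu, hsum]
        rw [hs]
        refine Lp.ext ((MemLp.coeFn_toLp _).trans ?_)
        refine Filter.EventuallyEq.trans ?_ (Lp.coeFn_finsetSum _ _).symm
        have : ∀ᵐ x ∂sphereMeasure V, ∀ l ∈ Finset.range (n + 1),
            ((hm l).toLp : USphere V → ℂ) x = h l x :=
          (Finset.range (n + 1)).eventually_all.2 fun l _ => (hm l).coeFn_toLp
        filter_upwards [this] with x hx
        rw [Finset.sum_apply]
        exact (Finset.sum_congr rfl hx).symm
      rw [hJ, map_sum]
      refine Finset.sum_eq_zero fun l _ => ?_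
      rw [innerSL_apply_apply, ← inner_conj_symm, hf l _ ((hh l).toLp_mem (hm l)), map_zero]
    | zero => simp
    | add u v _ _ hu hv => rw [map_add, map_add, hu, hv, add_zero]
    | smul c u _ hu => rw [map_smul, map_smul, hu, smul_zero]
  have h2 : ∀ u, φ (J u) = 0 := fun u =>
    congrFun (Continuous.ext_on dense_span_homRestrict (φ.continuous.comp J.continuous)
      continuous_const h1) u
  have h3 : ∀ g, φ g = 0 := fun g =>
    congrFun (Continuous.ext_on (ContinuousMap.toLp_denseRange ℂ (sphereMeasure V) ℂ (p := 2) (by simp))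
      φ.continuous continuous_const (by rintro _ ⟨u, rfl⟩; exact h2 u)) g
  exact inner_self_eq_zero.1 (h3 f)

/-- The orthogonal projection of `L²` onto the spherical harmonics of degree `n`. -/
noncomputable abbrev harmProj (V : Type*) [NormedAddCommGroup V] [InnerProductSpace ℝ V]
    [FiniteDimensional ℝ V] [MeasurableSpace V] [BorelSpace V] (n : ℕ) :
    Lp ℂ 2 (sphereMeasure V) →L[ℂ] Lp ℂ 2 (sphereMeasure V) :=
  (sphericalHarmonics V n).starProjection

lemma harmProj_mem (n : ℕ) (f : Lp ℂ 2 (sphereMeasure V)) :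
    harmProj V n f ∈ sphericalHarmonics V n := Submodule.starProjection_apply_mem _ _

lemma inner_harmProj_self (n : ℕ) (f : Lp ℂ 2 (sphereMeasure V)) :
    inner ℂ (harmProj V n f) f = ((‖harmProj V n f‖ ^ 2 : ℝ) : ℂ) := by
  have h : inner ℂ (harmProj V n f) (f - harmProj V n f) = 0 :=
    Submodule.inner_right_of_mem_orthogonal (harmProj_mem n f)
      (Submodule.sub_starProjection_mem_orthogonal f)
  rw [inner_sub_right, sub_eq_zero] at h
  rw [h, inner_self_eq_norm_sq_to_K]
  norm_cast

lemma norm_sum_sq_of_mem (hV : 2 ≤ Module.finrank ℝ V) (s : Finset ℕ)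
    {g : ℕ → Lp ℂ 2 (sphereMeasure V)} (hg : ∀ n, g n ∈ sphericalHarmonics V n) :
    ‖∑ n ∈ s, g n‖ ^ 2 = ∑ n ∈ s, ‖g n‖ ^ 2 := by
  have h1 : inner ℂ (∑ n ∈ s, g n) (∑ n ∈ s, g n) = ((∑ n ∈ s, ‖g n‖ ^ 2 : ℝ) : ℂ) := by
    rw [sum_inner]
    push_cast
    refine Finset.sum_congr rfl fun n hn => ?_
    rw [inner_sum, Finset.sum_eq_single n]
    · rw [inner_self_eq_norm_sq_to_K]; rfl
    · intro m _ hmn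
      exact inner_sphericalHarmonics_eq_zero hV (Ne.symm hmn) (hg n) (hg m)
    · exact fun h => absurd hn h
  rw [inner_self_eq_norm_sq_to_K] at h1
  exact Complex.ofReal_injective (by rw [← h1]; push_cast; rfl)

/-- Bessel's inequality. -/
lemma sum_norm_harmProj_sq_le (hV : 2 ≤ Module.finrank ℝ V) (f : Lp ℂ 2 (sphereMeasure V))
    (s : Finset ℕ) : ∑ n ∈ s, ‖harmProj V n f‖ ^ 2 ≤ ‖f‖ ^ 2 := by
  have h1 := norm_sum_sq_of_mem hV s fun n => harmProj_mem n f
  have h2 : inner ℂ (∑ n ∈ s, harmProj V n f) f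
      = ((∑ n ∈ s, ‖harmProj V n f‖ ^ 2 : ℝ) : ℂ) := by
    rw [sum_inner]
    push_cast
    exact Finset.sum_congr rfl fun n _ => by rw [inner_harmProj_self]; push_cast; rfl
  have h3 := norm_inner_le_norm (𝕜 := ℂ) (∑ n ∈ s, harmProj V n f) f
  rw [h2, Complex.norm_real, Real.norm_of_nonneg (Finset.sum_nonneg fun _ _ => sq_nonneg _),
    ← h1] at h3
  rw [← h1]
  by_cases h0 : ‖∑ n ∈ s, harmProj V n f‖ = 0
  · rw [h0]; nlinarith [sq_nonneg ‖f‖]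
  · have h4 : 0 < ‖∑ n ∈ s, harmProj V n f‖ := lt_of_le_of_ne (norm_nonneg _) (Ne.symm h0)
    have h5 : ‖∑ n ∈ s, harmProj V n f‖ ≤ ‖f‖ := by nlinarith
    gcongr

/-- Every `L²` function is the sum of its projections onto the spherical harmonics. -/
theorem hasSum_harmProj (hV : 2 ≤ Module.finrank ℝ V) (f : Lp ℂ 2 (sphereMeasure V)) :
    HasSum (fun n => harmProj V n f) f := by
  have hof : OrthogonalFamily ℂ (fun n => sphericalHarmonics V n)
      fun n => (sphericalHarmonics V n).subtypeₗᵢ := fun m n hmn u v =>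
    inner_sphericalHarmonics_eq_zero hV hmn u.2 v.2
  have hs : Summable fun n => harmProj V n f := by
    refine (hof.summable_iff_norm_sq_summable fun n => ⟨_, harmProj_mem n f⟩).2 ?_
    exact summable_of_sum_le (fun n => sq_nonneg _) fun s => sum_norm_harmProj_sq_le hV f s
  have h0 : f - ∑' n, harmProj V n f = 0 := by
    refine eq_zero_of_inner_sphericalHarmonics hV fun n g hg => ?_
    have h1 : HasSum (fun m => inner ℂ g (harmProj V m f)) (inner ℂ g (∑' n, harmProj V n f)) :=
      hs.hasSum.mapL (innerSL ℂ g)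
    have h2 : HasSum (fun m => inner ℂ g (harmProj V m f)) (inner ℂ g (harmProj V n f)) :=
      hasSum_single n fun m hm => inner_sphericalHarmonics_eq_zero hV (Ne.symm hm) hg
        (harmProj_mem m f)
    rw [inner_sub_right, h1.unique h2, ← inner_sub_right]
    exact Submodule.inner_right_of_mem_orthogonal hg (Submodule.sub_starProjection_mem_orthogonal f)
  rw [sub_eq_zero] at h0
  conv => arg 2; rw [h0]
  exact hs.hasSum

lemma harmProj_eq_zero {n : ℕ} {f : Lp ℂ 2 (sphereMeasure V)}
    (h : ∀ g ∈ sphericalHarmonics V n, inner ℂ g f = 0) : harmProj V n f = 0 := by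
  have h1 := inner_harmProj_self n f
  rw [h _ (harmProj_mem n f)] at h1
  have h2 : ‖harmProj V n f‖ ^ 2 = 0 := by exact_mod_cast h1.symm
  simpa using h2

/-- The restriction of a homogeneous polynomial has no components of higher degree. -/
lemma harmProj_smoothHomog_eq_zero (hV : 2 ≤ Module.finrank ℝ V) {n l : ℕ} (hnl : n < l)
    {f : V → ℂ} (hf : SmoothHomog n f)
    (hm : MemLp (fun x : USphere V => f x) 2 (sphereMeasure V)) :
    harmProj V l hm.toLp = 0 := by
  have := nontrivial_of_two_le hV
  refine harmProj_eq_zero fun g hg => ?_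
  obtain ⟨v, hv, hgv⟩ := mem_sphericalHarmonics_iff.1 hg
  obtain ⟨h, hh, hsum⟩ := exists_decomposition hV hf
  have h1 : inner ℂ g hm.toLp = ∫ x : USphere V, ∑ i ∈ Finset.range (n + 1),
      starRingEnd ℂ (v x) * h i x ∂sphereMeasure V := by
    rw [L2.inner_def]
    refine integral_congr_ae ?_
    filter_upwards [hgv, hm.coeFn_toLp] with x h1 h2
    rw [h1, h2, RCLike.inner_apply, hsum, mul_comm, Finset.mul_sum]
  rw [h1, integral_finsetSum _ fun i _ => integrable_of_continuous (by
    have := hv.continuous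
    have := (hh i).continuous
    fun_prop)]
  refine Finset.sum_eq_zero fun i hi => ?_
  rw [Finset.mem_range] at hi
  exact integral_conj_harmonic_mul_eq_zero hV (by omega) hv.toSmoothHomog (hh i).toSmoothHomog
    hv.lapl_eq (hh i).lapl_eq

end L2

/-! ### Zonal averaging operators -/

section Zonal

variable {V : Type*} [NormedAddCommGroup V] [InnerProductSpace ℝ V] [FiniteDimensional ℝ V]
  [MeasurableSpace V] [BorelSpace V]

/-- A function `k` such that `(x, θ) ↦ k ⟪x, θ⟫` is a Markov kernel on the sphere. -/
structure ZonalKernel (V : Type*) [NormedAddCommGroup V] [InnerProductSpace ℝ V]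
    [FiniteDimensional ℝ V] [MeasurableSpace V] [BorelSpace V] (k : ℝ → ℝ) : Prop where
  continuous : Continuous k
  nonneg : ∀ t, 0 ≤ k t
  integral_eq_one : ∀ θ : USphere V, ∫ x : USphere V, k ⟪(x : V), (θ : V)⟫ ∂sphereMeasure V = 1

/-- Average of `f` with respect to the weight `x ↦ k ⟪x, θ⟫`. -/
noncomputable def zonal (k : ℝ → ℝ) (f : USphere V → ℂ) (θ : USphere V) : ℂ :=
  ∫ x : USphere V, (k ⟪(x : V), (θ : V)⟫ : ℂ) * f x ∂sphereMeasure V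

variable {k : ℝ → ℝ}

lemma exists_bound_on_inner (hk : Continuous k) :
    ∃ C, ∀ x θ : USphere V, ‖k ⟪(x : V), (θ : V)⟫‖ ≤ C := by
  obtain ⟨C, hC⟩ := (isCompact_Icc (a := (-1 : ℝ)) (b := 1)).exists_bound_of_continuousOn
    hk.continuousOn
  refine ⟨C, fun x θ => hC _ (abs_le.1 ?_)⟩
  have := abs_real_inner_le_norm (x : V) (θ : V)
  rwa [norm_coe_sphere, norm_coe_sphere, one_mul] at this

lemma integrable_kernel_mul (hk : Continuous k) {f : USphere V → ℂ}
    (hf : Integrable f (sphereMeasure V)) (θ : USphere V) :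
    Integrable (fun x : USphere V => (k ⟪(x : V), (θ : V)⟫ : ℂ) * f x) (sphereMeasure V) := by
  obtain ⟨C, hC⟩ := exists_bound_on_inner (V := V) hk
  refine hf.bdd_mul (c := C) (Continuous.aestronglyMeasurable (by fun_prop)) ?_
  exact Filter.Eventually.of_forall fun x => by rw [Complex.norm_real]; exact hC x θ

lemma continuous_zonal (hk : Continuous k) {f : USphere V → ℂ}
    (hf : Integrable f (sphereMeasure V)) : Continuous (zonal k f) := by
  obtain ⟨C, hC⟩ := exists_bound_on_inner (V := V) hk
  refine continuous_of_dominated (bound := fun x => C * ‖f x‖)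
    (fun θ => (integrable_kernel_mul hk hf θ).aestronglyMeasurable) ?_ (hf.norm.const_mul C) ?_
  · refine fun θ => Filter.Eventually.of_forall fun x => ?_
    rw [norm_mul, Complex.norm_real]
    exact mul_le_mul_of_nonneg_right (hC x θ) (norm_nonneg _)
  · exact Filter.Eventually.of_forall fun x => by fun_prop

lemma zonal_sub (hk : Continuous k) {f g : USphere V → ℂ} (hf : Integrable f (sphereMeasure V))
    (hg : Integrable g (sphereMeasure V)) (θ : USphere V) :
    zonal k (fun x => f x - g x) θ = zonal k f θ - zonal k g θ := by
  rw [zonal, zonal, zonal, ← integral_sub (integrable_kernel_mul hk hf θ)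
    (integrable_kernel_mul hk hg θ)]
  simp only [mul_sub]

lemma zonal_sum (hk : Continuous k) {ι : Type*} (s : Finset ι) {f : ι → USphere V → ℂ}
    (hf : ∀ i, Integrable (f i) (sphereMeasure V)) (θ : USphere V) :
    zonal k (fun x => ∑ i ∈ s, f i x) θ = ∑ i ∈ s, zonal k (f i) θ := by
  simp only [zonal, Finset.mul_sum]
  exact integral_finsetSum _ fun i _ => integrable_kernel_mul hk (hf i) θ

/-- The operator with kernel `k` is symmetric for the bilinear pairing. -/
lemma integral_mul_zonal [Nontrivial V] (hk : Continuous k) {f g : USphere V → ℂ}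
    (hf : Integrable f (sphereMeasure V)) (hg : Integrable g (sphereMeasure V)) :
    ∫ θ, g θ * zonal k f θ ∂sphereMeasure V = ∫ θ, zonal k g θ * f θ ∂sphereMeasure V := by
  obtain ⟨C, hC⟩ := exists_bound_on_inner (V := V) hk
  have hI : Integrable (fun p : USphere V × USphere V =>
      (k ⟪(p.1 : V), (p.2 : V)⟫ : ℂ) * (g p.1 * f p.2)) ((sphereMeasure V).prod (sphereMeasure V)) := by
    refine (hg.mul_prod hf).bdd_mul (c := C) (Continuous.aestronglyMeasurable (by fun_prop)) ?_
    exact Filter.Eventually.of_forall fun x => by rw [Complex.norm_real]; exact hC _ _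
  have h1 := integral_integral_swap (f := fun θ x : USphere V =>
    (k ⟪(θ : V), (x : V)⟫ : ℂ) * (g θ * f x)) hI
  have e1 : ∀ θ : USphere V, ∫ x : USphere V, (k ⟪(θ : V), (x : V)⟫ : ℂ) * (g θ * f x) ∂sphereMeasure V
      = g θ * zonal k f θ := fun θ => by
    rw [zonal, ← integral_const_mul]
    refine integral_congr_ae (Filter.Eventually.of_forall fun x => ?_)
    simp only [real_inner_comm (θ : V)]
    ring
  have e2 : ∀ x : USphere V, ∫ θ : USphere V, (k ⟪(θ : V), (x : V)⟫ : ℂ) * (g θ * f x) ∂sphereMeasure V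
      = zonal k g x * f x := fun x => by
    rw [zonal, ← integral_mul_const]
    exact integral_congr_ae (Filter.Eventually.of_forall fun θ => by ring)
  simp only [e1, e2] at h1
  exact h1

lemma conj_zonal (f : USphere V → ℂ) (θ : USphere V) :
    starRingEnd ℂ (zonal k f θ) = zonal k (fun x => starRingEnd ℂ (f x)) θ := by
  rw [zonal, ← integral_conj]
  simp [zonal]

lemma zonal_const_one (hk : ZonalKernel V k) (θ : USphere V) : zonal k (fun _ => 1) θ = 1 := by
  simp only [zonal, mul_one]
  rw [integral_complex_ofReal, hk.integral_eq_one, Complex.ofReal_one]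

lemma integral_zonal [Nontrivial V] (hk : ZonalKernel V k) {f : USphere V → ℂ}
    (hf : Integrable f (sphereMeasure V)) :
    ∫ θ, zonal k f θ ∂sphereMeasure V = ∫ θ, f θ ∂sphereMeasure V := by
  have h := integral_mul_zonal hk.continuous hf (integrable_const (1 : ℂ))
  simpa only [one_mul, zonal_const_one hk] using h

lemma integrable_of_memLp_two [Nontrivial V] {f : USphere V → ℂ} (hf : MemLp f 2 (sphereMeasure V)) :
    Integrable f (sphereMeasure V) := hf.integrable one_le_two

lemma memLp_zonal [Nontrivial V] (hk : Continuous k) {f : USphere V → ℂ}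
    (hf : MemLp f 2 (sphereMeasure V)) : MemLp (zonal k f) 2 (sphereMeasure V) :=
  memLp_of_continuous (continuous_zonal hk (integrable_of_memLp_two hf))

lemma norm_toLp_sq {f : USphere V → ℂ} (hf : MemLp f 2 (sphereMeasure V)) :
    ‖hf.toLp f‖ ^ 2 = ∫ x, ‖f x‖ ^ 2 ∂sphereMeasure V := by
  have h := inner_toLp_eq hf hf
  rw [inner_self_eq_norm_sq_to_K] at h
  have h4 : ∀ x : USphere V, starRingEnd ℂ (f x) * f x = ((‖f x‖ ^ 2 : ℝ) : ℂ) := fun x => by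
    rw [mul_comm, Complex.mul_conj, Complex.normSq_eq_norm_sq]
  simp only [h4] at h
  rw [integral_complex_ofReal] at h
  refine Complex.ofReal_injective ?_
  rw [← h]; push_cast; rfl

lemma norm_zonal_sq_le [Nontrivial V] (hk : ZonalKernel V k) {f : USphere V → ℂ}
    (hf : MemLp f 2 (sphereMeasure V)) (θ : USphere V) :
    ‖zonal k f θ‖ ^ 2 ≤ (zonal k (fun x => ((‖f x‖ ^ 2 : ℝ) : ℂ)) θ).re := by
  set a := ‖zonal k f θ‖
  have hf1 := integrable_of_memLp_two hf
  have hf2 : Integrable (fun x => ‖f x‖ ^ 2) (sphereMeasure V) := hf.integrable_norm_pow two_ne_zero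
  have hkI : ∀ {g : USphere V → ℝ}, Integrable g (sphereMeasure V) →
      Integrable (fun x : USphere V => k ⟪(x : V), (θ : V)⟫ * g x) (sphereMeasure V) := fun {g} hg => by
    have := (integrable_kernel_mul hk.continuous hg.ofReal θ).re
    simpa [← Complex.ofReal_mul] using this
  have h1 : a ≤ ∫ x : USphere V, k ⟪(x : V), (θ : V)⟫ * ‖f x‖ ∂sphereMeasure V := by
    refine (norm_integral_le_integral_norm _).trans (le_of_eq ?_)
    refine integral_congr_ae (Filter.Eventually.of_forall fun x => ?_)
    simp only [norm_mul, Complex.norm_real, Real.norm_of_nonneg (hk.nonneg _)]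
  have h2 : (zonal k (fun x => ((‖f x‖ ^ 2 : ℝ) : ℂ)) θ).re
      = ∫ x : USphere V, k ⟪(x : V), (θ : V)⟫ * ‖f x‖ ^ 2 ∂sphereMeasure V := by
    simp only [zonal, ← Complex.ofReal_mul]
    rw [integral_complex_ofReal, Complex.ofReal_re]
  have h3 : 2 * a * ∫ x : USphere V, k ⟪(x : V), (θ : V)⟫ * ‖f x‖ ∂sphereMeasure V
      ≤ a ^ 2 + ∫ x : USphere V, k ⟪(x : V), (θ : V)⟫ * ‖f x‖ ^ 2 ∂sphereMeasure V := by
    have e : a ^ 2 = ∫ x : USphere V, k ⟪(x : V), (θ : V)⟫ * a ^ 2 ∂sphereMeasure V := by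
      rw [integral_mul_const, hk.integral_eq_one, one_mul]
    conv_rhs => rw [e]
    rw [← integral_const_mul, ← integral_add (hkI (integrable_const _)) (hkI hf2)]
    refine integral_mono ((hkI hf1.norm).const_mul _)
      ((hkI (integrable_const _)).add (hkI hf2)) fun x => ?_
    have := mul_nonneg (hk.nonneg ⟪(x : V), (θ : V)⟫) (sq_nonneg (a - ‖f x‖))
    nlinarith
  have ha : 0 ≤ a := norm_nonneg _
  rw [h2]
  nlinarith [mul_le_mul_of_nonneg_left h1 ha]

lemma norm_toLp_zonal_le [Nontrivial V] (hk : ZonalKernel V k) {f : USphere V → ℂ}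
    (hf : MemLp f 2 (sphereMeasure V)) (hm : MemLp (zonal k f) 2 (sphereMeasure V)) :
    ‖hm.toLp (zonal k f)‖ ≤ ‖hf.toLp f‖ := by
  have hf2 : Integrable (fun x => ((‖f x‖ ^ 2 : ℝ) : ℂ)) (sphereMeasure V) :=
    (hf.integrable_norm_pow two_ne_zero).ofReal
  refine le_of_sq_le_sq ?_ (norm_nonneg _)
  rw [norm_toLp_sq, norm_toLp_sq]
  have hz := integrable_of_continuous (μ := sphereMeasure V) (continuous_zonal hk.continuous hf2)
  refine (integral_mono (integrable_of_continuous
    ((continuous_zonal hk.continuous (integrable_of_memLp_two hf)).norm.pow 2)) hz.re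
    (norm_zonal_sq_le hk hf)).trans (le_of_eq ?_)
  have h1 := integral_zonal hk hf2
  rw [integral_complex_ofReal] at h1
  refine Eq.trans ?_ (congrArg Complex.re h1)
  exact integral_re hz

/-- The measure `k ⟪x, y⟫ dσ(x) dσ(y)`. -/
noncomputable def kernelMeasure (V : Type*) [NormedAddCommGroup V] [InnerProductSpace ℝ V]
    [FiniteDimensional ℝ V] [MeasurableSpace V] [BorelSpace V] (k : ℝ → ℝ) :
    Measure (USphere V × USphere V) :=
  ((sphereMeasure V).prod (sphereMeasure V)).withDensity
    fun p => ENNReal.ofReal (k ⟪(p.1 : V), (p.2 : V)⟫)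

lemma isFiniteMeasure_kernelMeasure [Nontrivial V] (hk : Continuous k) :
    IsFiniteMeasure (kernelMeasure V k) :=
  isFiniteMeasure_withDensity_ofReal (integrable_of_continuous
    (X := USphere V × USphere V) (by fun_prop)).hasFiniteIntegral

lemma map_kernelMeasure [Nontrivial V] (hk : Continuous k) (e : V ≃ₗᵢ[ℝ] V) :
    (kernelMeasure V k).map (Prod.map (sphereIso e) (sphereIso e)) = kernelMeasure V k := by
  have he : Measurable (sphereIso e) := (sphereIso e).continuous.measurable
  have hT : Measurable (Prod.map (sphereIso e) (sphereIso e)) := he.prodMap he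
  have hρ : Measurable fun p : USphere V × USphere V => ENNReal.ofReal (k ⟪(p.1 : V), (p.2 : V)⟫) :=
    (Continuous.measurable (by fun_prop : Continuous fun p : USphere V × USphere V =>
      k ⟪(p.1 : V), (p.2 : V)⟫)).ennreal_ofReal
  ext s hs
  rw [Measure.map_apply hT hs, kernelMeasure, withDensity_apply _ (hT hs), withDensity_apply _ hs]
  have hmap : ((sphereMeasure V).prod (sphereMeasure V)).map (Prod.map (sphereIso e) (sphereIso e))
      = (sphereMeasure V).prod (sphereMeasure V) := by
    rw [← Measure.map_prod_map _ _ he he, map_sphereMeasure]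
  conv_rhs => rw [← hmap, setLIntegral_map hs hρ hT]
  refine lintegral_congr fun p => ?_
  simp

lemma integral_kernelMeasure [Nontrivial V] (hk : ZonalKernel V k) {f g : USphere V → ℂ}
    (hf : Continuous f) (hg : Continuous g) :
    ∫ p, g p.1 * f p.2 ∂kernelMeasure V k = ∫ θ, g θ * zonal k f θ ∂sphereMeasure V := by
  have hkc := hk.continuous
  have hρ : Measurable fun p : USphere V × USphere V => ENNReal.ofReal (k ⟪(p.1 : V), (p.2 : V)⟫) :=
    (Continuous.measurable (by fun_prop : Continuous fun p : USphere V × USphere V =>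
      k ⟪(p.1 : V), (p.2 : V)⟫)).ennreal_ofReal
  rw [kernelMeasure, integral_withDensity_eq_integral_toReal_smul hρ
    (Filter.Eventually.of_forall fun _ => ENNReal.ofReal_lt_top), integral_prod _
    (integrable_of_continuous (X := USphere V × USphere V) (by
      simp only [ENNReal.toReal_ofReal (hk.nonneg _)]; fun_prop))]
  refine integral_congr_ae (Filter.Eventually.of_forall fun θ => ?_)
  simp only [zonal]
  rw [← integral_const_mul]
  refine integral_congr_ae (Filter.Eventually.of_forall fun x => ?_)
  simp only [ENNReal.toReal_ofReal (hk.nonneg _), Complex.real_smul, real_inner_comm (θ : V)]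
  ring

/-- Zonal operators map harmonic polynomials to harmonic polynomials of the same degree, because
the corresponding bilinear form is rotation-invariant. -/
lemma exists_harmHomog_zonal_eq (hV : 2 ≤ Module.finrank ℝ V) (hk : ZonalKernel V k) {n : ℕ}
    {h : V → ℂ} (hh : HarmHomog n h) :
    ∃ g : V → ℂ, HarmHomog n g ∧ ∀ θ : USphere V, zonal k (fun x => h x) θ = g θ := by
  have := nontrivial_of_two_le hV
  have hhc : Continuous fun x : USphere V => h x := hh.continuous.comp continuous_subtype_val
  have hm := memLp_of_continuous hhc
  have hzc := continuous_zonal hk.continuous (integrable_of_memLp_two hm)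
  have hz := memLp_zonal hk.continuous hm
  have := isFiniteMeasure_kernelMeasure (V := V) hk.continuous
  have h0 : ∀ m, m ≠ n → harmProj V m hz.toLp = 0 := fun m hmn => by
    refine harmProj_eq_zero fun g hg => ?_
    obtain ⟨u, hu, hgu⟩ := mem_sphericalHarmonics_iff.1 hg
    have h1 := integral_harmonic_mul_eq_zero hV (map_kernelMeasure hk.continuous) hmn
      hu.toSmoothHomog.conj hh.toSmoothHomog (lapl_conj_eq_zero hu.smooth hu.lapl_eq) hh.lapl_eq
    rw [integral_kernelMeasure hk hhc (g := fun x : USphere V => starRingEnd ℂ (u x)) (by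
      have := hu.continuous
      fun_prop)] at h1
    rw [L2.inner_def, ← h1]
    refine integral_congr_ae ?_
    filter_upwards [hgu, hz.coeFn_toLp] with x e1 e2
    rw [e1, e2, RCLike.inner_apply, mul_comm]
  have h1 : harmProj V n hz.toLp = hz.toLp := by
    refine (hasSum_single n fun m hmn => h0 m hmn).unique (hasSum_harmProj hV hz.toLp)
  have h2 := harmProj_mem n hz.toLp
  rw [h1] at h2
  obtain ⟨g, hg, hgz⟩ := mem_sphericalHarmonics_iff.1 h2
  refine ⟨g, hg, congrFun ((Continuous.ae_eq_iff_eq (sphereMeasure V) hzc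
    (hg.continuous.comp continuous_subtype_val)).1 (hz.coeFn_toLp.symm.trans hgz))⟩

/-- A zonal operator does not increase the norms of the components of a function. -/
lemma norm_harmProj_zonal_le (hV : 2 ≤ Module.finrank ℝ V) (hk : ZonalKernel V k)
    {f : USphere V → ℂ} (hf : MemLp f 2 (sphereMeasure V))
    (hm : MemLp (zonal k f) 2 (sphereMeasure V)) (n : ℕ) :
    ‖harmProj V n (hm.toLp (zonal k f))‖ ≤ ‖harmProj V n (hf.toLp f)‖ := by
  have := nontrivial_of_two_le hV
  set u := harmProj V n (hm.toLp (zonal k f)) with hu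
  obtain ⟨h, hh, huh⟩ := mem_sphericalHarmonics_iff.1 (harmProj_mem n (hm.toLp (zonal k f)))
  have hhm : MemLp (fun x : USphere V => h x) 2 (sphereMeasure V) :=
    memLp_of_continuous (hh.continuous.comp continuous_subtype_val)
  have hu1 : u = hhm.toLp := Lp.ext (huh.trans hhm.coeFn_toLp.symm)
  obtain ⟨g, hg, hzg⟩ := exists_harmHomog_zonal_eq hV hk hh
  have hzm := memLp_zonal hk.continuous hhm
  have hmem : hzm.toLp ∈ sphericalHarmonics V n :=
    mem_sphericalHarmonics_iff.2 ⟨g, hg, hzm.coeFn_toLp.trans (Filter.Eventually.of_forall hzg)⟩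
  have h1 : inner ℂ u (hm.toLp (zonal k f)) = inner ℂ hzm.toLp (hf.toLp f) := by
    rw [hu1, inner_toLp_eq, inner_toLp_eq]
    simp only [conj_zonal]
    exact integral_mul_zonal hk.continuous (integrable_of_memLp_two hf)
      (integrable_of_memLp_two hhm.star)
  have h2 : inner ℂ hzm.toLp (hf.toLp f) = inner ℂ hzm.toLp (harmProj V n (hf.toLp f)) := by
    rw [← sub_eq_zero, ← inner_sub_right]
    exact Submodule.inner_right_of_mem_orthogonal hmem
      (Submodule.sub_starProjection_mem_orthogonal (hf.toLp f))
  have h3 := norm_inner_le_norm (𝕜 := ℂ) hzm.toLp (harmProj V n (hf.toLp f))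
  rw [← h2, ← h1, inner_harmProj_self, Complex.norm_real, Real.norm_of_nonneg (sq_nonneg _)] at h3
  have h4 := norm_toLp_zonal_le hk hhm hzm
  rw [← hu1] at h4
  have h5 := mul_le_mul_of_nonneg_right h4 (norm_nonneg (harmProj V n (hf.toLp f)))
  rcases (norm_nonneg u).eq_or_lt with h6 | h6
  · rw [← h6]; exact norm_nonneg _
  · exact le_of_mul_le_mul_left (by rw [← pow_two]; exact h3.trans h5) h6

end Zonal

/-! ### Trigonometric polynomials and the trace on great spheres -/

section Trig

/-- `p` is a trigonometric polynomial of degree at most `M`. -/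
def TrigPoly (M : ℕ) (p : ℝ → ℂ) : Prop :=
  ∃ P : Polynomial ℂ, P.natDegree ≤ 2 * M ∧
    ∀ φ : ℝ, p φ = Complex.exp (-(M * (φ * Complex.I))) * P.eval (Complex.exp (φ * Complex.I))

namespace TrigPoly

variable {M N : ℕ} {p q : ℝ → ℂ}

lemma add (hp : TrigPoly M p) (hq : TrigPoly M q) : TrigPoly M fun φ => p φ + q φ := by
  obtain ⟨P, hP, hp⟩ := hp
  obtain ⟨Q, hQ, hq⟩ := hq
  refine ⟨P + Q, Polynomial.natDegree_add_le_of_degree_le hP hQ, fun φ => ?_⟩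
  dsimp only
  rw [hp, hq, Polynomial.eval_add, mul_add]

lemma mul (hp : TrigPoly M p) (hq : TrigPoly N q) : TrigPoly (M + N) fun φ => p φ * q φ := by
  obtain ⟨P, hP, hp⟩ := hp
  obtain ⟨Q, hQ, hq⟩ := hq
  refine ⟨P * Q, Polynomial.natDegree_mul_le.trans (by omega), fun φ => ?_⟩
  have h : -(((M + N : ℕ) : ℂ) * (φ * Complex.I))
      = -(M * (φ * Complex.I)) + -(N * (φ * Complex.I)) := by push_cast; ring
  dsimp only
  rw [hp, hq, Polynomial.eval_mul, h, Complex.exp_add]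
  ring

lemma const (c : ℂ) : TrigPoly 0 fun _ => c :=
  ⟨Polynomial.C c, by simp, fun φ => by simp⟩

lemma const_mul (hp : TrigPoly M p) (c : ℂ) : TrigPoly M fun φ => c * p φ := by
  simpa using (const c).mul hp

lemma mono (hp : TrigPoly M p) (h : M ≤ N) : TrigPoly N p := by
  obtain ⟨P, hP, hp⟩ := hp
  obtain ⟨k, rfl⟩ := Nat.exists_eq_add_of_le h
  refine ⟨P * Polynomial.X ^ k, ?_, fun φ => ?_⟩
  · refine Polynomial.natDegree_mul_le.trans ?_
    rw [Polynomial.natDegree_X_pow]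
    omega
  · have h : -(M * (φ * Complex.I))
        = -(((M + k : ℕ) : ℂ) * (φ * Complex.I)) + k * (φ * Complex.I) := by push_cast; ring
    rw [hp, h, Complex.exp_add, Polynomial.eval_mul, Polynomial.eval_pow, Polynomial.eval_X,
      Complex.exp_nat_mul (φ * Complex.I) k]
    ring

lemma sum {ι : Type*} (s : Finset ι) {p : ι → ℝ → ℂ} (hp : ∀ i ∈ s, TrigPoly M (p i)) :
    TrigPoly M fun φ => ∑ i ∈ s, p i φ := by
  classical
  induction s using Finset.induction_on with
  | empty => simpa using (const 0).mono (Nat.zero_le M)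
  | insert a s ha ih =>
    simp only [Finset.sum_insert ha]
    exact (hp a (Finset.mem_insert_self _ _)).add (ih fun i hi => hp i (Finset.mem_insert_of_mem hi))

lemma prod {ι : Type*} (s : Finset ι) {p : ι → ℝ → ℂ} (hp : ∀ i ∈ s, TrigPoly 1 (p i)) :
    TrigPoly s.card fun φ => ∏ i ∈ s, p i φ := by
  classical
  induction s using Finset.induction_on with
  | empty => simpa using const 1
  | insert a s ha ih =>
    simp only [Finset.prod_insert ha, Finset.card_insert_of_notMem ha, add_comm s.card]
    exact (hp a (Finset.mem_insert_self _ _)).mul (ih fun i hi => hp i (Finset.mem_insert_of_mem hi))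

lemma cos : TrigPoly 1 fun φ => (Real.cos φ : ℂ) := by
  refine ⟨Polynomial.C (1 / 2) * (Polynomial.X ^ 2 + 1), ?_, fun φ => ?_⟩
  · compute_degree
  · have h : Complex.exp (-(φ * Complex.I)) * Complex.exp (φ * Complex.I) = 1 := by
      rw [← Complex.exp_add]; simp
    simp only [Complex.ofReal_cos, Complex.cos, Nat.cast_one, one_mul, Polynomial.eval_mul,
      Polynomial.eval_C, Polynomial.eval_add, Polynomial.eval_pow, Polynomial.eval_X,
      Polynomial.eval_one, neg_mul]
    linear_combination (-Complex.exp (φ * Complex.I) / 2) * h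

lemma sin : TrigPoly 1 fun φ => (Real.sin φ : ℂ) := by
  refine ⟨Polynomial.C (-Complex.I / 2) * (Polynomial.X ^ 2 - 1), ?_, fun φ => ?_⟩
  · compute_degree
  · have h : Complex.exp (-(φ * Complex.I)) * Complex.exp (φ * Complex.I) = 1 := by
      rw [← Complex.exp_add]; simp
    simp only [Complex.ofReal_sin, Complex.sin, Nat.cast_one, one_mul, Polynomial.eval_mul,
      Polynomial.eval_C, Polynomial.eval_sub, Polynomial.eval_pow, Polynomial.eval_X,
      Polynomial.eval_one, neg_mul]
    linear_combination (Complex.I * Complex.exp (φ * Complex.I) / 2) * h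

lemma cos_pow (n : ℕ) : TrigPoly n fun φ => (Real.cos φ : ℂ) ^ n := by
  simpa using prod (Finset.univ : Finset (Fin n)) fun _ _ => cos

lemma continuous (hp : TrigPoly M p) : Continuous p := by
  obtain ⟨P, -, hp⟩ := hp
  rw [funext hp]
  have := P.continuous
  fun_prop

end TrigPoly

lemma integral_exp_int (n : ℤ) :
    ∫ φ in (-Real.pi)..Real.pi, Complex.exp (n * (φ * Complex.I))
      = if n = 0 then 2 * Real.pi else 0 := by
  split_ifs with hn
  · subst hn
    simp only [Int.cast_zero, zero_mul, Complex.exp_zero, intervalIntegral.integral_const,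
      Complex.real_smul]
    push_cast
    ring
  · have hc : (n : ℂ) * Complex.I ≠ 0 := mul_ne_zero (by exact_mod_cast hn) Complex.I_ne_zero
    have h := integral_exp_mul_complex (a := -Real.pi) (b := Real.pi) hc
    have e : ∀ φ : ℝ, (n : ℂ) * Complex.I * φ = n * (φ * Complex.I) := fun φ => by ring
    simp only [e] at h
    rw [h, Complex.ofReal_zero, div_eq_zero_iff, sub_eq_zero]
    refine Or.inl (Complex.exp_eq_exp_iff_exists_int.2 ⟨n, ?_⟩)
    push_cast
    ring

/-- Parseval's identity for polynomials on the unit circle. -/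
lemma integral_normSq_polynomial (P : Polynomial ℂ) {D : ℕ} (hD : P.natDegree ≤ D) :
    ∫ φ in (-Real.pi)..Real.pi, ‖P.eval (Complex.exp (φ * Complex.I))‖ ^ 2
      = 2 * Real.pi * ∑ k ∈ Finset.range (D + 1), ‖P.coeff k‖ ^ 2 := by
  refine Complex.ofReal_injective ?_
  rw [← intervalIntegral.integral_ofReal]
  have h1 : ∀ φ : ℝ, ((‖P.eval (Complex.exp (φ * Complex.I))‖ ^ 2 : ℝ) : ℂ)
      = ∑ k ∈ Finset.range (D + 1), ∑ l ∈ Finset.range (D + 1),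
        (P.coeff k * starRingEnd ℂ (P.coeff l)) *
          Complex.exp (((k - l : ℤ) : ℂ) * (φ * Complex.I)) := fun φ => by
    rw [← Complex.normSq_eq_norm_sq, ← Complex.mul_conj,
      Polynomial.eval_eq_sum_range' (Nat.lt_succ_of_le hD), map_sum, Finset.sum_mul_sum]
    refine Finset.sum_congr rfl fun k _ => Finset.sum_congr rfl fun l _ => ?_
    have e : ((k - l : ℤ) : ℂ) * (φ * Complex.I) = k * (φ * Complex.I) + l * -(φ * Complex.I) := by
      push_cast; ring
    rw [e, Complex.exp_add, Complex.exp_nat_mul, Complex.exp_nat_mul, map_mul, map_pow,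
      ← Complex.exp_conj, map_mul, Complex.conj_I, Complex.conj_ofReal, mul_neg]
    ring
  simp only [h1]
  have hint : ∀ (c : ℂ) (n : ℤ), IntervalIntegrable
      (fun φ : ℝ => c * Complex.exp (n * (φ * Complex.I))) volume (-Real.pi) Real.pi :=
    fun c n => Continuous.intervalIntegrable (by fun_prop) _ _
  rw [intervalIntegral.integral_finsetSum fun k _ => Continuous.intervalIntegrable
    (by fun_prop) _ _]
  push_cast
  rw [Finset.mul_sum]
  refine Finset.sum_congr rfl fun k hk => ?_
  rw [intervalIntegral.integral_finsetSum fun l _ => by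
    have := hint (P.coeff k * starRingEnd ℂ (P.coeff l)) (k - l)
    push_cast at this
    exact this, Finset.sum_eq_single k]
  · have h := integral_exp_int (k - k)
    push_cast at h
    rw [intervalIntegral.integral_const_mul, h, Complex.mul_conj, Complex.normSq_eq_norm_sq]
    simp
    ring
  · intro l _ hlk
    have h := integral_exp_int (k - l)
    rw [if_neg (by omega)] at h
    push_cast at h
    rw [intervalIntegral.integral_const_mul, h, mul_zero]
  · exact fun h => absurd hk h

/-- A trigonometric polynomial of degree `M` is controlled at each point by its `L²` norm, with the
loss of a factor of order `M`. -/
lemma TrigPoly.enorm_zero_sq_le {M : ℕ} {p : ℝ → ℂ} (hp : TrigPoly M p) :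
    ‖p 0‖ₑ ^ 2 ≤ (2 * M + 1) * ∫⁻ φ in Ioo (-Real.pi) Real.pi, ‖p φ‖ₑ ^ 2 := by
  have hpc := hp.continuous
  obtain ⟨P, hP, hp⟩ := hp
  have hn : ∀ φ, ‖p φ‖ = ‖P.eval (Complex.exp (φ * Complex.I))‖ := fun φ => by
    rw [hp, norm_mul, show -(M * (φ * Complex.I)) = ((-(M * φ) : ℝ) : ℂ) * Complex.I by
      push_cast; ring, Complex.norm_exp_ofReal_mul_I, one_mul]
  have h1 : ‖p 0‖ ^ 2 ≤ (2 * M + 1) * ∫ φ in Ioo (-Real.pi) Real.pi, ‖p φ‖ ^ 2 := by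
    rw [← integral_Ioc_eq_integral_Ioo,
      ← intervalIntegral.integral_of_le (by linarith [Real.pi_pos])]
    simp only [hn]
    rw [integral_normSq_polynomial P hP]
    have h2 : ‖P.eval (Complex.exp ((0 : ℝ) * Complex.I))‖
        ≤ ∑ k ∈ Finset.range (2 * M + 1), ‖P.coeff k‖ := by
      rw [Polynomial.eval_eq_sum_range' (Nat.lt_succ_of_le hP)]
      refine (norm_sum_le _ _).trans (Finset.sum_le_sum fun k _ => ?_)
      simp
    have h3 := sq_sum_le_card_mul_sum_sq (s := Finset.range (2 * M + 1)) (f := fun k => ‖P.coeff k‖)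
    rw [Finset.card_range] at h3
    push_cast at h3
    have h4 := pow_le_pow_left₀ (norm_nonneg _) h2 2
    have h5 : 0 ≤ ∑ k ∈ Finset.range (2 * M + 1), ‖P.coeff k‖ ^ 2 :=
      Finset.sum_nonneg fun _ _ => sq_nonneg _
    have h6 : (1 : ℝ) ≤ 2 * Real.pi := by linarith [Real.pi_gt_three]
    have h7 : (0 : ℝ) ≤ 2 * M + 1 := by positivity
    have h8 := mul_le_mul_of_nonneg_left (le_mul_of_one_le_left h5 h6) h7
    linarith
  have hI : Integrable (fun φ => ‖p φ‖ ^ 2) (volume.restrict (Ioo (-Real.pi) Real.pi)) :=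
    ((hpc.norm.pow 2).continuousOn.integrableOn_Icc).mono_set Ioo_subset_Icc_self
  have h2 := ENNReal.ofReal_le_ofReal h1
  rw [ENNReal.ofReal_mul (by positivity), ofReal_integral_eq_lintegral_ofReal hI
    (Filter.Eventually.of_forall fun φ => sq_nonneg _)] at h2
  simp only [ENNReal.ofReal_pow (norm_nonneg _), ofReal_norm] at h2
  convert h2 using 2
  rw [ENNReal.ofReal_add (by positivity) zero_le_one, ENNReal.ofReal_mul zero_le_two]
  simp

end Trig

section Trace

variable {V : Type*} [NormedAddCommGroup V] [InnerProductSpace ℝ V] [FiniteDimensional ℝ V]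

/-- The restriction of a homogeneous polynomial to a circle. -/
lemma SmoothHomog.trigPoly {n : ℕ} {f : V → ℂ} (hf : SmoothHomog n f) (v θ : V) :
    TrigPoly n fun φ => f (arc v θ φ) := by
  classical
  obtain ⟨A, hA⟩ := hf.exists_form
  have h1 : ∀ φ, f (arc v θ φ) = ∑ s : Finset (Fin n),
      A (s.piecewise (fun _ => θ) fun _ => v) *
        ∏ i, (if i ∈ s then (Real.cos φ : ℂ) else Real.sin φ) := fun φ => by
    rw [hA]
    have h2 : (fun _ : Fin n => arc v θ φ)
        = (fun _ => Real.cos φ • θ) + fun _ => Real.sin φ • v := rfl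
    rw [h2, A.map_add_univ]
    refine Finset.sum_congr rfl fun s _ => ?_
    have h3 : s.piecewise (fun _ : Fin n => Real.cos φ • θ) (fun _ => Real.sin φ • v)
        = fun i => (if i ∈ s then Real.cos φ else Real.sin φ) •
          s.piecewise (fun _ : Fin n => θ) (fun _ => v) i := by
      funext i
      by_cases hi : i ∈ s <;> simp [hi]
    rw [h3, A.map_smul_univ, Complex.real_smul, mul_comm, Complex.ofReal_prod]
    congr 1
    refine Finset.prod_congr rfl fun i _ => ?_
    split_ifs <;> rfl
  rw [funext h1]
  refine TrigPoly.sum _ fun s _ => TrigPoly.const_mul ?_ _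
  have := TrigPoly.prod (Finset.univ : Finset (Fin n))
    (p := fun i φ => if i ∈ s then (Real.cos φ : ℂ) else Real.sin φ) (fun i _ => by
      by_cases hi : i ∈ s
      · simpa [hi] using TrigPoly.cos
      · simpa [hi] using TrigPoly.sin)
  simpa using this

variable [MeasurableSpace V] [BorelSpace V]

/-- The trace on a great sphere of a polynomial of degree `M`. The factor `cos ^ m`, which is `1`
on the great sphere, absorbs the weight in polar coordinates. -/
theorem lintegral_trace_sq_le (v : USphere V) {m : ℕ} (hm : Module.finrank ℝ V = m + 2)
    {M : ℕ} (s : Finset ℕ) (hs : ∀ n ∈ s, n ≤ M) {h : ℕ → V → ℂ} (hh : ∀ n, SmoothHomog n (h n)) :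
    ∫⁻ θ : USphere (perp (v : V)), ‖∑ n ∈ s, h n (θ : perp (v : V))‖ₑ ^ 2
        ∂sphereMeasure (perp (v : V)) ≤
      ((2 * (M + m) + 1) * cosWeight m) *
        ∫⁻ x : USphere V, ‖∑ n ∈ s, h n x‖ₑ ^ 2 ∂sphereMeasure V := by
  set f : V → ℂ := fun x => ∑ n ∈ s, h n x
  have hfc : Continuous f := continuous_finsetSum _ fun n _ => (hh n).smooth.continuous
  have h1 : ∀ θ : V, ‖f θ‖ₑ ^ 2 ≤ (2 * (M + m) + 1) *
      ∫⁻ φ in Ioo (-Real.pi) Real.pi, ENNReal.ofReal (|Real.cos φ| ^ m) * ‖f (arc (v : V) θ φ)‖ₑ ^ 2 := by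
    intro θ
    have hp : TrigPoly (M + m) fun φ => f (arc (v : V) θ φ) * (Real.cos φ : ℂ) ^ m :=
      (TrigPoly.sum _ fun n hn => ((hh n).trigPoly (v : V) θ).mono (hs n hn)).mul (TrigPoly.cos_pow m)
    have h2 := hp.enorm_zero_sq_le
    have harc : arc (v : V) θ 0 = θ := by simp [arc]
    simp only [harc, Real.cos_zero, Complex.ofReal_one, one_pow, mul_one] at h2
    rw [Nat.cast_add] at h2
    refine h2.trans ?_
    gcongr with φ
    have h3 : ‖f (arc (v : V) θ φ) * (Real.cos φ : ℂ) ^ m‖ₑ ^ 2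
        = ENNReal.ofReal ((|Real.cos φ| ^ m) ^ 2) * ‖f (arc (v : V) θ φ)‖ₑ ^ 2 := by
      rw [enorm_mul, mul_pow, mul_comm, ENNReal.ofReal_pow (by positivity), enorm_pow,
        ← ofReal_norm (Real.cos φ : ℂ), Complex.norm_real, ENNReal.ofReal_pow (by positivity),
        Real.norm_eq_abs]
    refine h3.le.trans ?_
    gcongr
    exact pow_le_of_le_one (by positivity) (pow_le_one₀ (abs_nonneg _) (Real.abs_cos_le_one φ))
      two_ne_zero
  have h2 := lintegral_sphere_eq_arc v hm (f := fun x => ‖f x‖ₑ ^ 2) (by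
    have := hfc.measurable; fun_prop)
  change _ ≤ _ * ∫⁻ x : USphere V, ‖f x‖ₑ ^ 2 ∂sphereMeasure V
  rw [h2, ← mul_assoc, mul_assoc _ (cosWeight m),
    ENNReal.mul_inv_cancel (cosWeight_ne_zero m) (cosWeight_ne_top m), mul_one,
    ← lintegral_const_mul' _ _ (by finiteness)]
  exact lintegral_mono fun θ => h1 _

end Trace

/-! ### The trace estimate in Sobolev spaces -/

section Sums

/-- A finite form of the geometric tail sum `∑_{Q ^ (j + 1) ≥ l} l / Q ^ (j + 1) ≤ Q / (Q - 1)`. -/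
lemma sum_scale_le {Q l : ℝ} (hQ : 1 < Q) (hl : 0 < l) (J : ℕ) :
    ∑ j ∈ Finset.range J, (if Q ^ (j + 1) < l then 0 else l / Q ^ (j + 1))
      + min 1 (l / Q ^ (J + 1)) * (Q / (Q - 1)) ≤ Q / (Q - 1) := by
  have hQ1 : 0 < Q - 1 := by linarith
  have hc : 0 < Q / (Q - 1) := by positivity
  induction J with
  | zero =>
    simp only [Finset.range_zero, Finset.sum_empty, zero_add]
    exact mul_le_of_le_one_left hc.le (min_le_left _ _)
  | succ J ih =>
    rw [Finset.sum_range_succ]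
    have hp : 0 < Q ^ (J + 1) := by positivity
    by_cases h : Q ^ (J + 1) < l
    · rw [if_pos h, Finset.sum_eq_zero, zero_add, zero_add]
      · exact mul_le_of_le_one_left hc.le (min_le_left _ _)
      · intro j hj
        rw [Finset.mem_range] at hj
        exact if_pos ((pow_le_pow_right₀ hQ.le (by omega)).trans_lt h)
    · rw [if_neg h]
      rw [min_eq_right (by rw [div_le_one hp]; exact not_lt.1 h)] at ih
      have h1 : l / Q ^ (J + 1 + 1) = l / Q ^ (J + 1) / Q := by rw [pow_succ, div_div]
      have h2 : min 1 (l / Q ^ (J + 1 + 1)) * (Q / (Q - 1)) ≤ l / Q ^ (J + 1) / (Q - 1) := by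
        refine (mul_le_mul_of_nonneg_right (min_le_right _ _) hc.le).trans (le_of_eq ?_)
        rw [h1]; field_simp
      have h3 : l / Q ^ (J + 1) * (Q / (Q - 1))
          = l / Q ^ (J + 1) + l / Q ^ (J + 1) / (Q - 1) := by field_simp; ring
      linarith

/-- Almost orthogonality: a sum of `a j`, which live at the scales `Q ^ (j + 1) ≥ l`, costs
no more than the single terms once it is weighted with `l ^ 2`. -/
lemma sq_mul_sq_sum_le {Q l : ℝ} (hQ : 1 < Q) (hl : 0 < l) (J : ℕ) {a : ℕ → ℝ}
    (ha : ∀ j, Q ^ (j + 1) < l → a j = 0) :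
    l ^ 2 * (∑ j ∈ Finset.range J, a j) ^ 2
      ≤ Q / (Q - 1) * ∑ j ∈ Finset.range J, (Q ^ (j + 1)) ^ 2 * a j ^ 2 := by
  have hQ1 : 0 < Q - 1 := by linarith
  have hpow : ∀ j, 0 < Q ^ (j + 1) := fun j => by positivity
  have h1 := Finset.sum_sq_le_sum_mul_sum_of_sq_le_mul (Finset.range J) (r := a)
    (f := fun j => if Q ^ (j + 1) < l then 0 else l / Q ^ (j + 1))
    (g := fun j => Q ^ (j + 1) / l * a j ^ 2)
    (fun j _ => by have := hpow j; split_ifs <;> positivity)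
    (fun j _ => by have := hpow j; positivity) (fun j _ => by
      have := hpow j
      split_ifs with h
      · simp [ha j h]
      · exact le_of_eq (by field_simp))
  have h2 : ∑ j ∈ Finset.range J, (if Q ^ (j + 1) < l then 0 else l / Q ^ (j + 1)) ≤ Q / (Q - 1) := by
    have := sum_scale_le hQ hl J
    have h3 : 0 ≤ min 1 (l / Q ^ (J + 1)) * (Q / (Q - 1)) := by
      have := hpow J
      positivity
    linarith
  have h3 : 0 ≤ ∑ j ∈ Finset.range J, Q ^ (j + 1) / l * a j ^ 2 :=
    Finset.sum_nonneg fun j _ => by have := hpow j; positivity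
  have h4 : l ^ 2 * ∑ j ∈ Finset.range J, Q ^ (j + 1) / l * a j ^ 2
      ≤ ∑ j ∈ Finset.range J, (Q ^ (j + 1)) ^ 2 * a j ^ 2 := by
    rw [Finset.mul_sum]
    refine Finset.sum_le_sum fun j _ => ?_
    have := hpow j
    by_cases h : Q ^ (j + 1) < l
    · simp [ha j h]
    · have e : l ^ 2 * (Q ^ (j + 1) / l * a j ^ 2) = l * Q ^ (j + 1) * a j ^ 2 := by field_simp
      rw [e, pow_two (Q ^ (j + 1))]
      have := not_lt.1 h
      gcongr
  calc l ^ 2 * (∑ j ∈ Finset.range J, a j) ^ 2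
      ≤ l ^ 2 * (Q / (Q - 1) * ∑ j ∈ Finset.range J, Q ^ (j + 1) / l * a j ^ 2) := by
        gcongr
        exact h1.trans (mul_le_mul_of_nonneg_right h2 h3)
    _ = Q / (Q - 1) * (l ^ 2 * ∑ j ∈ Finset.range J, Q ^ (j + 1) / l * a j ^ 2) := by ring
    _ ≤ _ := by gcongr

lemma sum_range_dyadic {E : Type*} [AddCommMonoid E] (a : ℕ → E) (J : ℕ) :
    ∑ j ∈ Finset.range J, ∑ n ∈ Finset.Ico (2 ^ j) (2 ^ (j + 1)), a n
      = ∑ n ∈ Finset.Ico 1 (2 ^ J), a n := by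
  induction J with
  | zero => simp
  | succ J ih =>
    rw [Finset.sum_range_succ, ih, Finset.sum_Ico_consecutive _ Nat.one_le_two_pow
      (Nat.pow_le_pow_right two_pos (Nat.le_succ J))]

end Sums

section Energy

variable (V : Type*) [NormedAddCommGroup V] [InnerProductSpace ℝ V] [FiniteDimensional ℝ V]

/-- The weight of the spherical harmonics of degree `n` in the Sobolev norm of order `s`. -/
noncomputable def sobWeight (s : ℝ) (n : ℕ) : ℝ :=
  ((n : ℝ) * ((n : ℝ) + (Module.finrank ℝ V : ℝ) - 2)) ^ s

variable {V}

lemma le_mul_add_sub_two (hV : 2 ≤ Module.finrank ℝ V) (n : ℕ) :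
    (n : ℝ) ^ 2 ≤ (n : ℝ) * ((n : ℝ) + (Module.finrank ℝ V : ℝ) - 2) := by
  have h : (2 : ℝ) ≤ Module.finrank ℝ V := by exact_mod_cast hV
  have h0 : (0 : ℝ) ≤ n := n.cast_nonneg
  nlinarith

lemma sobWeight_nonneg (hV : 2 ≤ Module.finrank ℝ V) (s : ℝ) (n : ℕ) : 0 ≤ sobWeight V s n :=
  Real.rpow_nonneg ((sq_nonneg _).trans (le_mul_add_sub_two hV n)) s

lemma sobWeight_zero {s : ℝ} (hs : 0 < s) : sobWeight V s 0 = 0 := by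
  rw [sobWeight, Nat.cast_zero, zero_mul, Real.zero_rpow hs.ne']

lemma rpow_sq_le_sobWeight (hV : 2 ≤ Module.finrank ℝ V) {s : ℝ} (hs : 0 < s) (n : ℕ) :
    ((n : ℝ) ^ s) ^ 2 ≤ sobWeight V s n := by
  rw [← Real.rpow_natCast, ← Real.rpow_mul n.cast_nonneg, mul_comm s, Real.rpow_mul n.cast_nonneg,
    Real.rpow_natCast]
  exact Real.rpow_le_rpow (sq_nonneg _) (le_mul_add_sub_two hV n) hs.le

lemma sobWeight_le (hV : 2 ≤ Module.finrank ℝ V) {s : ℝ} (hs : 0 < s) {n : ℕ} (hn : 1 ≤ n) :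
    sobWeight V s n ≤ (Module.finrank ℝ V : ℝ) ^ s * ((n : ℝ) ^ s) ^ 2 := by
  have h : (2 : ℝ) ≤ Module.finrank ℝ V := by exact_mod_cast hV
  have h1 : (1 : ℝ) ≤ n := by exact_mod_cast hn
  have h0 : (0 : ℝ) ≤ n := n.cast_nonneg
  rw [← Real.rpow_natCast ((n : ℝ) ^ s), ← Real.rpow_mul h0, mul_comm s, Real.rpow_mul h0,
    Real.rpow_natCast, ← Real.mul_rpow (by positivity) (by positivity)]
  refine Real.rpow_le_rpow ((sq_nonneg _).trans (le_mul_add_sub_two hV n)) ?_ hs.le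
  nlinarith [mul_nonneg (sub_nonneg.2 h) (mul_nonneg h0 (sub_nonneg.2 h1))]

variable [MeasurableSpace V] [BorelSpace V]

/-- The square of the Sobolev norm. -/
noncomputable def sobEnergy (s : ℝ) (f : Lp ℂ 2 (sphereMeasure V)) : ℝ≥0∞ :=
  ∑' n : ℕ, ENNReal.ofReal (sobWeight V s n) * ‖harmProj V n f‖ₑ ^ 2

lemma sobolevNorm_eq {f : USphere V → ℂ} (hf : MemLp f 2 (sphereMeasure V)) (s : ℝ) :
    sobolevNorm V s f = sobEnergy s (hf.toLp f) ^ (1 / 2 : ℝ) := by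
  rw [sobolevNorm, dif_pos hf]
  rfl

lemma ofReal_sum_sobWeight (hV : 2 ≤ Module.finrank ℝ V) (s : ℝ) (L : Finset ℕ)
    (f : Lp ℂ 2 (sphereMeasure V)) :
    ENNReal.ofReal (∑ l ∈ L, sobWeight V s l * ‖harmProj V l f‖ ^ 2)
      = ∑ l ∈ L, ENNReal.ofReal (sobWeight V s l) * ‖harmProj V l f‖ₑ ^ 2 := by
  rw [ENNReal.ofReal_sum_of_nonneg fun l _ => mul_nonneg (sobWeight_nonneg hV s l) (sq_nonneg _)]
  refine Finset.sum_congr rfl fun l _ => ?_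
  rw [ENNReal.ofReal_mul (sobWeight_nonneg hV s l), ENNReal.ofReal_pow (norm_nonneg _), ofReal_norm]

lemma sobEnergy_le (hV : 2 ≤ Module.finrank ℝ V) {s : ℝ} {f : Lp ℂ 2 (sphereMeasure V)} {B : ℝ}
    (h : ∀ L : Finset ℕ, ∑ l ∈ L, sobWeight V s l * ‖harmProj V l f‖ ^ 2 ≤ B) :
    sobEnergy s f ≤ ENNReal.ofReal B := by
  rw [sobEnergy, ENNReal.tsum_eq_iSup_sum]
  exact iSup_le fun L => (ofReal_sum_sobWeight hV s L f).symm.le.trans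
    (ENNReal.ofReal_le_ofReal (h L))

lemma sum_sobWeight_le (hV : 2 ≤ Module.finrank ℝ V) {s : ℝ} {f : Lp ℂ 2 (sphereMeasure V)}
    (hf : sobEnergy s f ≠ ∞) (L : Finset ℕ) :
    ∑ l ∈ L, sobWeight V s l * ‖harmProj V l f‖ ^ 2 ≤ (sobEnergy s f).toReal := by
  rw [← ENNReal.ofReal_le_iff_le_toReal hf, ofReal_sum_sobWeight hV]
  exact ENNReal.sum_le_tsum L

lemma toLp_sum {α ι : Type*} [MeasurableSpace α] {μ : Measure α} (s : Finset ι) {f : ι → α → ℂ}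
    (hm : ∀ i, MemLp (f i) 2 μ) (h : MemLp (fun x => ∑ i ∈ s, f i x) 2 μ) :
    h.toLp = ∑ i ∈ s, (hm i).toLp := by
  refine Lp.ext ((MemLp.coeFn_toLp _).trans ?_)
  refine Filter.EventuallyEq.trans ?_ (Lp.coeFn_finsetSum _ _).symm
  have : ∀ᵐ x ∂μ, ∀ i ∈ s, ((hm i).toLp : α → ℂ) x = f i x :=
    s.eventually_all.2 fun i _ => (hm i).coeFn_toLp
  filter_upwards [this] with x hx
  rw [Finset.sum_apply]
  exact (Finset.sum_congr rfl hx).symm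

lemma enorm_toLp_sq {α : Type*} [MeasurableSpace α] {μ : Measure α} {f : α → ℂ}
    (hf : MemLp f 2 μ) : ‖hf.toLp f‖ₑ ^ 2 = ∫⁻ x, ‖f x‖ₑ ^ 2 ∂μ := by
  rw [Lp.enorm_toLp]
  have h := eLpNorm_nnreal_pow_eq_lintegral (f := f) (μ := μ) (p := 2) two_ne_zero
  simpa using h

lemma SmoothHomog.restrict {n : ℕ} {f : V → ℂ} (hf : SmoothHomog n f) (v : V) :
    SmoothHomog n fun w : perp v => f w :=
  ⟨hf.smooth.comp (perp v).subtypeL.contDiff, fun t x => hf.homog t x⟩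

/-- The constant in the trace estimate for polynomials. -/
noncomputable def traceConst (m : ℕ) : ℝ := (2 * m + 5) * (cosWeight m).toReal

lemma traceConst_nonneg (m : ℕ) : 0 ≤ traceConst m := by unfold traceConst; positivity

/-- The trace estimate for a dyadic block of spherical harmonics. -/
lemma norm_trace_block_sq_le {v : USphere V} {m : ℕ} (hm : Module.finrank ℝ V = m + 2)
    {h : ℕ → V → ℂ} (hh : ∀ n, HarmHomog n (h n)) (j : ℕ)
    (hV : ∀ n, MemLp (fun x : USphere V => h n x) 2 (sphereMeasure V))
    (hT : MemLp (fun θ : USphere (perp (v : V)) =>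
      ∑ n ∈ Finset.Ico (2 ^ j) (2 ^ (j + 1)), h n (θ : perp (v : V))) 2 (sphereMeasure (perp (v : V)))) :
    ‖hT.toLp‖ ^ 2 ≤ traceConst m * 2 ^ j *
      ∑ n ∈ Finset.Ico (2 ^ j) (2 ^ (j + 1)), ‖(hV n).toLp‖ ^ 2 := by
  have := nontrivial_of_two_le (V := V) (by omega)
  set I := Finset.Ico (2 ^ j) (2 ^ (j + 1))
  have hS : MemLp (fun x : USphere V => ∑ n ∈ I, h n x) 2 (sphereMeasure V) :=
    memLp_finsetSum I fun n _ => hV n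
  have h1 := lintegral_trace_sq_le v hm (M := 2 ^ (j + 1)) I
    (fun n hn => (Finset.mem_Ico.1 hn).2.le) (fun n => (hh n).toSmoothHomog)
  rw [← enorm_toLp_sq hT, ← enorm_toLp_sq hS] at h1
  have h2 : ‖hS.toLp‖ ^ 2 = ∑ n ∈ I, ‖(hV n).toLp‖ ^ 2 := by
    rw [toLp_sum I hV hS]
    exact norm_sum_sq_of_mem (by omega) I fun n => (hh n).toLp_mem (hV n)
  have h3 := ENNReal.toReal_mono (by
    have := cosWeight_ne_top m
    finiteness) h1
  rw [ENNReal.toReal_mul, ENNReal.toReal_mul, ENNReal.toReal_pow, ENNReal.toReal_pow, toReal_enorm,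
    toReal_enorm, h2] at h3
  refine h3.trans ?_
  have h4 : (2 * (((2 ^ (j + 1) : ℕ) : ℝ≥0∞) + m) + 1 : ℝ≥0∞).toReal = 2 * (2 ^ (j + 1) + m) + 1 := by
    rw [ENNReal.toReal_add (by finiteness) (by finiteness), ENNReal.toReal_mul,
      ENNReal.toReal_add (by finiteness) (by finiteness)]
    simp
  rw [h4, traceConst]
  have h5 : (1 : ℝ) ≤ 2 ^ j := one_le_pow₀ one_le_two
  have h6 : (2 : ℝ) * (2 ^ (j + 1) + m) + 1 ≤ (2 * m + 5) * 2 ^ j := by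
    have : (0 : ℝ) ≤ m := m.cast_nonneg
    rw [pow_succ]
    nlinarith
  have h7 : (0 : ℝ) ≤ ∑ n ∈ I, ‖(hV n).toLp‖ ^ 2 := Finset.sum_nonneg fun _ _ => sq_nonneg _
  calc (2 * (2 ^ (j + 1) + (m : ℝ)) + 1) * (cosWeight m).toReal * ∑ n ∈ I, ‖(hV n).toLp‖ ^ 2
      ≤ ((2 * m + 5) * 2 ^ j) * (cosWeight m).toReal * ∑ n ∈ I, ‖(hV n).toLp‖ ^ 2 :=
        mul_le_mul_of_nonneg_right (mul_le_mul_of_nonneg_right h6 ENNReal.toReal_nonneg) h7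
    _ = _ := by ring

/-- The constant in the Sobolev trace estimate. -/
noncomputable def sobTraceConst (m : ℕ) (s : ℝ) : ℝ :=
  ((m + 1 : ℕ) : ℝ) ^ (s - 1 / 2) * ((2 : ℝ) ^ (s - 1 / 2) / ((2 : ℝ) ^ (s - 1 / 2) - 1)) *
    (((2 : ℝ) ^ (s - 1 / 2)) ^ 2 * traceConst m)

lemma sobTraceConst_nonneg (m : ℕ) {s : ℝ} (hs : 1 / 2 < s) : 0 ≤ sobTraceConst m s := by
  have h := Real.one_lt_rpow one_lt_two (sub_pos.2 hs)
  have := traceConst_nonneg m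
  have : 0 < (2 : ℝ) ^ (s - 1 / 2) - 1 := sub_pos.2 h
  unfold sobTraceConst
  positivity

lemma rpow_pow_comm (s : ℝ) (j : ℕ) : ((2 : ℝ) ^ s) ^ j = ((2 : ℝ) ^ j) ^ s := by
  rw [← Real.rpow_natCast, ← Real.rpow_natCast, ← Real.rpow_mul zero_le_two,
    ← Real.rpow_mul zero_le_two, mul_comm]

lemma dyadic_weight_le (hV : 2 ≤ Module.finrank ℝ V) {s : ℝ} (hs : 1 / 2 < s) {j n : ℕ}
    (hn : 2 ^ j ≤ n) : (((2 : ℝ) ^ (s - 1 / 2)) ^ j) ^ 2 * 2 ^ j ≤ sobWeight V s n := by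
  refine le_trans ?_ (rpow_sq_le_sobWeight hV (by linarith) n)
  have h1 : (((2 : ℝ) ^ (s - 1 / 2)) ^ j) ^ 2 * 2 ^ j = (((2 : ℝ) ^ j) ^ s) ^ 2 := by
    have h2 : (0 : ℝ) < 2 ^ j := by positivity
    rw [rpow_pow_comm, ← Real.rpow_mul_natCast h2.le, ← Real.rpow_mul_natCast h2.le,
      ← Real.rpow_add_one h2.ne']
    congr 1
    push_cast
    ring
  rw [h1]
  have h2 : (2 : ℝ) ^ j ≤ n := by exact_mod_cast hn
  gcongr

/-- The Sobolev trace estimate for polynomials. -/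
theorem sum_sobWeight_trace_le (v : USphere V) {m : ℕ} (hm : Module.finrank ℝ V = m + 2)
    (hm1 : 1 ≤ m) {s : ℝ} (hs : 1 / 2 < s) {h : ℕ → V → ℂ} (hh : ∀ n, HarmHomog n (h n)) (J : ℕ)
    (hV : ∀ n, MemLp (fun x : USphere V => h n x) 2 (sphereMeasure V))
    (hT : MemLp (fun θ : USphere (perp (v : V)) =>
      ∑ n ∈ Finset.Ico 1 (2 ^ J), h n (θ : perp (v : V))) 2 (sphereMeasure (perp (v : V))))
    (L : Finset ℕ) :
    ∑ l ∈ L, sobWeight (perp (v : V)) (s - 1 / 2) l * ‖harmProj (perp (v : V)) l hT.toLp‖ ^ 2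
      ≤ sobTraceConst m s * ∑ n ∈ Finset.Ico 1 (2 ^ J), sobWeight V s n * ‖(hV n).toLp‖ ^ 2 := by
  have := nontrivial_of_two_le (V := V) (by omega)
  have := nontrivial_perp v (by omega)
  have hdim : Module.finrank ℝ (perp (v : V)) = m + 1 := by have := finrank_perp v; omega
  have hd2 : 2 ≤ Module.finrank ℝ (perp (v : V)) := by omega
  set r := s - 1 / 2 with hr
  have hr0 : 0 < r := by rw [hr]; linarith
  set Q : ℝ := 2 ^ r with hQ
  have hQ1 : 1 < Q := Real.one_lt_rpow one_lt_two hr0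
  have hQ0 : 0 < Q - 1 := sub_pos.2 hQ1
  let I : ℕ → Finset ℕ := fun j => Finset.Ico (2 ^ j) (2 ^ (j + 1))
  have hrs : ∀ n, SmoothHomog n fun θ : perp (v : V) => h n θ := fun n =>
    (hh n).toSmoothHomog.restrict v
  have hmn : ∀ n, MemLp (fun θ : USphere (perp (v : V)) => h n (θ : perp (v : V))) 2
      (sphereMeasure (perp (v : V))) := fun n =>
    memLp_of_continuous ((hrs n).smooth.continuous.comp continuous_subtype_val)
  have hB : ∀ j, MemLp (fun θ : USphere (perp (v : V)) =>
      ∑ n ∈ I j, h n (θ : perp (v : V))) 2 (sphereMeasure (perp (v : V))) := fun j =>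
    memLp_finsetSum _ fun n _ => hmn n
  have hsum : hT.toLp = ∑ j ∈ Finset.range J, (hB j).toLp := by
    rw [toLp_sum _ hmn hT, ← sum_range_dyadic]
    exact Finset.sum_congr rfl fun j _ => (toLp_sum _ hmn (hB j)).symm
  let a : ℕ → ℕ → ℝ := fun l j => ‖harmProj (perp (v : V)) l (hB j).toLp‖
  have ha : ∀ l j : ℕ, Q ^ (j + 1) < (l : ℝ) ^ r → a l j = 0 := by
    intro l j hlj
    have h1 : 2 ^ (j + 1) < l := by
      by_contra h2
      have h3 : (l : ℝ) ≤ 2 ^ (j + 1) := by exact_mod_cast not_lt.1 h2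
      rw [hQ, rpow_pow_comm] at hlj
      exact absurd (Real.rpow_le_rpow l.cast_nonneg h3 hr0.le) (not_le.2 hlj)
    change ‖harmProj (perp (v : V)) l (hB j).toLp‖ = 0
    rw [toLp_sum _ hmn (hB j), map_sum, Finset.sum_eq_zero, norm_zero]
    intro n hn
    exact harmProj_smoothHomog_eq_zero hd2 ((Finset.mem_Ico.1 hn).2.trans h1) (hrs n) (hmn n)
  have h1 : ∀ l, sobWeight (perp (v : V)) r l * ‖harmProj (perp (v : V)) l hT.toLp‖ ^ 2
      ≤ ((m + 1 : ℕ) : ℝ) ^ r * (Q / (Q - 1)) *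
        ∑ j ∈ Finset.range J, (Q ^ (j + 1)) ^ 2 * a l j ^ 2 := by
    intro l
    have hnn : 0 ≤ ∑ j ∈ Finset.range J, (Q ^ (j + 1)) ^ 2 * a l j ^ 2 :=
      Finset.sum_nonneg fun j _ => by positivity
    rcases Nat.eq_zero_or_pos l with rfl | hl
    · rw [sobWeight_zero hr0, zero_mul]
      positivity
    have h2 : ‖harmProj (perp (v : V)) l hT.toLp‖ ≤ ∑ j ∈ Finset.range J, a l j := by
      rw [hsum, map_sum]
      exact norm_sum_le _ _
    have h3 : (0 : ℝ) < (l : ℝ) ^ r := Real.rpow_pos_of_pos (by exact_mod_cast hl) r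
    have h4 := sq_mul_sq_sum_le hQ1 h3 J (ha l)
    have h5 := sobWeight_le hd2 hr0 hl
    rw [hdim] at h5
    calc sobWeight (perp (v : V)) r l * ‖harmProj (perp (v : V)) l hT.toLp‖ ^ 2
        ≤ (((m + 1 : ℕ) : ℝ) ^ r * ((l : ℝ) ^ r) ^ 2) * (∑ j ∈ Finset.range J, a l j) ^ 2 := by
          gcongr
      _ = ((m + 1 : ℕ) : ℝ) ^ r * (((l : ℝ) ^ r) ^ 2 * (∑ j ∈ Finset.range J, a l j) ^ 2) := by ring
      _ ≤ ((m + 1 : ℕ) : ℝ) ^ r * (Q / (Q - 1) * ∑ j ∈ Finset.range J, (Q ^ (j + 1)) ^ 2 * a l j ^ 2) := by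
          gcongr
      _ = _ := by ring
  refine (Finset.sum_le_sum fun l _ => h1 l).trans ?_
  rw [← Finset.mul_sum, Finset.sum_comm, sobTraceConst, mul_assoc (((m + 1 : ℕ) : ℝ) ^ r * _)]
  refine mul_le_mul_of_nonneg_left ?_ (by positivity)
  rw [← sum_range_dyadic, Finset.mul_sum]
  refine Finset.sum_le_sum fun j _ => ?_
  rw [← Finset.mul_sum]
  have h2 : ∑ l ∈ L, a l j ^ 2 ≤ ‖(hB j).toLp‖ ^ 2 := sum_norm_harmProj_sq_le hd2 _ L
  have h3 := norm_trace_block_sq_le hm hh j hV (hB j)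
  have htc := traceConst_nonneg m
  calc (Q ^ (j + 1)) ^ 2 * ∑ l ∈ L, a l j ^ 2
      ≤ (Q ^ (j + 1)) ^ 2 * (traceConst m * 2 ^ j * ∑ n ∈ I j, ‖(hV n).toLp‖ ^ 2) := by
        gcongr
        exact h2.trans h3
    _ = Q ^ 2 * traceConst m * ∑ n ∈ I j, ((Q ^ j) ^ 2 * 2 ^ j) * ‖(hV n).toLp‖ ^ 2 := by
        rw [← Finset.mul_sum]; ring
    _ ≤ Q ^ 2 * traceConst m * ∑ n ∈ I j, sobWeight V s n * ‖(hV n).toLp‖ ^ 2 := by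
        gcongr with n hn
        exact dyadic_weight_le (by omega) hs (Finset.mem_Ico.1 hn).1

end Energy

/-! ### Precise representatives of Sobolev functions -/

section Cauchy

open Filter Topology

variable {α : Type*} [MeasurableSpace α] {μ : Measure α}

/-- A sequence with geometric increments in `L²` converges almost everywhere, and every pointwise
limit is also its limit in `L²`. -/
lemma ae_tendsto_of_geometric {u : ℕ → α → ℂ} (hu : ∀ n, MemLp (u n) 2 μ) {B ρ : ℝ}
    (hρ0 : 0 < ρ) (hρ : ρ < 1)
    (h : ∀ n, ‖(hu (n + 1)).toLp - (hu n).toLp‖ ≤ B * ρ ^ n) :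
    (∀ᵐ x ∂μ, ∃ l, Tendsto (fun n => u n x) atTop (𝓝 l)) ∧
    ∀ g : α → ℂ, (∀ᵐ x ∂μ, Tendsto (fun n => u n x) atTop (𝓝 (g x))) →
      ∃ hg : MemLp g 2 μ, Tendsto (fun n => (hu n).toLp) atTop (𝓝 (hg.toLp g)) := by
  have hB : 0 ≤ B := by simpa using (norm_nonneg _).trans (h 0)
  have h1ρ : 0 < 1 - ρ := by linarith
  have hd : ∀ n, dist ((hu n).toLp) ((hu (n + 1)).toLp) ≤ B * ρ ^ n := fun n => by
    rw [dist_comm, dist_eq_norm]; exact h n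
  obtain ⟨F, hF⟩ := cauchySeq_tendsto_of_complete (cauchySeq_of_le_geometric ρ B hρ hd)
  have hdF := fun n => dist_le_of_le_geometric_of_tendsto ρ B hρ hd hF n
  have hsum : ∑' n, ENNReal.ofReal ((2 * (B / (1 - ρ)) + 1) * ρ ^ n) ≠ ∞ :=
    Summable.tsum_ofReal_ne_top ((summable_geometric_of_lt_one hρ0.le hρ).mul_left _)
  have hcau : ∀ N n m : ℕ, N ≤ n → N ≤ m →
      eLpNorm (u n - u m) 2 μ < ENNReal.ofReal ((2 * (B / (1 - ρ)) + 1) * ρ ^ N) := by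
    intro N n m hn hm
    have e1 : ∀ k, N ≤ k → B * ρ ^ k / (1 - ρ) ≤ B / (1 - ρ) * ρ ^ N := fun k hk => by
      rw [div_mul_eq_mul_div]
      exact div_le_div_of_nonneg_right (mul_le_mul_of_nonneg_left
        (pow_le_pow_of_le_one hρ0.le hρ.le hk) hB) h1ρ.le
    have e2 := dist_triangle_right ((hu n).toLp) ((hu m).toLp) F
    have e3 : 0 < ρ ^ N := by positivity
    have e4 := (hdF n).trans (e1 n hn)
    have e5 := (hdF m).trans (e1 m hm)
    have e6 : dist ((hu n).toLp) ((hu m).toLp) < (2 * (B / (1 - ρ)) + 1) * ρ ^ N := by linarith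
    have e7 : eLpNorm (u n - u m) 2 μ = ENNReal.ofReal (dist ((hu n).toLp) ((hu m).toLp)) := by
      rw [← Lp.enorm_toLp ((hu n).sub (hu m)), MemLp.toLp_sub (hu n) (hu m), ← ofReal_norm, dist_eq_norm]
    rw [e7]
    exact (ENNReal.ofReal_lt_ofReal_iff (dist_nonneg.trans_lt e6)).2 e6
  refine ⟨Lp.ae_tendsto_of_cauchy_eLpNorm (fun n => (hu n).1) one_le_two hsum hcau, fun g hg => ?_⟩
  have ht := Lp.cauchy_tendsto_of_tendsto (fun n => (hu n).1) g hsum hcau hg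
  have hgm : MemLp g 2 μ := Lp.memLp_of_cauchy_tendsto one_le_two hu g
    (aestronglyMeasurable_of_tendsto_ae atTop (fun n => (hu n).1) hg) ht
  exact ⟨hgm, (Lp.tendsto_Lp_iff_tendsto_eLpNorm'' u hu g hgm).2 ht⟩

end Cauchy

section Representative

open Filter Topology

variable {V : Type*} [NormedAddCommGroup V] [InnerProductSpace ℝ V] [FiniteDimensional ℝ V]
  [MeasurableSpace V] [BorelSpace V]

lemma harmProj_zero_eq_zero (hV : 2 ≤ Module.finrank ℝ V) {f : Lp ℂ 2 (sphereMeasure V)}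
    (hf : ∫ x, f x ∂sphereMeasure V = 0) : harmProj V 0 f = 0 := by
  have := nontrivial_of_two_le hV
  refine harmProj_eq_zero fun g hg => ?_
  obtain ⟨h, hh, hgh⟩ := mem_sphericalHarmonics_iff.1 hg
  have hc : ∀ x, h x = h 0 := fun x => by simpa using (hh.homog 0 x).symm
  have h1 : inner ℂ g f = ∫ x, starRingEnd ℂ (h 0) * f x ∂sphereMeasure V := by
    rw [L2.inner_def]
    refine integral_congr_ae ?_
    filter_upwards [hgh] with x h1
    rw [h1, RCLike.inner_apply, hc, mul_comm]
  rw [h1, integral_const_mul, hf, mul_zero]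

/-- The harmonic polynomial that represents the component of degree `n` of `f`. -/
noncomputable def harmComp (f : Lp ℂ 2 (sphereMeasure V)) (n : ℕ) : V → ℂ :=
  (mem_sphericalHarmonics_iff.1 (harmProj_mem n f)).choose

lemma harmHomog_harmComp (f : Lp ℂ 2 (sphereMeasure V)) (n : ℕ) : HarmHomog n (harmComp f n) :=
  (mem_sphericalHarmonics_iff.1 (harmProj_mem n f)).choose_spec.1

lemma memLp_harmComp [Nontrivial V] (f : Lp ℂ 2 (sphereMeasure V)) (n : ℕ) :
    MemLp (fun x : USphere V => harmComp f n x) 2 (sphereMeasure V) :=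
  memLp_of_continuous ((harmHomog_harmComp f n).continuous.comp continuous_subtype_val)

lemma toLp_harmComp [Nontrivial V] (f : Lp ℂ 2 (sphereMeasure V)) (n : ℕ) :
    (memLp_harmComp f n).toLp = harmProj V n f :=
  Lp.ext ((memLp_harmComp f n).coeFn_toLp.trans
    (mem_sphericalHarmonics_iff.1 (harmProj_mem n f)).choose_spec.2.symm)

/-- The dyadic partial sums of the expansion in spherical harmonics, over the degrees
`1 ≤ n < 2 ^ J`. The degree zero is left out, as only functions of mean zero are of interest. -/
noncomputable def partialSum (f : Lp ℂ 2 (sphereMeasure V)) (J : ℕ) (x : V) : ℂ :=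
  ∑ n ∈ Finset.Ico 1 (2 ^ J), harmComp f n x

lemma continuous_partialSum (f : Lp ℂ 2 (sphereMeasure V)) (J : ℕ) : Continuous (partialSum f J) :=
  continuous_finsetSum _ fun n _ => (harmHomog_harmComp f n).continuous

/-- The pointwise limit of the dyadic partial sums of `f`. Where they diverge, the value of
`limUnder` does not matter: such points form a null set in the sphere and in each great sphere. -/
noncomputable def preciseRep (f : Lp ℂ 2 (sphereMeasure V)) (x : V) : ℂ :=
  limUnder atTop fun J => partialSum f J x

lemma measurable_preciseRep (f : Lp ℂ 2 (sphereMeasure V)) : Measurable (preciseRep f) :=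
  (StronglyMeasurable.limUnder fun J => (continuous_partialSum f J).stronglyMeasurable).measurable

lemma memLp_partialSum [Nontrivial V] (f : Lp ℂ 2 (sphereMeasure V)) (J : ℕ) :
    MemLp (fun x : USphere V => partialSum f J x) 2 (sphereMeasure V) :=
  memLp_of_continuous ((continuous_partialSum f J).comp continuous_subtype_val)

lemma toLp_partialSum [Nontrivial V] (f : Lp ℂ 2 (sphereMeasure V)) (J : ℕ) :
    (memLp_partialSum f J).toLp = ∑ n ∈ Finset.Ico 1 (2 ^ J), harmProj V n f := by
  simp only [← toLp_harmComp]
  exact toLp_sum _ (memLp_harmComp f) _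

lemma tendsto_toLp_partialSum (hV : 2 ≤ Module.finrank ℝ V) [Nontrivial V]
    {f : Lp ℂ 2 (sphereMeasure V)} (hf : harmProj V 0 f = 0) :
    Tendsto (fun J => (memLp_partialSum f J).toLp) atTop (𝓝 f) := by
  have h1 := ((hasSum_harmProj hV f).tendsto_sum_nat).comp
    (tendsto_pow_atTop_atTop_of_one_lt (one_lt_two : (1 : ℕ) < 2))
  refine h1.congr fun J => ?_
  rw [toLp_partialSum, Function.comp_apply, Finset.range_eq_Ico,
    Finset.sum_eq_sum_Ico_succ_bot (by positivity : 0 < 2 ^ J), hf, zero_add]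

lemma sum_block_le (hV : 2 ≤ Module.finrank ℝ V) {s : ℝ} (hs : 1 / 2 < s)
    {f : Lp ℂ 2 (sphereMeasure V)} (hE : sobEnergy s f ≠ ∞) (J : ℕ) :
    2 ^ J * ∑ n ∈ Finset.Ico (2 ^ J) (2 ^ (J + 1)), ‖harmProj V n f‖ ^ 2
      ≤ (sobEnergy s f).toReal * ((((2 : ℝ) ^ (s - 1 / 2))⁻¹) ^ J) ^ 2 := by
  set Q : ℝ := 2 ^ (s - 1 / 2)
  have hQ : 0 < Q := by positivity
  have h1 := sum_sobWeight_le hV hE (Finset.Ico (2 ^ J) (2 ^ (J + 1)))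
  have h2 : (Q ^ J) ^ 2 * (2 ^ J * ∑ n ∈ Finset.Ico (2 ^ J) (2 ^ (J + 1)), ‖harmProj V n f‖ ^ 2)
      ≤ (sobEnergy s f).toReal := by
    refine le_trans ?_ h1
    rw [← mul_assoc, Finset.mul_sum]
    gcongr with n hn
    exact dyadic_weight_le hV hs (Finset.mem_Ico.1 hn).1
  rw [inv_pow, inv_pow, ← div_eq_mul_inv, le_div_iff₀ (by positivity), mul_comm]
  exact h2

lemma norm_le_of_sq_le {a b c ρ : ℝ} (ha : 0 ≤ a) (hb : 0 ≤ b) (hρ : 0 ≤ ρ)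
    (h : c ^ 2 ≤ a * b * ρ ^ 2) : c ≤ Real.sqrt (a * b) * ρ := by
  refine le_of_sq_le_sq ?_ (by positivity)
  rw [mul_pow, Real.sq_sqrt (by positivity)]
  exact h

lemma partialSum_succ (f : Lp ℂ 2 (sphereMeasure V)) (J : ℕ) (x : V) :
    partialSum f (J + 1) x - partialSum f J x
      = ∑ n ∈ Finset.Ico (2 ^ J) (2 ^ (J + 1)), harmComp f n x := by
  rw [partialSum, partialSum, ← Finset.sum_Ico_consecutive _ Nat.one_le_two_pow
    (Nat.pow_le_pow_right two_pos (Nat.le_succ J)), add_sub_cancel_left]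

lemma inv_two_rpow_mem {s : ℝ} (hs : 1 / 2 < s) :
    0 < ((2 : ℝ) ^ (s - 1 / 2))⁻¹ ∧ ((2 : ℝ) ^ (s - 1 / 2))⁻¹ < 1 :=
  ⟨by positivity, inv_lt_one_of_one_lt₀ (Real.one_lt_rpow one_lt_two (sub_pos.2 hs))⟩

/-- The precise representative of a function of mean zero agrees with it almost everywhere. -/
lemma preciseRep_ae_eq (hV : 2 ≤ Module.finrank ℝ V) {s : ℝ} (hs : 1 / 2 < s)
    {f : Lp ℂ 2 (sphereMeasure V)} (hE : sobEnergy s f ≠ ∞) (hf : harmProj V 0 f = 0) :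
    f =ᵐ[sphereMeasure V] fun x => preciseRep f x := by
  have := nontrivial_of_two_le hV
  obtain ⟨h1, h2⟩ := ae_tendsto_of_geometric (memLp_partialSum f) (inv_two_rpow_mem hs).1
    (inv_two_rpow_mem hs).2 (B := Real.sqrt (1 * (sobEnergy s f).toReal)) fun J => by
      refine norm_le_of_sq_le zero_le_one ENNReal.toReal_nonneg
        (pow_nonneg (inv_two_rpow_mem hs).1.le J) ?_
      rw [one_mul]
      refine le_trans ?_ (sum_block_le hV hs hE J)
      have e : (memLp_partialSum f (J + 1)).toLp - (memLp_partialSum f J).toLp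
          = ∑ n ∈ Finset.Ico (2 ^ J) (2 ^ (J + 1)), harmProj V n f := by
        rw [toLp_partialSum, toLp_partialSum, ← Finset.sum_Ico_consecutive _ Nat.one_le_two_pow
          (Nat.pow_le_pow_right two_pos (Nat.le_succ J)), add_sub_cancel_left]
      rw [e, norm_sum_sq_of_mem hV _ fun n => harmProj_mem n f]
      exact le_mul_of_one_le_left (Finset.sum_nonneg fun _ _ => sq_nonneg _)
        (one_le_pow₀ one_le_two)
  obtain ⟨hg, hlim⟩ := h2 (fun x => preciseRep f x) (h1.mono fun x hx => tendsto_nhds_limUnder hx)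
  exact (Lp.ext_iff.1 (tendsto_nhds_unique (tendsto_toLp_partialSum hV hf) hlim)).trans
    hg.coeFn_toLp

lemma sobEnergy_le_of_tendsto (hV : 2 ≤ Module.finrank ℝ V) {s : ℝ}
    {u : ℕ → Lp ℂ 2 (sphereMeasure V)} {f : Lp ℂ 2 (sphereMeasure V)}
    (hu : Tendsto u atTop (𝓝 f)) {B : ℝ}
    (hB : ∀ n, ∀ L : Finset ℕ, ∑ l ∈ L, sobWeight V s l * ‖harmProj V l (u n)‖ ^ 2 ≤ B) :
    sobEnergy s f ≤ ENNReal.ofReal B := by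
  refine sobEnergy_le hV fun L => le_of_tendsto' (x := atTop) ?_ fun n => hB n L
  refine tendsto_finsetSum _ fun l _ => Tendsto.const_mul _ ?_
  exact ((((harmProj V l).continuous.tendsto f).comp hu).norm).pow 2

lemma ofReal_const_mul_toReal {C : ℝ} (hC : 0 ≤ C) {E : ℝ≥0∞} (hE : E ≠ ∞) :
    ENNReal.ofReal (C * E.toReal) = ENNReal.ofReal C * E := by
  rw [ENNReal.ofReal_mul hC, ENNReal.ofReal_toReal hE]

/-- The precise representative has a trace in the Sobolev space on every great sphere. -/
theorem sobEnergy_preciseRep_le {m : ℕ} (hm : Module.finrank ℝ V = m + 2) (hm1 : 1 ≤ m)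
    {s : ℝ} (hs : 1 / 2 < s) {f : Lp ℂ 2 (sphereMeasure V)} (hE : sobEnergy s f ≠ ∞)
    (v : USphere V) :
    ∃ hg : MemLp (fun θ : USphere (perp (v : V)) => preciseRep f (θ : perp (v : V))) 2
        (sphereMeasure (perp (v : V))),
      sobEnergy (s - 1 / 2) hg.toLp ≤ ENNReal.ofReal (sobTraceConst m s) * sobEnergy s f := by
  have hV : 2 ≤ Module.finrank ℝ V := by omega
  have := nontrivial_of_two_le hV
  have := nontrivial_perp v hV
  have hd2 : 2 ≤ Module.finrank ℝ (perp (v : V)) := by have := finrank_perp v; omega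
  have hmP : ∀ J, MemLp (fun θ : USphere (perp (v : V)) => partialSum f J (θ : perp (v : V))) 2
      (sphereMeasure (perp (v : V))) := fun J => memLp_of_continuous
    ((continuous_partialSum f J).comp (continuous_subtype_val.comp continuous_subtype_val))
  have hmB : ∀ J, MemLp (fun θ : USphere (perp (v : V)) =>
      ∑ n ∈ Finset.Ico (2 ^ J) (2 ^ (J + 1)), harmComp f n (θ : perp (v : V))) 2
      (sphereMeasure (perp (v : V))) := fun J => memLp_of_continuous
    (continuous_finsetSum _ fun n _ => (harmHomog_harmComp f n).continuous.comp
      (continuous_subtype_val.comp continuous_subtype_val))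
  obtain ⟨h1, h2⟩ := ae_tendsto_of_geometric hmP (inv_two_rpow_mem hs).1
    (inv_two_rpow_mem hs).2 (B := Real.sqrt (traceConst m * (sobEnergy s f).toReal)) fun J => by
      refine norm_le_of_sq_le (traceConst_nonneg m) ENNReal.toReal_nonneg
        (pow_nonneg (inv_two_rpow_mem hs).1.le J) ?_
      have e : (hmP (J + 1)).toLp - (hmP J).toLp = (hmB J).toLp := by
        rw [← MemLp.toLp_sub]
        exact MemLp.toLp_congr _ _ (Eventually.of_forall fun θ => partialSum_succ f J _)
      have h3 := norm_trace_block_sq_le hm (harmHomog_harmComp f) J (memLp_harmComp f) (hmB J)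
      simp only [toLp_harmComp] at h3
      rw [e]
      refine h3.trans ?_
      rw [mul_assoc, mul_assoc]
      exact mul_le_mul_of_nonneg_left (sum_block_le hV hs hE J) (traceConst_nonneg m)
  obtain ⟨hg, hlim⟩ := h2 (fun θ => preciseRep f (θ : perp (v : V)))
    (h1.mono fun x hx => tendsto_nhds_limUnder hx)
  refine ⟨hg, ?_⟩
  rw [← ofReal_const_mul_toReal (sobTraceConst_nonneg m hs) hE]
  refine sobEnergy_le_of_tendsto hd2 hlim fun J L => ?_
  have h3 := sum_sobWeight_trace_le v hm hm1 hs (harmHomog_harmComp f) J (memLp_harmComp f) (hmP J) L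
  simp only [toLp_harmComp] at h3
  exact h3.trans (mul_le_mul_of_nonneg_left (sum_sobWeight_le hV hE _) (sobTraceConst_nonneg m hs))

/-! ### Traces of continuous functions -/

/-- The inclusion of a great sphere. -/
def greatIncl (v : V) (θ : USphere (perp v)) : USphere V :=
  ⟨(θ : perp v), mem_sphere_zero_iff_norm.2 (norm_eq_of_mem_sphere θ)⟩

lemma continuous_greatIncl (v : V) : Continuous (greatIncl v) :=
  (continuous_subtype_val.comp continuous_subtype_val).subtype_mk _

lemma exists_zonalKernel [Nontrivial V] {η : ℝ} (hη : 0 < η) :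
    ∃ k : ℝ → ℝ, ZonalKernel V k ∧ ∀ t, k t ≠ 0 → 1 - η < t := by
  let k₀ : ℝ → ℝ := fun t => max 0 (t - (1 - η))
  have hk₀ : Continuous k₀ := by fun_prop
  have hk₀0 : ∀ t, 0 ≤ k₀ t := fun t => le_max_left _ _
  obtain ⟨e⟩ : Nonempty (USphere V) := (NormedSpace.sphere_nonempty.2 zero_le_one).to_subtype
  set I := ∫ x : USphere V, k₀ ⟪(x : V), (e : V)⟫ ∂sphereMeasure V
  have hI : ∀ θ : USphere V, ∫ x : USphere V, k₀ ⟪(x : V), (θ : V)⟫ ∂sphereMeasure V = I := by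
    intro θ
    obtain ⟨g, hg⟩ := exists_sphereIso_apply_eq e θ
    conv_lhs => rw [← map_sphereMeasure g]
    rw [integral_map (sphereIso g).continuous.measurable.aemeasurable
      (Continuous.aestronglyMeasurable (by fun_prop))]
    simp [← hg, I]
  have hcont : Continuous fun x : USphere V => k₀ ⟪(x : V), (e : V)⟫ := by fun_prop
  have hI0 : 0 < I := by
    refine hcont.integral_pos_of_hasCompactSupport_nonneg_nonzero
      (HasCompactSupport.of_compactSpace _) (fun x => hk₀0 _) (x := e) ?_
    rw [real_inner_self_eq_norm_sq, norm_coe_sphere]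
    exact (lt_max_of_lt_right (by linarith)).ne'
  refine ⟨fun t => I⁻¹ * k₀ t, ⟨by fun_prop, fun t => mul_nonneg (inv_nonneg.2 hI0.le) (hk₀0 t),
    fun θ => by rw [integral_const_mul, hI, inv_mul_cancel₀ hI0.ne']⟩, fun t ht => ?_⟩
  by_contra h
  exact ht (by simp [k₀, max_eq_left (by linarith : t - (1 - η) ≤ 0)])

/-- Zonal averages of a continuous function converge uniformly. -/
lemma exists_zonal_close [Nontrivial V] {Ω : USphere V → ℂ} (hΩ : Continuous Ω) {δ : ℝ}
    (hδ : 0 < δ) : ∃ k : ℝ → ℝ, ZonalKernel V k ∧ ∀ θ, ‖Ω θ - zonal k Ω θ‖ ≤ δ := by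
  have huc : UniformContinuous Ω := CompactSpace.uniformContinuous_of_continuous hΩ
  obtain ⟨η, hη, hη'⟩ := Metric.uniformContinuous_iff.1 huc δ hδ
  obtain ⟨k, hk, hk'⟩ := exists_zonalKernel (V := V) (η := η ^ 2 / 2) (by positivity)
  refine ⟨k, hk, fun θ => ?_⟩
  have hkc := hk.continuous
  have h1 : Ω θ - zonal k Ω θ
      = ∫ x : USphere V, (k ⟪(x : V), (θ : V)⟫ : ℂ) * (Ω θ - Ω x) ∂sphereMeasure V := by
    simp only [mul_sub]
    rw [integral_sub (integrable_of_continuous (by fun_prop)) (integrable_of_continuous (by fun_prop)),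
      integral_mul_const, integral_complex_ofReal, hk.integral_eq_one, Complex.ofReal_one, one_mul]
    rfl
  rw [h1]
  refine (norm_integral_le_integral_norm _).trans ?_
  have h2 : δ = ∫ x : USphere V, k ⟪(x : V), (θ : V)⟫ * δ ∂sphereMeasure V := by
    rw [integral_mul_const, hk.integral_eq_one, one_mul]
  conv_rhs => rw [h2]
  refine integral_mono (integrable_of_continuous (by fun_prop)) (integrable_of_continuous (by fun_prop))
    fun x => ?_
  dsimp only
  rw [norm_mul, Complex.norm_real, Real.norm_of_nonneg (hk.nonneg _)]
  by_cases h0 : k ⟪(x : V), (θ : V)⟫ = 0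
  · simp [h0]
  · refine mul_le_mul_of_nonneg_left ?_ (hk.nonneg _)
    rw [← dist_eq_norm]
    refine (hη' ?_).le
    rw [Subtype.dist_eq, dist_eq_norm]
    refine lt_of_pow_lt_pow_left₀ 2 hη.le ?_
    rw [norm_sub_sq_real, norm_coe_sphere, norm_coe_sphere, real_inner_comm]
    linarith [hk' _ h0]

lemma exists_norm_zonal_le [Nontrivial V] {k : ℝ → ℝ} (hk : ZonalKernel V k) :
    ∃ C, 0 ≤ C ∧ ∀ (f : USphere V → ℂ) (hf : MemLp f 2 (sphereMeasure V)) (θ : USphere V),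
      ‖zonal k f θ‖ ≤ C * ‖hf.toLp f‖ := by
  obtain ⟨C, hC⟩ := exists_bound_on_inner (V := V) hk.continuous
  obtain ⟨e⟩ : Nonempty (USphere V) := (NormedSpace.sphere_nonempty.2 zero_le_one).to_subtype
  have hC0 : 0 ≤ C := (norm_nonneg _).trans (hC e e)
  refine ⟨Real.sqrt C, by positivity, fun f hf θ => ?_⟩
  refine le_of_sq_le_sq ?_ (by positivity)
  rw [mul_pow, Real.sq_sqrt hC0, norm_toLp_sq]
  refine (norm_zonal_sq_le hk hf θ).trans ((Complex.re_le_norm _).trans ?_)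
  refine (norm_integral_le_integral_norm _).trans ?_
  have hf2 := hf.integrable_norm_pow two_ne_zero
  rw [← integral_const_mul]
  refine integral_mono (integrable_kernel_mul hk.continuous hf2.ofReal θ).norm (hf2.const_mul C)
    fun x => ?_
  dsimp only
  rw [norm_mul, Complex.norm_real, Complex.norm_real, Real.norm_of_nonneg (sq_nonneg ‖f x‖)]
  exact mul_le_mul_of_nonneg_right (hC x θ) (sq_nonneg _)

/-- A continuous function of mean zero is a uniform limit of polynomials whose components are not
larger than its own: smoothed partial sums of its expansion. -/
lemma exists_polynomial_close (hV : 2 ≤ Module.finrank ℝ V) {Ω : USphere V → ℂ} (hΩ : Continuous Ω)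
    (hm : MemLp Ω 2 (sphereMeasure V)) (h0 : harmProj V 0 hm.toLp = 0) {δ : ℝ} (hδ : 0 < δ) :
    ∃ (J : ℕ) (g : ℕ → V → ℂ), (∀ n, HarmHomog n (g n)) ∧
      (∀ n (hg : MemLp (fun x : USphere V => g n x) 2 (sphereMeasure V)),
        ‖hg.toLp‖ ≤ ‖harmProj V n hm.toLp‖) ∧
      ∀ x : USphere V, ‖Ω x - ∑ n ∈ Finset.Ico 1 (2 ^ J), g n x‖ ≤ δ := by
  have := nontrivial_of_two_le hV
  set f := hm.toLp
  obtain ⟨k, hk, hkΩ⟩ := exists_zonal_close hΩ (half_pos hδ)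
  obtain ⟨C, hC0, hC⟩ := exists_norm_zonal_le hk
  have ht := tendsto_toLp_partialSum hV h0
  obtain ⟨J, hJ⟩ := ((Metric.tendsto_atTop.1 ht) (δ / 2 / (C + 1)) (by positivity))
  have hJ := hJ J le_rfl
  choose g hg hgz using fun n => exists_harmHomog_zonal_eq hV hk (harmHomog_harmComp f n)
  refine ⟨J, g, hg, fun n hgn => ?_, fun x => ?_⟩
  · have hz := memLp_zonal hk.continuous (memLp_harmComp f n)
    have e : hgn.toLp = hz.toLp :=
      MemLp.toLp_congr _ _ (Eventually.of_forall fun θ => (hgz n θ).symm)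
    rw [e, ← toLp_harmComp]
    exact norm_toLp_zonal_le hk _ _
  · have e1 : ∑ n ∈ Finset.Ico 1 (2 ^ J), g n x
        = zonal k (fun y : USphere V => partialSum f J y) x := by
      simp only [partialSum]
      rw [zonal_sum hk.continuous _ fun n => integrable_of_memLp_two (memLp_harmComp f n)]
      exact Finset.sum_congr rfl fun n _ => (hgz n x).symm
    have e2 := zonal_sub hk.continuous (integrable_of_memLp_two hm)
      (integrable_of_memLp_two (memLp_partialSum f J)) x
    have e3 := hC _ (hm.sub (memLp_partialSum f J)) x
    rw [MemLp.toLp_sub hm (memLp_partialSum f J), ← dist_eq_norm, dist_comm] at e3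
    change ‖zonal k (fun y => Ω y - partialSum f J y) x‖ ≤ _ at e3
    rw [e2] at e3
    have e4 : C * dist ((memLp_partialSum f J).toLp) f ≤ δ / 2 := by
      have : (C + 1) * (δ / 2 / (C + 1)) = δ / 2 := by field_simp
      have h5 := mul_le_mul_of_nonneg_left hJ.le (by positivity : 0 ≤ C + 1)
      have h6 : 0 ≤ dist ((memLp_partialSum f J).toLp) f := dist_nonneg
      linarith
    rw [e1]
    have e5 := norm_add_le (Ω x - zonal k Ω x)
      (zonal k Ω x - zonal k (fun y : USphere V => partialSum f J y) x)
    rw [sub_add_sub_cancel] at e5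
    linarith [hkΩ x]

lemma norm_toLp_le_of_norm_le [Nontrivial V] {f : USphere V → ℂ} (hf : MemLp f 2 (sphereMeasure V))
    {δ : ℝ} (hδ : 0 ≤ δ) (h : ∀ x, ‖f x‖ ≤ δ) : ‖hf.toLp f‖ ≤ δ := by
  refine le_of_sq_le_sq ?_ hδ
  rw [norm_toLp_sq]
  refine (integral_mono (hf.integrable_norm_pow two_ne_zero) (integrable_const (δ ^ 2))
    fun x => pow_le_pow_left₀ (norm_nonneg _) (h x) 2).trans ?_
  simp

/-- The restriction of a continuous function to a great sphere satisfies the trace estimate. -/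
theorem sobEnergy_continuous_le {m : ℕ} (hm : Module.finrank ℝ V = m + 2) (hm1 : 1 ≤ m)
    {s : ℝ} (hs : 1 / 2 < s) {Ω : USphere V → ℂ} (hΩ : Continuous Ω)
    (hmem : MemLp Ω 2 (sphereMeasure V)) (hE : sobEnergy s hmem.toLp ≠ ∞)
    (h0 : harmProj V 0 hmem.toLp = 0) (v : USphere V)
    (hg : MemLp (fun θ => Ω (greatIncl (v : V) θ)) 2 (sphereMeasure (perp (v : V)))) :
    sobEnergy (s - 1 / 2) hg.toLp ≤ ENNReal.ofReal (sobTraceConst m s) * sobEnergy s hmem.toLp := by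
  have hV : 2 ≤ Module.finrank ℝ V := by omega
  have := nontrivial_of_two_le hV
  have := nontrivial_perp v hV
  have hd2 : 2 ≤ Module.finrank ℝ (perp (v : V)) := by have := finrank_perp v; omega
  choose J g hgh hgn hgΩ using fun i : ℕ =>
    exists_polynomial_close hV hΩ hmem h0 (δ := (1 : ℝ) / (i + 1)) (by positivity)
  have hgc : ∀ i n, MemLp (fun x : USphere V => g i n x) 2 (sphereMeasure V) := fun i n =>
    memLp_of_continuous ((hgh i n).continuous.comp continuous_subtype_val)
  have hT : ∀ i, MemLp (fun θ : USphere (perp (v : V)) =>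
      ∑ n ∈ Finset.Ico 1 (2 ^ J i), g i n (θ : perp (v : V))) 2 (sphereMeasure (perp (v : V))) :=
    fun i => memLp_of_continuous (continuous_finsetSum _ fun n _ => (hgh i n).continuous.comp
      (continuous_subtype_val.comp continuous_subtype_val))
  have hlim : Tendsto (fun i => (hT i).toLp) atTop (𝓝 hg.toLp) := by
    rw [tendsto_iff_dist_tendsto_zero]
    refine squeeze_zero (fun _ => dist_nonneg) (fun i => ?_) tendsto_one_div_add_atTop_nhds_zero_nat
    rw [dist_comm, dist_eq_norm, ← MemLp.toLp_sub]
    exact norm_toLp_le_of_norm_le _ (by positivity) fun θ => hgΩ i (greatIncl (v : V) θ)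
  rw [← ofReal_const_mul_toReal (sobTraceConst_nonneg m hs) hE]
  refine sobEnergy_le_of_tendsto hd2 hlim fun i L => ?_
  refine (sum_sobWeight_trace_le v hm hm1 hs (hgh i) (J i) (hgc i) (hT i) L).trans
    (mul_le_mul_of_nonneg_left ?_ (sobTraceConst_nonneg m hs))
  refine le_trans ?_ (sum_sobWeight_le hV hE (Finset.Ico 1 (2 ^ J i)))
  refine Finset.sum_le_sum fun n _ => mul_le_mul_of_nonneg_left ?_ (sobWeight_nonneg hV s n)
  exact pow_le_pow_left₀ (norm_nonneg _) (hgn i n (hgc i n)) 2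

end Representative

/-! ### Integrating over all great spheres -/

section Disintegration

variable {V : Type*} [NormedAddCommGroup V] [InnerProductSpace ℝ V] [FiniteDimensional ℝ V]
  [MeasurableSpace V] [BorelSpace V]

lemma measurable_greatProj_comp {X : Type*} [MeasurableSpace X] {a b : X → V} (ha : Measurable a)
    (hb : Measurable b) : Measurable fun x => greatProj (a x) (b x) :=
  measurable_greatProj.comp (ha.prodMk hb)

lemma integral_perp_eq (v : USphere V) (h : 2 ≤ Module.finrank ℝ V) {F : V → ℂ}
    (hF : StronglyMeasurable F) :
    ∫ θ : USphere (perp (v : V)), F (θ : perp (v : V)) ∂sphereMeasure (perp (v : V))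
      = ∫ y : USphere V, F (greatProj (v : V) y) ∂sphereMeasure V := by
  have h1 : Measurable fun y : USphere V => greatProj (v : V) (y : V) :=
    measurable_greatProj_comp measurable_const measurable_subtype_coe
  rw [← integral_map (f := F) (by fun_prop) hF.aestronglyMeasurable, map_perp_eq v h,
    integral_map h1.aemeasurable hF.aestronglyMeasurable]

/-- The averages over great spheres of an integrable function average to its integral. -/
lemma integral_great (h : 2 ≤ Module.finrank ℝ V) {F : V → ℂ} (hF : Measurable F)
    (hI : Integrable (fun x : USphere V => F x) (sphereMeasure V)) :
    Integrable (fun ν : USphere V => ∫ θ : USphere (perp (ν : V)), F (θ : perp (ν : V))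
      ∂sphereMeasure (perp (ν : V))) (sphereMeasure V) ∧
    ∫ ν : USphere V, (∫ θ : USphere (perp (ν : V)), F (θ : perp (ν : V))
      ∂sphereMeasure (perp (ν : V))) ∂sphereMeasure V = ∫ x : USphere V, F x ∂sphereMeasure V := by
  have := nontrivial_of_two_le h
  have hg : Measurable fun p : USphere V × USphere V => greatProj (p.1 : V) (p.2 : V) :=
    measurable_greatProj_comp (by fun_prop) (by fun_prop)
  have hl : ∀ f : V → ℝ≥0∞, Measurable f →
      ∫⁻ p : USphere V × USphere V, f (greatProj (p.1 : V) (p.2 : V))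
        ∂(sphereMeasure V).prod (sphereMeasure V) = ∫⁻ x : USphere V, f x ∂sphereMeasure V := by
    intro f hf
    rw [lintegral_prod _ (show Measurable fun p : USphere V × USphere V =>
      f (greatProj (p.1 : V) (p.2 : V)) from hf.comp hg).aemeasurable, ← lintegral_great h hf]
    exact lintegral_congr fun ν => (lintegral_perp_eq ν h hf).symm
  have hmap : ((sphereMeasure V).prod (sphereMeasure V)).map
      (fun p : USphere V × USphere V => greatProj (p.1 : V) (p.2 : V))
      = (sphereMeasure V).map (fun x : USphere V => (x : V)) := by
    refine Measure.ext_of_lintegral _ fun f hf => ?_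
    rw [lintegral_map hf hg, lintegral_map hf measurable_subtype_coe, hl f hf]
  have hIp : Integrable (fun p : USphere V × USphere V => F (greatProj (p.1 : V) (p.2 : V)))
      ((sphereMeasure V).prod (sphereMeasure V)) := by
    refine ⟨(hF.comp hg).aestronglyMeasurable, ?_⟩
    rw [hasFiniteIntegral_iff_enorm, hl (fun x => ‖F x‖ₑ) (by fun_prop)]
    exact hI.2
  simp only [fun ν : USphere V => integral_perp_eq ν h hF.stronglyMeasurable]
  refine ⟨hIp.integral_prod_left, ?_⟩
  rw [← integral_prod _ hIp, ← integral_map (φ := fun p : USphere V × USphere V =>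
    greatProj (p.1 : V) (p.2 : V)) hg.aemeasurable hF.aestronglyMeasurable, hmap,
    integral_map (by fun_prop) hF.aestronglyMeasurable]

/-- The kernel of the correction term: a multiple of the sine of the angle with cosine `t`,
normalized to have mass one on the unit sphere of a space of dimension `m + 2`, and hence on the
great spheres in dimension `m + 3`. -/
noncomputable def sinKernel (m : ℕ) (t : ℝ) : ℝ :=
  ((cosWeight m)⁻¹ * cosWeight (m + 1)).toReal⁻¹ * √(1 - t ^ 2)

lemma cosWeight_ratio (m : ℕ) :
    (cosWeight m)⁻¹ * cosWeight (m + 1) ≠ 0 ∧ (cosWeight m)⁻¹ * cosWeight (m + 1) ≠ ∞ :=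
  ⟨mul_ne_zero (ENNReal.inv_ne_zero.2 (cosWeight_ne_top m)) (cosWeight_ne_zero _),
    ENNReal.mul_ne_top (ENNReal.inv_ne_top.2 (cosWeight_ne_zero m)) (cosWeight_ne_top _)⟩

lemma sinKernel_nonneg (m : ℕ) (t : ℝ) : 0 ≤ sinKernel m t := by unfold sinKernel; positivity

lemma continuous_sinKernel (m : ℕ) : Continuous (sinKernel m) := by unfold sinKernel; fun_prop

lemma ofReal_sinKernel (m : ℕ) (t : ℝ) : ENNReal.ofReal (sinKernel m t)
    = ((cosWeight m)⁻¹ * cosWeight (m + 1))⁻¹ * ENNReal.ofReal √(1 - t ^ 2) := by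
  rw [sinKernel, ENNReal.ofReal_mul (by positivity), ← ENNReal.toReal_inv,
    ENNReal.ofReal_toReal (ENNReal.inv_ne_top.2 (cosWeight_ratio m).1)]

lemma zonalKernel_sinKernel {m : ℕ} (h : Module.finrank ℝ V = m + 2) :
    ZonalKernel V (sinKernel m) := by
  have hV := nontrivial_of_two_le (V := V) (by omega)
  refine ⟨continuous_sinKernel m, sinKernel_nonneg m, fun θ => ?_⟩
  have := nontrivial_perp θ (by omega)
  have h1 : ∫⁻ x : USphere V, ENNReal.ofReal (√(1 - ⟪(x : V), (θ : V)⟫ ^ 2)) ∂sphereMeasure V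
      = (cosWeight m)⁻¹ * cosWeight (m + 1) := by
    rw [lintegral_sphere_eq_arc θ h (f := fun x => ENNReal.ofReal (√(1 - ⟪x, (θ : V)⟫ ^ 2)))
      (by fun_prop)]
    have h2 : ∀ (ω : USphere (perp (θ : V))) (φ : ℝ), ENNReal.ofReal (|Real.cos φ| ^ m) *
        ENNReal.ofReal (√(1 - ⟪arc (θ : V) (ω : perp (θ : V)) φ, (θ : V)⟫ ^ 2))
        = ENNReal.ofReal (|Real.cos φ| ^ (m + 1)) := fun ω φ => by
      have h3 : ⟪arc (θ : V) (ω : perp (θ : V)) φ, (θ : V)⟫ = Real.sin φ := by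
        rw [arc, inner_add_left, inner_smul_left, inner_smul_left, real_inner_comm, inner_perp,
          real_inner_self_eq_norm_sq, norm_coe_sphere]
        simp
      rw [h3, ← Real.cos_sq', Real.sqrt_sq_eq_abs, ← ENNReal.ofReal_mul (by positivity), pow_succ]
    simp only [h2, lintegral_const, measure_univ, mul_one]
    rfl
  rw [integral_eq_lintegral_of_nonneg_ae (Filter.Eventually.of_forall fun x => sinKernel_nonneg m _)
    ((continuous_sinKernel m).comp (by fun_prop : Continuous fun x : USphere V =>
      ⟪(x : V), (θ : V)⟫)).aestronglyMeasurable]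
  simp only [ofReal_sinKernel]
  rw [lintegral_const_mul _ (by fun_prop), h1, ENNReal.inv_mul_cancel (cosWeight_ratio m).1
    (cosWeight_ratio m).2, ENNReal.toReal_one]

lemma lintegral_perp_perp_eq (ν : USphere V) (h : 2 ≤ Module.finrank ℝ V) {H : V × V → ℝ≥0∞}
    (hH : Measurable H) :
    ∫⁻ θ : USphere (perp (ν : V)), (∫⁻ x : USphere (perp (ν : V)),
      H (((θ : perp (ν : V)) : V), ((x : perp (ν : V)) : V)) ∂sphereMeasure (perp (ν : V)))
      ∂sphereMeasure (perp (ν : V))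
    = ∫⁻ y : USphere V, (∫⁻ z : USphere V, H (greatProj (ν : V) y, greatProj (ν : V) z)
      ∂sphereMeasure V) ∂sphereMeasure V := by
  have := nontrivial_of_two_le h
  have h1 : Measurable fun a : V => ∫⁻ z : USphere V, H (a, greatProj (ν : V) (z : V))
      ∂sphereMeasure V := by
    refine Measurable.lintegral_prod_right' (f := fun p : V × USphere V =>
      H (p.1, greatProj (ν : V) (p.2 : V))) (hH.comp (measurable_fst.prodMk ?_))
    exact measurable_greatProj_comp measurable_const (by fun_prop)
  rw [← lintegral_perp_eq ν h h1]
  refine lintegral_congr fun θ => ?_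
  rw [lintegral_perp_eq ν h (f := fun b => H (((θ : perp (ν : V)) : V), b))
    (hH.comp (measurable_const.prodMk measurable_id))]

lemma integral_perp_perp_eq (ν : USphere V) (h : 2 ≤ Module.finrank ℝ V) {H : V × V → ℂ}
    (hH : Measurable H) :
    ∫ θ : USphere (perp (ν : V)), (∫ x : USphere (perp (ν : V)),
      H (((θ : perp (ν : V)) : V), ((x : perp (ν : V)) : V)) ∂sphereMeasure (perp (ν : V)))
      ∂sphereMeasure (perp (ν : V))
    = ∫ y : USphere V, (∫ z : USphere V, H (greatProj (ν : V) y, greatProj (ν : V) z)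
      ∂sphereMeasure V) ∂sphereMeasure V := by
  have := nontrivial_of_two_le h
  have h1 : StronglyMeasurable fun a : V => ∫ z : USphere V, H (a, greatProj (ν : V) (z : V))
      ∂sphereMeasure V := by
    refine StronglyMeasurable.integral_prod_right' (f := fun p : V × USphere V =>
      H (p.1, greatProj (ν : V) (p.2 : V)))
      (Measurable.stronglyMeasurable (hH.comp (measurable_fst.prodMk ?_)))
    exact measurable_greatProj_comp measurable_const (by fun_prop)
  rw [← integral_perp_eq ν h h1]
  refine integral_congr_ae (Filter.Eventually.of_forall fun θ => ?_)
  exact integral_perp_eq ν h (F := fun b => H (((θ : perp (ν : V)) : V), b))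
    (hH.comp (measurable_const.prodMk measurable_id)).stronglyMeasurable

/-- Two points on the great sphere orthogonal to `q.1`: the directions of the projections of the
two remaining entries. -/
noncomputable def greatPair (q : USphere V × (USphere V × USphere V)) : V × V :=
  (greatProj (q.1 : V) (q.2.1 : V), greatProj (q.1 : V) (q.2.2 : V))

lemma measurable_greatPair : Measurable (greatPair (V := V)) :=
  (measurable_greatProj_comp (by fun_prop) (by fun_prop)).prodMk
    (measurable_greatProj_comp (by fun_prop) (by fun_prop))

lemma lintegral_greatPair {m : ℕ} (h : Module.finrank ℝ V = m + 3) {f : V × V → ℝ≥0∞}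
    (hf : Measurable f) :
    ∫⁻ q, ENNReal.ofReal (sinKernel m ⟪(greatPair q).2, (greatPair q).1⟫) * f (greatPair q)
      ∂(sphereMeasure V).prod ((sphereMeasure V).prod (sphereMeasure V))
    = ∫⁻ p : USphere V × USphere V, f ((p.1 : V), (p.2 : V))
      ∂(sphereMeasure V).prod (sphereMeasure V) := by
  have h2 : 2 ≤ Module.finrank ℝ V := by omega
  have := nontrivial_of_two_le h2
  have hk : Measurable (sinKernel m) := (continuous_sinKernel m).measurable
  have hf' : Measurable fun p : V × V => ENNReal.ofReal (sinKernel m ⟪p.2, p.1⟫) * f p :=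
    (hk.comp (by fun_prop)).ennreal_ofReal.mul hf
  have hq : Measurable fun q => ENNReal.ofReal (sinKernel m ⟪(greatPair (V := V) q).2,
      (greatPair q).1⟫) * f (greatPair q) := hf'.comp measurable_greatPair
  have h3 := lintegral_great_pair h hf
  rw [lintegral_prod _ hq.aemeasurable, lintegral_prod _ (by fun_prop)]
  have h4 : ∀ ν : USphere V, ∫⁻ p : USphere V × USphere V, ENNReal.ofReal
        (sinKernel m ⟪(greatPair (ν, p)).2, (greatPair (ν, p)).1⟫) * f (greatPair (ν, p))
        ∂(sphereMeasure V).prod (sphereMeasure V)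
      = ((cosWeight m)⁻¹ * cosWeight (m + 1))⁻¹ *
        ∫⁻ θ : USphere (perp (ν : V)), (∫⁻ x : USphere (perp (ν : V)),
          ENNReal.ofReal √(1 - ⟪((x : perp (ν : V)) : V), ((θ : perp (ν : V)) : V)⟫ ^ 2) *
          f (((θ : perp (ν : V)) : V), ((x : perp (ν : V)) : V)) ∂sphereMeasure (perp (ν : V)))
          ∂sphereMeasure (perp (ν : V)) := by
    intro ν
    have hν : Measurable fun p : USphere V × USphere V => ENNReal.ofReal
        (sinKernel m ⟪(greatPair (ν, p)).2, (greatPair (ν, p)).1⟫) * f (greatPair (ν, p)) :=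
      hq.comp (measurable_const.prodMk measurable_id)
    rw [lintegral_prod _ hν.aemeasurable]
    refine (lintegral_perp_perp_eq ν h2 hf').symm.trans ?_
    rw [← lintegral_const_mul' _ _ (ENNReal.inv_ne_top.2 (cosWeight_ratio m).1)]
    refine lintegral_congr fun θ => ?_
    rw [← lintegral_const_mul' _ _ (ENNReal.inv_ne_top.2 (cosWeight_ratio m).1)]
    simp only [← mul_assoc, ← ofReal_sinKernel]
  simp only [h4]
  rw [lintegral_const_mul' _ _ (ENNReal.inv_ne_top.2 (cosWeight_ratio m).1), h3, ← mul_assoc,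
    ENNReal.inv_mul_cancel (cosWeight_ratio m).1 (cosWeight_ratio m).2, one_mul]

/-- Pairs of points on great spheres, with the weight given by `sinKernel`, are distributed like
pairs of independent points on the sphere. -/
lemma integral_great_pair {m : ℕ} (h : Module.finrank ℝ V = m + 3) {G : V × V → ℂ}
    (hG : Measurable G) (hI : Integrable (fun p : USphere V × USphere V => G ((p.1 : V), (p.2 : V)))
      ((sphereMeasure V).prod (sphereMeasure V))) :
    Integrable (fun ν : USphere V => ∫ θ : USphere (perp (ν : V)), (∫ x : USphere (perp (ν : V)),
      (sinKernel m ⟪((x : perp (ν : V)) : V), ((θ : perp (ν : V)) : V)⟫ : ℂ) *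
        G (((θ : perp (ν : V)) : V), ((x : perp (ν : V)) : V)) ∂sphereMeasure (perp (ν : V)))
      ∂sphereMeasure (perp (ν : V))) (sphereMeasure V) ∧
    ∫ ν : USphere V, (∫ θ : USphere (perp (ν : V)), (∫ x : USphere (perp (ν : V)),
      (sinKernel m ⟪((x : perp (ν : V)) : V), ((θ : perp (ν : V)) : V)⟫ : ℂ) *
        G (((θ : perp (ν : V)) : V), ((x : perp (ν : V)) : V)) ∂sphereMeasure (perp (ν : V)))
      ∂sphereMeasure (perp (ν : V))) ∂sphereMeasure V
      = ∫ p : USphere V × USphere V, G ((p.1 : V), (p.2 : V))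
        ∂(sphereMeasure V).prod (sphereMeasure V) := by
  have h2 : 2 ≤ Module.finrank ℝ V := by omega
  have := nontrivial_of_two_le h2
  set σ := sphereMeasure V
  have hΦ := measurable_greatPair (V := V)
  have hk : Measurable (sinKernel m) := (continuous_sinKernel m).measurable
  have hK : Measurable fun p : V × V => (sinKernel m ⟪p.2, p.1⟫ : ℂ) * G p :=
    (Complex.measurable_ofReal.comp (hk.comp (by fun_prop))).mul hG
  have hρ : Measurable fun q => ENNReal.ofReal
      (sinKernel m ⟪(greatPair (V := V) q).2, (greatPair q).1⟫) :=
    (hk.comp (by fun_prop : Measurable fun p : V × V => ⟪p.2, p.1⟫)).ennreal_ofReal.comp hΦ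
  have hmap : ((σ.prod (σ.prod σ)).withDensity
      fun q => ENNReal.ofReal (sinKernel m ⟪(greatPair q).2, (greatPair q).1⟫)).map greatPair
      = (σ.prod σ).map fun p : USphere V × USphere V => ((p.1 : V), (p.2 : V)) := by
    refine Measure.ext_of_lintegral _ fun f hf => ?_
    rw [lintegral_map hf hΦ, lintegral_map hf (by fun_prop), ← lintegral_greatPair h hf]
    exact lintegral_withDensity_eq_lintegral_mul _ hρ (hf.comp hΦ)
  have hIp : Integrable (fun q => (sinKernel m ⟪(greatPair q).2, (greatPair q).1⟫ : ℂ) *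
      G (greatPair q)) (σ.prod (σ.prod σ)) := by
    refine ⟨(hK.comp hΦ).aestronglyMeasurable, ?_⟩
    rw [hasFiniteIntegral_iff_enorm]
    have h3 : ∀ q, ‖(sinKernel m ⟪(greatPair q).2, (greatPair (V := V) q).1⟫ : ℂ) * G (greatPair q)‖ₑ
        = ENNReal.ofReal (sinKernel m ⟪(greatPair q).2, (greatPair q).1⟫) * ‖G (greatPair q)‖ₑ :=
      fun q => by
        rw [enorm_mul, ← ofReal_norm (sinKernel m _ : ℂ), Complex.norm_real,
          Real.norm_of_nonneg (sinKernel_nonneg m _)]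
    simp only [h3]
    rw [lintegral_greatPair h (f := fun p => ‖G p‖ₑ) (by fun_prop)]
    exact hI.2
  have hIeq : ∫ q, (sinKernel m ⟪(greatPair q).2, (greatPair q).1⟫ : ℂ) * G (greatPair q)
      ∂σ.prod (σ.prod σ) = ∫ p : USphere V × USphere V, G ((p.1 : V), (p.2 : V)) ∂σ.prod σ := by
    have h3 := integral_withDensity_eq_integral_toReal_smul (μ := σ.prod (σ.prod σ)) hρ
      (Filter.Eventually.of_forall fun _ => ENNReal.ofReal_lt_top) (fun q => G (greatPair q))
    simp only [ENNReal.toReal_ofReal (sinKernel_nonneg m _), Complex.real_smul] at h3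
    rw [← h3, ← integral_map (φ := greatPair) (f := G) hΦ.aemeasurable hG.aestronglyMeasurable, hmap,
      integral_map (by fun_prop) hG.aestronglyMeasurable]
  -- for almost every great sphere the integral over the square is an iterated integral
  have hin : ∀ᵐ ν ∂σ, ∫ p : USphere V × USphere V,
      (sinKernel m ⟪(greatPair (ν, p)).2, (greatPair (ν, p)).1⟫ : ℂ) * G (greatPair (ν, p)) ∂σ.prod σ
      = ∫ θ : USphere (perp (ν : V)), (∫ x : USphere (perp (ν : V)),
      (sinKernel m ⟪((x : perp (ν : V)) : V), ((θ : perp (ν : V)) : V)⟫ : ℂ) *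
        G (((θ : perp (ν : V)) : V), ((x : perp (ν : V)) : V)) ∂sphereMeasure (perp (ν : V)))
      ∂sphereMeasure (perp (ν : V)) := by
    filter_upwards [hIp.prod_right_ae] with ν hν
    rw [integral_prod _ hν]
    exact (integral_perp_perp_eq ν h2 hK).symm
  refine ⟨hIp.integral_prod_left.congr hin, ?_⟩
  rw [← integral_congr_ae hin, ← integral_prod _ hIp, hIeq]

end Disintegration

/-! ### The decomposition of a function into functions on great spheres -/

section Gamma

variable {V : Type*} [NormedAddCommGroup V] [InnerProductSpace ℝ V] [FiniteDimensional ℝ V]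
  [MeasurableSpace V] [BorelSpace V]

lemma sobEnergy_sub_zonal_le (hV : 2 ≤ Module.finrank ℝ V) {k : ℝ → ℝ} (hk : ZonalKernel V k)
    {g : USphere V → ℂ} (hg : MemLp g 2 (sphereMeasure V))
    (hm : MemLp (fun θ => g θ - zonal k g θ) 2 (sphereMeasure V)) (r : ℝ) :
    sobEnergy r hm.toLp ≤ 4 * sobEnergy r hg.toLp := by
  have := nontrivial_of_two_le hV
  have hz := memLp_zonal hk.continuous hg
  rw [sobEnergy, sobEnergy, ← ENNReal.tsum_mul_left]
  refine ENNReal.tsum_le_tsum fun n => ?_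
  have h1 : hm.toLp = hg.toLp - hz.toLp := MemLp.toLp_sub hg hz
  have h2 : ‖harmProj V n hm.toLp‖ₑ ≤ 2 * ‖harmProj V n hg.toLp‖ₑ := by
    rw [h1, map_sub, two_mul]
    refine enorm_sub_le.trans (add_le_add le_rfl ?_)
    rw [← ofReal_norm, ← ofReal_norm]
    exact ENNReal.ofReal_le_ofReal (norm_harmProj_zonal_le hV hk hg hz n)
  calc ENNReal.ofReal (sobWeight V r n) * ‖harmProj V n hm.toLp‖ₑ ^ 2
      ≤ ENNReal.ofReal (sobWeight V r n) * (2 * ‖harmProj V n hg.toLp‖ₑ) ^ 2 := by gcongr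
    _ = 4 * (ENNReal.ofReal (sobWeight V r n) * ‖harmProj V n hg.toLp‖ₑ ^ 2) := by ring

lemma sobEnergy_ne_top {s : ℝ} {f : USphere V → ℂ} (hf : MemSobolevZero V s f) :
    sobEnergy s hf.1.toLp ≠ ∞ := by
  have h := hf.2.1
  rw [sobolevNorm_eq hf.1] at h
  intro h0
  rw [h0] at h
  norm_num at h

lemma harmProj_zero_of_memSobolevZero (hV : 2 ≤ Module.finrank ℝ V) {s : ℝ} {f : USphere V → ℂ}
    (hf : MemSobolevZero V s f) : harmProj V 0 hf.1.toLp = 0 :=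
  harmProj_zero_eq_zero hV ((integral_congr_ae hf.1.coeFn_toLp).trans hf.2.2)

/-- Subtracting the zonal average makes the mean vanish and at most doubles the Sobolev norm. -/
lemma memSobolevZero_sub_zonal (hV : 2 ≤ Module.finrank ℝ V) {k : ℝ → ℝ} (hk : ZonalKernel V k)
    {g : USphere V → ℂ} (hg : MemLp g 2 (sphereMeasure V)) {r : ℝ} (hE : sobEnergy r hg.toLp ≠ ∞) :
    MemSobolevZero V r (fun θ => g θ - zonal k g θ) ∧
      sobolevNorm V r (fun θ => g θ - zonal k g θ) ≤ 2 * sobEnergy r hg.toLp ^ (1 / 2 : ℝ) := by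
  have := nontrivial_of_two_le hV
  have hz := memLp_zonal hk.continuous hg
  have hm : MemLp (fun θ => g θ - zonal k g θ) 2 (sphereMeasure V) := hg.sub hz
  have h1 := sobEnergy_sub_zonal_le hV hk hg hm r
  have h2 : sobolevNorm V r (fun θ => g θ - zonal k g θ) ≤ 2 * sobEnergy r hg.toLp ^ (1 / 2 : ℝ) := by
    rw [sobolevNorm_eq hm]
    refine (ENNReal.rpow_le_rpow h1 (by norm_num)).trans (le_of_eq ?_)
    rw [ENNReal.mul_rpow_of_nonneg _ _ (by norm_num)]
    congr 1
    rw [show (4 : ℝ≥0∞) = 2 ^ (2 : ℝ) by norm_num, ← ENNReal.rpow_mul]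
    norm_num
  refine ⟨⟨hm, h2.trans_lt ?_, ?_⟩, h2⟩
  · exact ENNReal.mul_lt_top (by norm_num) (ENNReal.rpow_lt_top_of_nonneg (by norm_num) hE)
  · rw [integral_sub (integrable_of_memLp_two hg) (integrable_of_memLp_two hz),
      integral_zonal hk (integrable_of_memLp_two hg), sub_self]

/-- The weighted average of `F` over the great sphere orthogonal to `p.1`, around `p.2`. -/
noncomputable def greatCorr (m : ℕ) (F : V → ℂ) (p : V × V) : ℂ :=
  ∫ x : USphere (perp p.1), (sinKernel m ⟪((x : perp p.1) : V), p.2⟫ : ℂ) * F (x : perp p.1)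
    ∂sphereMeasure (perp p.1)

/-- The part of `F` on the great sphere orthogonal to `p.1`, at the point `p.2`. -/
noncomputable def greatPart (m : ℕ) (F : V → ℂ) (p : V × V) : ℂ := F p.2 - greatCorr m F p

lemma greatPart_eq (m : ℕ) (F : V → ℂ) (ν : V) (θ : USphere (perp ν)) :
    greatPart m F (ν, ((θ : perp ν) : V)) = F (θ : perp ν) -
      zonal (sinKernel m) (fun x : USphere (perp ν) => F (x : perp ν)) θ := rfl

/-- The parts of `F` on the great spheres add up to `F`: the corrections contribute the mean
of `F`, which is zero. -/
theorem integral_greatPart {m : ℕ} (h : Module.finrank ℝ V = m + 3) {F : V → ℂ} (hF : Measurable F)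
    (hI : MemLp (fun x : USphere V => F x) 2 (sphereMeasure V))
    (hI' : ∀ ν : USphere V, MemLp (fun θ : USphere (perp (ν : V)) => F (θ : perp (ν : V))) 2
      (sphereMeasure (perp (ν : V))))
    (h0 : ∫ x : USphere V, F x ∂sphereMeasure V = 0) {B : Set (USphere V)} (hB : MeasurableSet B) :
    Integrable (fun ν : USphere V => ∫ θ in greatIncl (ν : V) ⁻¹' B,
      greatPart m F ((ν : V), ((θ : perp (ν : V)) : V)) ∂sphereMeasure (perp (ν : V)))
      (sphereMeasure V) ∧
    ∫ ν : USphere V, (∫ θ in greatIncl (ν : V) ⁻¹' B,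
      greatPart m F ((ν : V), ((θ : perp (ν : V)) : V)) ∂sphereMeasure (perp (ν : V)))
      ∂sphereMeasure V = ∫ x in B, F x ∂sphereMeasure V := by
  have h2 : 2 ≤ Module.finrank ℝ V := by omega
  have := nontrivial_of_two_le h2
  set σ := sphereMeasure V
  -- integration over `B` is integration against its indicator function, extended to `V`
  let b : V → ℂ := indicator (Subtype.val '' B) 1
  have hb : Measurable b :=
    measurable_one.indicator ((MeasurableEmbedding.subtype_coe
      Metric.isClosed_sphere.measurableSet).measurableSet_image.2 hB)
  have hbS : ∀ x : USphere V, b x = indicator B 1 x := fun x => by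
    by_cases hx : x ∈ B
    · rw [indicator_of_mem hx]
      exact indicator_of_mem (mem_image_of_mem _ hx) _
    · rw [indicator_of_notMem hx]
      refine indicator_of_notMem ?_ _
      rintro ⟨y, hy, hyx⟩
      exact hx (Subtype.ext hyx ▸ hy)
  have hb1 : ∀ x, ‖b x‖ ≤ 1 := fun x => by
    by_cases hx : x ∈ Subtype.val '' B <;> simp [b, hx]
  have hbmul : ∀ (x : USphere V) (z : ℂ), b x * z = indicator B (fun _ => z) x := fun x z => by
    rw [hbS]
    by_cases hx : x ∈ B <;> simp [hx]
  have hFI := integrable_of_memLp_two hI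
  have hbF : Integrable (fun x : USphere V => b x * F x) σ :=
    hFI.bdd_mul (c := 1) (hb.comp measurable_subtype_coe).aestronglyMeasurable (Filter.Eventually.of_forall fun x => hb1 x)
  obtain ⟨hA1, hA2⟩ := integral_great h2 (F := fun x => b x * F x) (hb.mul hF) hbF
  have hGI : Integrable (fun p : USphere V × USphere V => b p.1 * F p.2) (σ.prod σ) := by
    have : Integrable (fun x : USphere V => b x) σ :=
      Integrable.of_bound (hb.comp measurable_subtype_coe).aestronglyMeasurable 1 (Filter.Eventually.of_forall fun x => hb1 x)
    exact this.mul_prod hFI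
  obtain ⟨hC1, hC2⟩ := integral_great_pair h (G := fun p => b p.1 * F p.2)
    ((hb.comp measurable_fst).mul (hF.comp measurable_snd)) hGI
  have hC3 : ∫ p : USphere V × USphere V, b p.1 * F p.2 ∂σ.prod σ = 0 := by
    rw [integral_prod_mul (fun x : USphere V => b x) (fun x : USphere V => F x), h0, mul_zero]
  have hsplit : ∀ ν : USphere V, ∫ θ in greatIncl (ν : V) ⁻¹' B,
      greatPart m F ((ν : V), ((θ : perp (ν : V)) : V)) ∂sphereMeasure (perp (ν : V))
      = ∫ θ : USphere (perp (ν : V)), b (θ : perp (ν : V)) * F (θ : perp (ν : V))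
          ∂sphereMeasure (perp (ν : V))
        - ∫ θ : USphere (perp (ν : V)), (∫ x : USphere (perp (ν : V)),
          (sinKernel m ⟪((x : perp (ν : V)) : V), ((θ : perp (ν : V)) : V)⟫ : ℂ) *
          (b (θ : perp (ν : V)) * F (x : perp (ν : V))) ∂sphereMeasure (perp (ν : V)))
          ∂sphereMeasure (perp (ν : V)) := by
    intro ν
    have := nontrivial_perp ν h2
    have hd : Module.finrank ℝ (perp (ν : V)) = m + 2 := by have := finrank_perp ν; omega
    have hk := zonalKernel_sinKernel hd
    have hmB : MeasurableSet (greatIncl (ν : V) ⁻¹' B) :=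
      (continuous_greatIncl (ν : V)).measurable hB
    have hz := memLp_zonal hk.continuous (hI' ν)
    have hbν : ∀ {u : USphere (perp (ν : V)) → ℂ}, MemLp u 2 (sphereMeasure (perp (ν : V))) →
        Integrable (fun θ : USphere (perp (ν : V)) => b (θ : perp (ν : V)) * u θ)
          (sphereMeasure (perp (ν : V))) := fun hu =>
      (integrable_of_memLp_two hu).bdd_mul (c := 1)
        (hb.comp (measurable_subtype_coe.comp measurable_subtype_coe)).aestronglyMeasurable
        (Filter.Eventually.of_forall fun x => hb1 _)
    rw [← integral_indicator hmB]
    have e1 : ∀ θ : USphere (perp (ν : V)), (∫ x : USphere (perp (ν : V)),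
          (sinKernel m ⟪((x : perp (ν : V)) : V), ((θ : perp (ν : V)) : V)⟫ : ℂ) *
          (b (θ : perp (ν : V)) * F (x : perp (ν : V))) ∂sphereMeasure (perp (ν : V)))
        = b (θ : perp (ν : V)) * zonal (sinKernel m)
          (fun x : USphere (perp (ν : V)) => F (x : perp (ν : V))) θ := fun θ => by
      rw [zonal, ← integral_const_mul]
      refine integral_congr_ae (Filter.Eventually.of_forall fun x => ?_)
      simp only [Submodule.coe_inner]
      ring
    simp only [e1]
    rw [← integral_sub (hbν (hI' ν)) (hbν hz)]
    refine integral_congr_ae (Filter.Eventually.of_forall fun θ => ?_)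
    dsimp only
    rw [← mul_sub, ← greatPart_eq]
    refine Eq.trans ?_ (hbmul (greatIncl (ν : V) θ) _).symm
    by_cases hθ : greatIncl (ν : V) θ ∈ B
    · rw [indicator_of_mem (show θ ∈ greatIncl (ν : V) ⁻¹' B from hθ), indicator_of_mem hθ]
    · rw [indicator_of_notMem (show θ ∉ greatIncl (ν : V) ⁻¹' B from hθ), indicator_of_notMem hθ]
  simp only [hsplit]
  dsimp only at hC1 hC2
  refine ⟨hA1.sub hC1, ?_⟩
  rw [integral_sub hA1 hC1, hC2, hC3, sub_zero]
  refine hA2.trans ?_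
  rw [← integral_indicator hB]
  refine integral_congr_ae (Filter.Eventually.of_forall fun x => ?_)
  dsimp only
  rw [hbmul]
  by_cases hx : x ∈ B <;> simp [hx]

open Classical in
/-- The representative of `Ω` which is restricted to great spheres, as a function on `V`. For
continuous functions it is the function itself, so that smoothness is not lost. The value outside
the sphere is irrelevant. -/
noncomputable def bestRep (s : ℝ) (Ω : USphere V → ℂ) : V → ℂ :=
  if h : MemSobolevZero V s Ω ∧ ¬ Continuous Ω then preciseRep (h.1.1.toLp Ω)
  else Function.extend Subtype.val Ω 0

lemma bestRep_of_continuous (s : ℝ) {Ω : USphere V → ℂ} (hΩ : Continuous Ω) (x : USphere V) :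
    bestRep s Ω x = Ω x := by
  rw [bestRep, dif_neg (fun h => h.2 hΩ)]
  exact Subtype.val_injective.extend_apply Ω 0 x

lemma measurable_bestRep (s : ℝ) {Ω : USphere V → ℂ} (hΩ : MemSobolevZero V s Ω) :
    Measurable (bestRep s Ω) := by
  unfold bestRep
  split_ifs with h
  · exact measurable_preciseRep _
  · have hc : Continuous Ω := by
      by_contra hc
      exact h ⟨hΩ, hc⟩
    exact (MeasurableEmbedding.subtype_coe Metric.isClosed_sphere.measurableSet).measurable_extend
      hc.measurable measurable_const

lemma bestRep_ae_eq (hV : 2 ≤ Module.finrank ℝ V) {s : ℝ} (hs : 1 / 2 < s) {Ω : USphere V → ℂ}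
    (hΩ : MemSobolevZero V s Ω) : (fun x : USphere V => bestRep s Ω x) =ᵐ[sphereMeasure V] Ω := by
  by_cases hc : Continuous Ω
  · exact Filter.Eventually.of_forall fun x => bestRep_of_continuous s hc x
  · rw [bestRep, dif_pos ⟨hΩ, hc⟩]
    exact (preciseRep_ae_eq hV hs (sobEnergy_ne_top hΩ)
      (harmProj_zero_of_memSobolevZero hV hΩ)).symm.trans hΩ.1.coeFn_toLp

lemma exists_sobEnergy_bestRep_le {m : ℕ} (hm : Module.finrank ℝ V = m + 2) (hm1 : 1 ≤ m) {s : ℝ}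
    (hs : 1 / 2 < s) {Ω : USphere V → ℂ} (hΩ : MemSobolevZero V s Ω) (v : USphere V) :
    ∃ hg : MemLp (fun θ : USphere (perp (v : V)) => bestRep s Ω (θ : perp (v : V))) 2
        (sphereMeasure (perp (v : V))),
      sobEnergy (s - 1 / 2) hg.toLp ≤
        ENNReal.ofReal (sobTraceConst m s) * sobEnergy s (hΩ.1.toLp Ω) := by
  have hV : 2 ≤ Module.finrank ℝ V := by omega
  have := nontrivial_perp v hV
  by_cases hc : Continuous Ω
  · have e : (fun θ : USphere (perp (v : V)) => bestRep s Ω (θ : perp (v : V)))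
        = fun θ => Ω (greatIncl (v : V) θ) :=
      funext fun θ => bestRep_of_continuous s hc (greatIncl (v : V) θ)
    have hg := memLp_of_continuous (hc.comp (continuous_greatIncl (v : V)))
    simp only [e]
    exact ⟨hg, sobEnergy_continuous_le hm hm1 hs hc hΩ.1 (sobEnergy_ne_top hΩ)
      (harmProj_zero_of_memSobolevZero hV hΩ) v hg⟩
  · rw [bestRep, dif_pos ⟨hΩ, hc⟩]
    exact sobEnergy_preciseRep_le hm hm1 hs (sobEnergy_ne_top hΩ) v

end Gamma

/-! ### Smooth dependence on the great sphere -/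

section Localized

open scoped ContDiff

variable {P : Type} [NormedAddCommGroup P] [NormedSpace ℝ P] [FiniteDimensional ℝ P]
  {Y : Type*} [NormedAddCommGroup Y] [NormedSpace ℝ Y]
  {W : Type*} [NormedAddCommGroup W] [NormedSpace ℝ W]
  {X : Type*} [TopologicalSpace X] [CompactSpace X] [SecondCountableTopology X]
  [MeasurableSpace X] [BorelSpace X] {μ : Measure X} [IsFiniteMeasure μ] {ι : X → Y}

/-- A common bound for the derivatives up to a given order; that it is at least `1` allows one to use
its powers as bounds. -/
lemma exists_bound_iteratedFDeriv {Q : Type*} [NormedAddCommGroup Q] [NormedSpace ℝ Q]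
    {A : Q → W} (hA : ContDiff ℝ ∞ A) {K : Set Q} (hK : IsCompact K) (k : ℕ) :
    ∃ D : ℝ, 1 ≤ D ∧ ∀ q ∈ K, ∀ j ≤ k, ‖iteratedFDeriv ℝ j A q‖ ≤ D := by
  choose c hc using fun j : ℕ => hK.exists_bound_of_continuousOn
    (hA.continuous_iteratedFDeriv (m := j) (by exact_mod_cast le_top)).continuousOn
  refine ⟨1 + ∑ j ∈ Finset.range (k + 1), |c j|, ?_, fun q hq j hj => ?_⟩
  · linarith [Finset.sum_nonneg fun j (_ : j ∈ Finset.range (k + 1)) => abs_nonneg (c j)]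
  · have := Finset.single_le_sum (f := fun j => |c j|) (fun j _ => abs_nonneg (c j))
      (Finset.mem_range.2 (Nat.lt_succ_of_le hj))
    linarith [hc j q hq, le_abs_self (c j)]

lemma norm_iteratedFDeriv_comp_integral_le {k j : ℕ} (hj : j ≤ k) (hι : Continuous ι)
    {A : P × Y → W} (hA : ContDiff ℝ ∞ A) {g : W → ℂ} (hg : ContDiff ℝ k g) {p : P} {B D : ℝ}
    (hB : ∀ x, ∀ i ≤ k, ‖iteratedFDeriv ℝ i g (A (p, ι x))‖ ≤ B) (hD1 : 1 ≤ D)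
    (hD : ∀ x, ∀ i ≤ k, ‖iteratedFDeriv ℝ i A (p, ι x)‖ ≤ D) :
    ‖iteratedFDeriv ℝ j (fun p => ∫ x, (g ∘ A) (p, ι x) ∂μ) p‖
      ≤ (j.factorial * B * D ^ j) * μ.real univ := by
  have hAk : ContDiff ℝ k A := hA.of_le (by exact_mod_cast le_top)
  refine norm_iteratedFDeriv_integral_param_le (H := g ∘ A) hj hι (hg.comp hAk) p fun x => ?_
  refine norm_iteratedFDeriv_comp_le hg hAk (by exact_mod_cast hj) _
    (fun i hi => hB x i (hi.trans hj)) fun i hi1 hi => (hD x i (hi.trans hj)).trans ?_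
  exact le_self_pow₀ hD1 (by omega)

/-- The `C^k` size of a localized integral of `g` is controlled by the `C^k` size of `g` on the set
over which the values of `g` are averaged. -/
lemma exists_bound_smul_integral (hι : Continuous ι) {A : P × Y → W} (hA : ContDiff ℝ ∞ A)
    {χ : P → ℝ} (hχ : ContDiff ℝ ∞ χ) {M : Set P} (hM : IsCompact M) {S : Set W}
    (hS : ∀ p ∈ M, p ∈ tsupport χ → ∀ x, A (p, ι x) ∈ S) (μ : Measure X) [IsFiniteMeasure μ]
    (k : ℕ) :
    ∃ K : ℝ, 0 ≤ K ∧ ∀ g : W → ℂ, ContDiff ℝ k g →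
      ContDiff ℝ k (fun p => χ p • ∫ x, g (A (p, ι x)) ∂μ) ∧
      ∀ B : ℝ, 0 ≤ B → (∀ x ∈ S, ∀ j ≤ k, ‖iteratedFDeriv ℝ j g x‖ ≤ B) →
        ∀ p ∈ M, ∀ j ≤ k,
          ‖iteratedFDeriv ℝ j (fun p => χ p • ∫ x, g (A (p, ι x)) ∂μ) p‖ ≤ K * B := by
  obtain ⟨D, hD1, hD⟩ := exists_bound_iteratedFDeriv hA
    (hM.prod (isCompact_range hι)) k
  obtain ⟨E, hE1, hE⟩ := exists_bound_iteratedFDeriv hχ hM k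
  have hμ : 0 ≤ μ.real univ := measureReal_nonneg
  have hχk : ContDiff ℝ k χ := hχ.of_le (by exact_mod_cast le_top)
  have hAk : ContDiff ℝ k A := hA.of_le (by exact_mod_cast le_top)
  have h0 : ∀ n i : ℕ, 0 ≤ (n.choose i : ℝ) * E * (((n - i).factorial * D ^ (n - i)) * μ.real univ) :=
    fun n i => by positivity
  refine ⟨∑ n ∈ Finset.range (k + 1), ∑ i ∈ Finset.range (n + 1),
    (n.choose i : ℝ) * E * (((n - i).factorial * D ^ (n - i)) * μ.real univ),
    Finset.sum_nonneg fun n _ => Finset.sum_nonneg fun i _ => h0 n i, fun g hg => ?_⟩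
  have hI : ContDiff ℝ k fun p => ∫ x, (g ∘ A) (p, ι x) ∂μ :=
    contDiff_integral_param hι (hg.comp hAk)
  refine ⟨hχk.smul hI, fun B hB0 hB p hp j hj => ?_⟩
  by_cases hpχ : p ∈ tsupport χ
  · have h1 : ‖iteratedFDeriv ℝ j (fun p => χ p • ∫ x, (g ∘ A) (p, ι x) ∂μ) p‖ ≤ _ :=
      norm_iteratedFDeriv_smul_le hχk hI p (by exact_mod_cast hj)
    refine h1.trans ?_
    refine le_trans ?_ (mul_le_mul_of_nonneg_right (Finset.single_le_sum (f := fun n : ℕ =>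
      ∑ i ∈ Finset.range (n + 1),
        (n.choose i : ℝ) * E * (((n - i).factorial * D ^ (n - i)) * μ.real univ))
      (fun n _ => Finset.sum_nonneg fun i _ => h0 n i)
      (Finset.mem_range.2 (Nat.lt_succ_of_le hj))) hB0)
    rw [Finset.sum_mul]
    refine Finset.sum_le_sum fun i hi => ?_
    have hij : i ≤ j := Nat.lt_succ_iff.1 (Finset.mem_range.1 hi)
    have h2 := norm_iteratedFDeriv_comp_integral_le (μ := μ) (j := j - i) (k := k) (by omega) hι hA
      hg (p := p) (B := B) (D := D) (fun x => hB _ (hS p hp hpχ x)) hD1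
      (fun x => hD (p, ι x) ⟨hp, mem_range_self x⟩)
    have h3 := hE p hp i (by omega)
    calc (j.choose i : ℝ) * ‖iteratedFDeriv ℝ i χ p‖ *
          ‖iteratedFDeriv ℝ (j - i) (fun p => ∫ x, (g ∘ A) (p, ι x) ∂μ) p‖
        ≤ (j.choose i : ℝ) * E * (((j - i).factorial * B * D ^ (j - i)) * μ.real univ) := by gcongr
      _ = _ := by ring
  · have h1 : (fun p => χ p • ∫ x, g (A (p, ι x)) ∂μ) =ᶠ[nhds p] fun _ => 0 := by
      filter_upwards [notMem_tsupport_iff_eventuallyEq.1 hpχ] with q hq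
      rw [hq]; simp
    rw [(h1.iteratedFDeriv ℝ j).eq_of_nhds]
    have : iteratedFDeriv ℝ j (fun _ : P => (0 : ℂ)) p = 0 := by simp
    rw [this, norm_zero]
    exact mul_nonneg (Finset.sum_nonneg fun n _ => Finset.sum_nonneg fun i _ => h0 n i) hB0

end Localized

section Frames

open scoped ContDiff

/-- A smooth function that agrees with `t ↦ 1 / t` for `t ≥ 1 / 4`. -/
noncomputable def cutInv (t : ℝ) : ℝ := Real.smoothTransition (8 * t - 1) * t⁻¹

lemma cutInv_of_le {t : ℝ} (ht : 1 / 4 ≤ t) : cutInv t = t⁻¹ := by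
  rw [cutInv, Real.smoothTransition.one_of_one_le (by linarith), one_mul]

lemma contDiff_cutInv : ContDiff ℝ ∞ cutInv := by
  rw [contDiff_iff_contDiffAt]
  intro t
  by_cases ht : t = 0
  · have : cutInv =ᶠ[nhds t] fun _ => 0 := by
      filter_upwards [Iio_mem_nhds (show t < 1 / 8 by rw [ht]; norm_num)] with x hx
      rw [mem_Iio] at hx
      rw [cutInv, Real.smoothTransition.zero_of_nonpos (by linarith), zero_mul]
    exact contDiffAt_const.congr_of_eventuallyEq this
  · exact (Real.smoothTransition.contDiff.contDiffAt.comp t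
      ((contDiffAt_const.mul contDiffAt_id).sub contDiffAt_const)).mul (contDiffAt_id.inv ht)

variable {V : Type*} [NormedAddCommGroup V] [InnerProductSpace ℝ V]

/-- The reflection of `x` in the hyperplane orthogonal to `w`, modified for short vectors `w` to
depend smoothly on `w`. -/
noncomputable def smoothRefl (w x : V) : V := x - (2 * cutInv (‖w‖ ^ 2) * ⟪w, x⟫) • w

lemma contDiff_smoothRefl {Q : Type*} [NormedAddCommGroup Q] [NormedSpace ℝ Q] {w x : Q → V}
    (hw : ContDiff ℝ ∞ w) (hx : ContDiff ℝ ∞ x) : ContDiff ℝ ∞ fun q => smoothRefl (w q) (x q) :=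
  hx.sub (((contDiff_const.mul (contDiff_cutInv.comp (hw.norm_sq ℝ))).mul (hw.inner ℝ hx)).smul hw)

lemma smoothRefl_eq {w : V} (hw : 1 / 2 < ‖w‖) (x : V) :
    smoothRefl w x = (Submodule.span ℝ {w})ᗮ.reflection x := by
  rw [smoothRefl, cutInv_of_le (by nlinarith), Submodule.reflection_orthogonal_apply,
    Submodule.reflection_singleton_apply, neg_sub, ← Nat.cast_smul_eq_nsmul ℝ, smul_smul]
  congr 2
  simp only [RCLike.ofReal_real_eq_id, id, Nat.cast_ofNat]
  ring

/-- The second of the two vectors in which to reflect in order to take the orthonormal pair `q` to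
the pair `p`; the first one is `q.1 - p.1`, and takes `q.1` to `p.1`. -/
noncomputable def frameVec (q p : V × V) : V := smoothRefl (q.1 - p.1) q.2 - p.2

/-- The image of `y` under a linear map which takes the orthonormal pair `q` to the orthonormal
pair `p` and depends smoothly on `p`, as long as `p` belongs to `frameDomain q`. -/
noncomputable def frameMap (q p : V × V) (y : V) : V :=
  smoothRefl (frameVec q p) (smoothRefl (q.1 - p.1) y)

/-- The set of pairs for which `frameMap q` is an isometry: those that are reached from `q` by two
reflections in vectors that are not too short. -/
def frameDomain (q : V × V) : Set (V × V) := {p | 1 / 2 < ‖q.1 - p.1‖ ∧ 1 / 2 < ‖frameVec q p‖}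

lemma contDiff_frameVec (q : V × V) : ContDiff ℝ ∞ (frameVec q) :=
  (contDiff_smoothRefl (contDiff_const.sub contDiff_fst) contDiff_const).sub contDiff_snd

lemma contDiff_frameMap (q : V × V) :
    ContDiff ℝ ∞ fun r : (V × V) × V => frameMap q r.1 r.2 :=
  contDiff_smoothRefl ((contDiff_frameVec q).comp contDiff_fst)
    (contDiff_smoothRefl (contDiff_const.sub (contDiff_fst.comp contDiff_fst)) contDiff_snd)

lemma isOpen_frameDomain (q : V × V) : IsOpen (frameDomain q) :=
  (isOpen_lt continuous_const (continuous_const.sub continuous_fst).norm).inter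
    (isOpen_lt continuous_const (contDiff_frameVec q).continuous.norm)

variable [FiniteDimensional ℝ V]

lemma exists_isometry_eq_frameMap {q p : V × V} (hq : q ∈ orthoSet V) (hp : p ∈ orthoSet V)
    (h : p ∈ frameDomain q) :
    ∃ e : V ≃ₗᵢ[ℝ] V, e q.1 = p.1 ∧ e q.2 = p.2 ∧ ∀ y, frameMap q p y = e y := by
  obtain ⟨hp1, hp2, hp3⟩ := hp
  obtain ⟨hq1, hq2, hq3⟩ := hq
  obtain ⟨hd1, hd2⟩ := h
  let e₁ := (Submodule.span ℝ {q.1 - p.1})ᗮ.reflection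
  have h1 : e₁ q.1 = p.1 := Submodule.reflection_sub (by rw [hp1, hq1])
  have hw : frameVec q p = e₁ q.2 - p.2 := by rw [frameVec, smoothRefl_eq hd1]
  let e₂ := (Submodule.span ℝ {frameVec q p})ᗮ.reflection
  have h2 : e₂ (e₁ q.2) = p.2 := by
    simp only [e₂, hw]
    exact Submodule.reflection_sub (by rw [e₁.norm_map, hp2, hq2])
  have h3 : e₂ p.1 = p.1 := by
    refine Submodule.reflection_mem_subspace_eq_self ?_
    rw [Submodule.mem_orthogonal_singleton_iff_inner_left, hw, inner_sub_right, hp3, ← h1,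
      e₁.inner_map_map, hq3, sub_zero]
  refine ⟨e₁.trans e₂, by simp [h1, h3], by simp [h2], fun y => ?_⟩
  rw [frameMap, smoothRefl_eq hd1, smoothRefl_eq hd2]
  rfl

/-- For the antipodal pair `-p` both reflection vectors have length `2`, so the domains cover all
orthonormal pairs. -/
lemma mem_frameDomain_neg {p : V × V} (hp : p ∈ orthoSet V) : p ∈ frameDomain (-p) := by
  obtain ⟨hp1, hp2, hp3⟩ := hp
  have h1 : (-p).1 - p.1 = (-2 : ℝ) • p.1 := by
    rw [Prod.fst_neg, neg_smul, two_smul]; abel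
  have h2 : frameVec (-p) p = (-2 : ℝ) • p.2 := by
    rw [frameVec, h1, smoothRefl, inner_smul_left, Prod.snd_neg, inner_neg_right, hp3]
    simp only [neg_zero, mul_zero, zero_smul, neg_smul, two_smul]
    abel
  refine ⟨?_, ?_⟩
  · rw [h1, norm_smul, hp1]; norm_num
  · rw [h2, norm_smul, hp2]; norm_num

lemma neg_mem_orthoSet {p : V × V} (hp : p ∈ orthoSet V) : -p ∈ orthoSet V :=
  ⟨by simp [hp.1], by simp [hp.2.1], by simp [hp.2.2]⟩

end Frames

/-! ### The parts of functions of class `C^k` -/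

section GreatPartCk

open scoped ContDiff Manifold

variable {V : Type} [NormedAddCommGroup V] [InnerProductSpace ℝ V] [FiniteDimensional ℝ V]
  [MeasurableSpace V] [BorelSpace V]

/-- The correction term at any orthonormal pair is an integral over the great sphere of a fixed
pair. -/
lemma greatCorr_eq_integral_isometry (h : 2 ≤ Module.finrank ℝ V) (m : ℕ) {g : V → ℂ}
    (hg : Continuous g) {q p : V × V} (hq : q ∈ orthoSet V) (e : V ≃ₗᵢ[ℝ] V) (h1 : e q.1 = p.1)
    (h2 : e q.2 = p.2) :
    greatCorr m g p = ∫ x : USphere (perp q.1),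
      (sinKernel m ⟪((x : perp q.1) : V), q.2⟫ : ℂ) * g (e (x : perp q.1))
        ∂sphereMeasure (perp q.1) := by
  have hq1 : ‖q.1‖ = 1 := hq.1
  let v : USphere V := ⟨q.1, mem_sphere_zero_iff_norm.2 hq1⟩
  let w : USphere V := ⟨p.1, mem_sphere_zero_iff_norm.2 (by rw [← h1, e.norm_map, hq1])⟩
  have hk := continuous_sinKernel m
  have hF : Continuous fun x : V => (sinKernel m ⟪x, p.2⟫ : ℂ) * g x := by fun_prop
  have hF' : Continuous fun x : V => (sinKernel m ⟪x, q.2⟫ : ℂ) * g (e x) :=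
    (Complex.continuous_ofReal.comp (hk.comp (by fun_prop))).mul (hg.comp e.continuous)
  refine (integral_perp_eq w h hF.measurable.stronglyMeasurable).trans ?_
  refine Eq.trans ?_ (integral_perp_eq v h hF'.measurable.stronglyMeasurable).symm
  conv_lhs => rw [← map_sphereMeasure e]
  refine ((sphereIso e).toHomeomorph.measurableEmbedding.integral_map _).trans ?_
  refine integral_congr_ae (Filter.Eventually.of_forall fun y => ?_)
  change (sinKernel m ⟪greatProj p.1 (e y), p.2⟫ : ℂ) * g (greatProj p.1 (e y)) = _
  rw [← h1, ← h2, ← map_greatProj, e.inner_map_map]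

/-- The uniform measure on the great sphere orthogonal to `q.1`, weighted by `sinKernel`. -/
noncomputable def sinMeasure (m : ℕ) (q : V × V) : Measure (USphere (perp q.1)) :=
  (sphereMeasure (perp q.1)).withDensity
    fun x => ENNReal.ofReal (sinKernel m ⟪((x : perp q.1) : V), q.2⟫)

lemma continuous_kernel (m : ℕ) (q : V × V) :
    Continuous fun x : USphere (perp q.1) => sinKernel m ⟪((x : perp q.1) : V), q.2⟫ :=
  (continuous_sinKernel m).comp (by fun_prop)

lemma isFiniteMeasure_sinMeasure (h : 2 ≤ Module.finrank ℝ V) (m : ℕ) {q : V × V}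
    (hq : ‖q.1‖ = 1) : IsFiniteMeasure (sinMeasure m q) := by
  have := nontrivial_perp (⟨q.1, mem_sphere_zero_iff_norm.2 hq⟩ : USphere V) h
  change Nontrivial (perp q.1) at this
  exact isFiniteMeasure_withDensity_ofReal (integrable_of_continuous (continuous_kernel m q)).2

lemma integral_sinMeasure (m : ℕ) (q : V × V) (f : USphere (perp q.1) → ℂ) :
    ∫ x, f x ∂sinMeasure m q = ∫ x : USphere (perp q.1),
      (sinKernel m ⟪((x : perp q.1) : V), q.2⟫ : ℂ) * f x ∂sphereMeasure (perp q.1) := by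
  rw [sinMeasure, integral_withDensity_eq_integral_toReal_smul
    (continuous_kernel m q).measurable.ennreal_ofReal
    (Filter.Eventually.of_forall fun _ => ENNReal.ofReal_lt_top)]
  simp only [ENNReal.toReal_ofReal (sinKernel_nonneg m _), Complex.real_smul]

/-- A smooth partition of unity on the manifold of orthonormal pairs, subordinate to a finite cover by
domains of frames. -/
lemma exists_partition_frameDomain (V : Type) [NormedAddCommGroup V] [InnerProductSpace ℝ V]
    [FiniteDimensional ℝ V] [MeasurableSpace V] [BorelSpace V] :
    ∃ (J : Type) (_ : Fintype J) (q : J → V × V) (χ : J → V × V → ℝ), (∀ i, q i ∈ orthoSet V) ∧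
      (∀ i, ContDiff ℝ ∞ (χ i)) ∧ (∀ i, tsupport (χ i) ⊆ frameDomain (q i)) ∧
      ∀ p ∈ orthoSet V, ∑ i, χ i p = 1 := by
  obtain ⟨t, ht1, ht2⟩ := isCompact_orthoSet.elim_nhds_subcover (fun p : V × V => frameDomain (-p))
    fun p hp => (isOpen_frameDomain _).mem_nhds (mem_frameDomain_neg hp)
  obtain ⟨f, hf⟩ := SmoothPartitionOfUnity.exists_isSubordinate (I := 𝓘(ℝ, V × V))
    isCompact_orthoSet.isClosed (fun i : t => frameDomain (-(i : V × V)))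
    (fun i => isOpen_frameDomain _) (fun p hp => by
      obtain ⟨i, hi, hpi⟩ := mem_iUnion₂.1 (ht2 hp)
      exact mem_iUnion.2 ⟨⟨i, hi⟩, hpi⟩)
  refine ⟨t, inferInstance, fun i => -(i : V × V), fun i => f i,
    fun i => neg_mem_orthoSet (ht1 i i.2), fun i => (f i).contMDiff.contDiff, hf, fun p hp => ?_⟩
  rw [← finsum_eq_sum_of_fintype]
  exact f.sum_eq_one hp

/-- The great sphere parts of `C^k` functions are `C^k`, with control of the derivatives. -/
lemma exists_bound_greatPart (h : 2 ≤ Module.finrank ℝ V) (m k : ℕ) :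
    ∃ K : ℝ, 0 < K ∧ ∀ g : V → ℂ, ContDiff ℝ k g → ∃ G : V × V → ℂ, ContDiff ℝ k G ∧
      (∀ p ∈ orthoSet V, G p = greatPart m g p) ∧
      ∀ B : ℝ, 0 ≤ B → (∀ x ∈ Metric.sphere (0 : V) 1, ∀ j ≤ k, ‖iteratedFDeriv ℝ j g x‖ ≤ B) →
        ∀ p ∈ orthoSet V, ∀ j ≤ k, ‖iteratedFDeriv ℝ j G p‖ ≤ K * B := by
  obtain ⟨J, _, q, χ, hq, hχ, hsub, hsum⟩ := exists_partition_frameDomain V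
  have hι : ∀ i, Continuous fun x : USphere (perp (q i).1) => ((x : perp (q i).1) : V) :=
    fun i => by fun_prop
  have hfin : ∀ i : J, IsFiniteMeasure (sinMeasure m (q i)) := fun i =>
    isFiniteMeasure_sinMeasure h m (hq i).1
  have hS : ∀ i : J, ∀ p ∈ orthoSet V, p ∈ tsupport (χ i) →
      ∀ x : USphere (perp (q i).1),
        frameMap (q i) p (x : perp (q i).1) ∈ Metric.sphere (0 : V) 1 := by
    intro i p hp hpi x
    obtain ⟨e, -, -, he⟩ := exists_isometry_eq_frameMap (hq i) hp (hsub i hpi)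
    rw [he, mem_sphere_zero_iff_norm, e.norm_map]
    exact norm_eq_of_mem_sphere x
  choose K hK0 hK using fun i : J => exists_bound_smul_integral (hι i)
    (contDiff_frameMap (q i)) (hχ i) isCompact_orthoSet (hS i) (sinMeasure m (q i)) k
  refine ⟨1 + ∑ i, K i, by have := Finset.sum_nonneg fun i (_ : i ∈ Finset.univ) => hK0 i; linarith,
    fun g hg => ?_⟩
  have hI : ∀ i, ContDiff ℝ k _ := fun i => (hK i g hg).1
  have hsnd : ContDiff ℝ k (g ∘ ContinuousLinearMap.snd ℝ V V) := hg.comp contDiff_snd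
  refine ⟨fun p => (g ∘ ContinuousLinearMap.snd ℝ V V) p - ∑ i, χ i p • ∫ x : USphere (perp (q i).1),
    g (frameMap (q i) p (x : perp (q i).1)) ∂sinMeasure m (q i),
    hsnd.sub (ContDiff.sum fun i _ => hI i), fun p hp => ?_, fun B hB0 hB p hp j hj => ?_⟩
  -- every chart whose bump function does not vanish at `p` gives the same correction
  · have h1 : ∀ i : J, χ i p • ∫ x : USphere (perp (q i).1),
        g (frameMap (q i) p (x : perp (q i).1)) ∂sinMeasure m (q i)
        = (χ i p : ℂ) * greatCorr m g p := by
      intro i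
      rw [Complex.real_smul]
      by_cases h0 : χ i p = 0
      · simp [h0]
      · obtain ⟨e, he1, he2, he⟩ := exists_isometry_eq_frameMap (hq i) hp
          (hsub i (subset_tsupport _ h0))
        rw [integral_sinMeasure, greatCorr_eq_integral_isometry h m hg.continuous (hq i) e
          he1 he2]
        simp only [he]
    simp only [h1]
    rw [← Finset.sum_mul, ← Complex.ofReal_sum, hsum p hp, Complex.ofReal_one, one_mul]
    rfl
  · have hjk : (j : WithTop ℕ∞) ≤ k := by exact_mod_cast hj
    rw [fun_iteratedFDeriv_sub_apply (hsnd.of_le hjk).contDiffAt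
      ((ContDiff.sum fun i _ => (hI i).of_le hjk).contDiffAt),
      iteratedFDeriv_fun_sum_apply fun i _ => ((hI i).of_le hjk).contDiffAt]
    refine (norm_sub_le _ _).trans ?_
    rw [add_mul, one_mul, Finset.sum_mul]
    refine add_le_add ?_ ((norm_sum_le _ _).trans (Finset.sum_le_sum fun i _ =>
      (hK i g hg).2 B hB0 hB p hp j hj))
    rw [ContinuousLinearMap.iteratedFDeriv_comp_right _ hg p hjk]
    refine (ContinuousMultilinearMap.norm_compContinuousLinearMap_le _ _).trans ?_
    rw [Finset.prod_const, Finset.card_univ, Fintype.card_fin]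
    refine (mul_le_of_le_one_right (norm_nonneg _) (pow_le_one₀ (norm_nonneg _)
      (ContinuousLinearMap.norm_snd_le ℝ V V))).trans ?_
    exact hB p.2 (mem_sphere_zero_iff_norm.2 hp.2.1) j hj

lemma greatPart_congr (m : ℕ) {u g : V → ℂ} (hug : ∀ x, ‖x‖ = 1 → u x = g x) {p : V × V}
    (hp : p ∈ orthoSet V) : greatPart m u p = greatPart m g p := by
  unfold greatPart greatCorr
  rw [hug _ hp.2.1]
  congr 1
  refine integral_congr_ae (Filter.Eventually.of_forall fun x => ?_)
  exact congrArg _ (hug ((x : perp p.1) : V) (norm_eq_of_mem_sphere x))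

lemma greatPart_sub (h : 2 ≤ Module.finrank ℝ V) (m : ℕ) {u v : V → ℂ}
    (hu : Continuous fun x : USphere V => u x) (hv : Continuous fun x : USphere V => v x) {p : V × V}
    (hp : p ∈ orthoSet V) :
    greatPart m (fun x => u x - v x) p = greatPart m u p - greatPart m v p := by
  have := nontrivial_perp (⟨p.1, mem_sphere_zero_iff_norm.2 hp.1⟩ : USphere V) h
  change Nontrivial (perp p.1) at this
  have hk : Continuous fun x : USphere (perp p.1) =>
      (sinKernel m ⟪((x : perp p.1) : V), p.2⟫ : ℂ) :=
    Complex.continuous_ofReal.comp (continuous_kernel m p)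
  have hI : ∀ {w : V → ℂ}, Continuous (fun x : USphere V => w x) →
      Integrable (fun x : USphere (perp p.1) =>
        (sinKernel m ⟪((x : perp p.1) : V), p.2⟫ : ℂ) * w (x : perp p.1))
        (sphereMeasure (perp p.1)) := fun hw =>
    integrable_of_continuous (hk.mul (hw.comp (continuous_greatIncl p.1)))
  simp only [greatPart, greatCorr, mul_sub]
  rw [integral_sub (hI hu) (hI hv)]
  ring

lemma IsCk.continuous {E : Type*} [NormedAddCommGroup E] [NormedSpace ℝ E] {M : Set E} {k : ℕ}
    {f : M → ℂ} (hf : IsCk k f) : Continuous f := by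
  obtain ⟨g, hg, hgf⟩ := hf
  exact (hg.continuous.comp continuous_subtype_val).congr hgf

/-- Taking the parts on great spheres is bounded for the `C^k` norms. -/
theorem exists_ckNorm_greatPart_le (h : 2 ≤ Module.finrank ℝ V) (m k : ℕ) :
    ∃ K : ℝ, 0 < K ∧ ∀ (Ω : USphere V → ℂ) (u : V → ℂ), (∀ x : USphere V, u x = Ω x) →
      (IsCk k Ω → IsCk k fun p : orthoSet V => greatPart m u p) ∧
      ckNorm k (fun p : orthoSet V => greatPart m u p) ≤ ENNReal.ofReal K * ckNorm k Ω := by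
  obtain ⟨K, hK0, hK⟩ := exists_bound_greatPart h m k
  refine ⟨K, hK0, fun Ω u hu => ?_⟩
  have hext : ∀ g : V → ℂ, (∀ x : USphere V, g x = Ω x) → ∀ p ∈ orthoSet V,
      greatPart m g p = greatPart m u p := fun g hg p hp =>
    greatPart_congr m (fun x hx => (hg ⟨x, mem_sphere_zero_iff_norm.2 hx⟩).trans
      (hu ⟨x, mem_sphere_zero_iff_norm.2 hx⟩).symm) hp
  refine ⟨fun ⟨g, hg, hgΩ⟩ => ?_, ?_⟩
  · obtain ⟨G, hG, hG1, -⟩ := hK g hg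
    exact ⟨G, hG, fun p => (hG1 p p.2).trans (hext g hgΩ p p.2)⟩
  · rw [ckNorm, ckNorm]
    simp only [ENNReal.mul_iInf_of_ne (ENNReal.ofReal_pos.2 hK0).ne' ENNReal.ofReal_ne_top]
    refine le_iInf₂ fun g ⟨hg, hgΩ⟩ => ?_
    obtain ⟨G, hG, hG1, hG2⟩ := hK g hg
    refine (iInf₂_le G ⟨hG, fun p => (hG1 p p.2).trans (hext g hgΩ p p.2)⟩).trans ?_
    set N := ⨆ (x : USphere V) (j : ℕ) (_ : j ≤ k), ‖iteratedFDeriv ℝ j g (x : V)‖ₑ with hN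
    by_cases hNtop : N = ⊤
    · rw [hNtop, ENNReal.mul_top (ENNReal.ofReal_pos.2 hK0).ne']
      exact le_top
    · refine iSup_le fun p => iSup₂_le fun j hj => ?_
      rw [← ofReal_norm, ← ENNReal.ofReal_toReal hNtop, ← ENNReal.ofReal_mul hK0.le]
      refine ENNReal.ofReal_le_ofReal (hG2 _ ENNReal.toReal_nonneg (fun x hx i hi => ?_) p p.2 j hj)
      rw [← ENNReal.ofReal_le_iff_le_toReal hNtop, ofReal_norm, hN]
      exact le_iSup_of_le (⟨x, hx⟩ : USphere V) (le_iSup₂_of_le i hi le_rfl)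

end GreatPartCk

end GreatSphere

open MeasureTheory GreatSphere in
theorem proposition5p3 (d : ℕ) (hd : 3 ≤ d) (s : ℝ) (hs : 1 / 2 < s) :
    ∃ (C : ℝ) (Γ : (USphere (Euc d) → ℂ) → orthoPairs d → ℂ), 0 < C ∧
      (∀ Ω : USphere (Euc d) → ℂ, MemSobolevZero (Euc d) s Ω →
        (∀ ν : USphere (Euc d),
          MemSobolevZero (hyperplane ν) (s - 1 / 2) (fun θ => Γ Ω (pair ν θ)) ∧
          sobolevNorm (hyperplane ν) (s - 1 / 2) (fun θ => Γ Ω (pair ν θ)) ≤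
            ENNReal.ofReal C * sobolevNorm (Euc d) s Ω) ∧
        (∀ B : Set (USphere (Euc d)), MeasurableSet B →
          Integrable
            (fun ν => ∫ θ in incl ν ⁻¹' B, Γ Ω (pair ν θ) ∂(sphereMeasure (hyperplane ν)))
            (sphereMeasure (Euc d)) ∧
          ∫ θ in B, Ω θ ∂(sphereMeasure (Euc d)) =
            ∫ ν, ∫ θ in incl ν ⁻¹' B, Γ Ω (pair ν θ) ∂(sphereMeasure (hyperplane ν))
              ∂(sphereMeasure (Euc d)))) ∧
      (∀ k : ℕ,
        (∀ Ω : USphere (Euc d) → ℂ, IsCk k Ω → ∫ θ, Ω θ ∂(sphereMeasure (Euc d)) = 0 →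
          IsCk k (Γ Ω)) ∧
        (∀ Ω₀ : USphere (Euc d) → ℂ, IsCk k Ω₀ → ∫ θ, Ω₀ θ ∂(sphereMeasure (Euc d)) = 0 →
          ∀ ε : ENNReal, 0 < ε → ∃ δ : ENNReal, 0 < δ ∧
            ∀ Ω : USphere (Euc d) → ℂ, IsCk k Ω → ∫ θ, Ω θ ∂(sphereMeasure (Euc d)) = 0 →
              ckNorm k (fun θ => Ω θ - Ω₀ θ) < δ →
                ckNorm k (fun p => Γ Ω p - Γ Ω₀ p) < ε)) := by
  obtain ⟨m, rfl⟩ := Nat.exists_eq_add_of_le' hd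
  have hV : Module.finrank ℝ (Euc (m + 3)) = m + 3 := finrank_euclideanSpace_fin
  have h2 : 2 ≤ Module.finrank ℝ (Euc (m + 3)) := by omega
  have := nontrivial_of_two_le h2
  have hT := sobTraceConst_nonneg (m + 1) hs
  refine ⟨2 * √(sobTraceConst (m + 1) s) + 1,
    fun Ω p => greatPart m (bestRep s Ω) (p : Euc (m + 3) × Euc (m + 3)), by positivity,
    fun Ω hΩ => ⟨fun ν => ?_, fun B hB => ?_⟩, fun k => ⟨fun Ω hΩ _ => ?_, fun Ω₀ hΩ₀ _ ε hε => ?_⟩⟩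
  · have hd2 : Module.finrank ℝ (perp (ν : Euc (m + 3))) = m + 2 := by
      have := finrank_perp ν; omega
    obtain ⟨hg, hle⟩ := exists_sobEnergy_bestRep_le (m := m + 1) hV (by omega) hs hΩ ν
    have hE : sobEnergy (s - 1 / 2) hg.toLp ≠ ⊤ :=
      ne_top_of_le_ne_top (ENNReal.mul_ne_top ENNReal.ofReal_ne_top (sobEnergy_ne_top hΩ)) hle
    obtain ⟨h3, h4⟩ := memSobolevZero_sub_zonal (by omega) (zonalKernel_sinKernel hd2) hg hE
    refine ⟨h3, h4.trans ?_⟩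
    rw [sobolevNorm_eq hΩ.1]
    calc 2 * sobEnergy (s - 1 / 2) hg.toLp ^ (1 / 2 : ℝ)
        ≤ 2 * (ENNReal.ofReal (sobTraceConst (m + 1) s) * sobEnergy s hΩ.1.toLp) ^ (1 / 2 : ℝ) := by
          gcongr
      _ = ENNReal.ofReal (2 * √(sobTraceConst (m + 1) s)) * sobEnergy s hΩ.1.toLp ^ (1 / 2 : ℝ) := by
          rw [ENNReal.mul_rpow_of_nonneg _ _ (by norm_num), ENNReal.ofReal_mul two_pos.le,
            Real.sqrt_eq_rpow, ENNReal.ofReal_rpow_of_nonneg hT (by norm_num), ENNReal.ofReal_ofNat,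
            mul_assoc]
      _ ≤ _ := by gcongr; linarith
  · have hae := bestRep_ae_eq h2 hs hΩ
    have h0 : ∫ x : USphere (Euc (m + 3)), bestRep s Ω x ∂sphereMeasure (Euc (m + 3)) = 0 :=
      (integral_congr_ae hae).trans hΩ.2.2
    obtain ⟨h3, h4⟩ := integral_greatPart hV (measurable_bestRep s hΩ) (hΩ.1.ae_eq hae.symm)
      (fun ν => (exists_sobEnergy_bestRep_le (m := m + 1) hV (by omega) hs hΩ ν).1) h0 hB
    exact ⟨h3, (setIntegral_congr_ae hB (hae.mono fun x hx _ => hx.symm)).trans h4.symm⟩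
  · obtain ⟨K, -, hK⟩ := exists_ckNorm_greatPart_le h2 m k
    exact (hK Ω _ (bestRep_of_continuous s hΩ.continuous)).1 hΩ
  · obtain ⟨K, hK0, hK⟩ := exists_ckNorm_greatPart_le h2 m k
    have hK1 := (ENNReal.ofReal_pos.2 hK0).ne'
    refine ⟨ε / ENNReal.ofReal K, ENNReal.div_pos hε.ne' ENNReal.ofReal_ne_top,
      fun Ω hΩ _ hlt => ?_⟩
    have hu := bestRep_of_continuous s hΩ.continuous
    have hu₀ := bestRep_of_continuous s hΩ₀.continuous
    have h3 := (hK (fun θ => Ω θ - Ω₀ θ) (fun x => bestRep s Ω x - bestRep s Ω₀ x)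
      fun x => by rw [hu, hu₀]).2
    have h4 : (fun p : orthoPairs (m + 3) => greatPart m (bestRep s Ω) p -
        greatPart m (bestRep s Ω₀) p)
        = fun p : orthoSet (Euc (m + 3)) =>
          greatPart m (fun x => bestRep s Ω x - bestRep s Ω₀ x) p := funext fun p =>
      (greatPart_sub h2 m (hΩ.continuous.congr fun x => (hu x).symm)
        (hΩ₀.continuous.congr fun x => (hu₀ x).symm) p.2).symm
    refine (le_of_eq (congrArg (ckNorm k) h4)).trans_lt (h3.trans_lt ?_)
    rw [mul_comm]
    exact (ENNReal.lt_div_iff_mul_lt (Or.inl hK1) (Or.inl ENNReal.ofReal_ne_top)).1 hlt
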